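/- **Setting.** Let $d\ge 1$ and let ${\rm g}=({\rm g}_{ij})$ be a smooth Riemannian metric on $\mathbb R^d$ with inverse $({\rm g}^{ij})$ and Riemann curvature tensor ${\rm R}_{ijkl}$. Let $M\ge 1$, $c>0$, and let $(B_\beta)$ be constants indexed by multi-indices. Assume $$\|{\rm R}_{ijkl}\|_{L^\infty}+\|{\rm g}_{ij}-\delta_{ij}\|_{\rm Lip}+\|\nabla^2_x{\rm g}_{ij}\|_{BMO}\le c, \tag{1}$$ $$\|\partial_x^\beta {\rm g}^{ij}\|_{L^\infty}\le B_\beta M^{|\beta|-1}\ \ (|\beta|\ge 1),\qquad \|\partial_x^\beta {\rm R}_{ijkl}\|_{L^\infty}\le B_\beta M^{|\beta|}\ \ (|\beta|\ge 0), \tag{2}$$ where each norm in (1) is the maximum over components and the Lipschitz norm is the supremum norm plus the best Lipschitz constant. Let $p_M(x,\eta)=\bigl(\sum_{ij}{\rm g}^{ij}(x)\eta_i\eta_j\bigr)^{1/2}$, and for $\eta\ne 0$ let $(x(t,y,\eta),\xi(t,y,\eta))$, $t\in\mathbb R$, be the solution, with $\xi\neq 0$, of $$\dot x=\nabla_\xi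 p_M(x,\xi),\qquad \dot\xi=-\nabla_x p_M(x,\xi),\qquad x(0,y,\eta)=y,\quad \xi(0,y,\eta)=\eta .$$ **Theorem.** There are $c_d>0$ and $K_d$, depending only on $d$, and for every family $(B_\beta)$ there are constants $C_{\alpha,\beta}$, depending only on $d$ and $(B_\beta)$, such that the following holds for all $M\ge 1$, all $0<c\le c_d$ and all ${\rm g}$ satisfying (1) and (2). The Hamiltonian flow exists for all $t\in\mathbb R$, $y\in\mathbb R^d$, $\eta\ne 0$. If $|t|\le 1$ and $\eta\neq 0$, the map $y\mapsto x(t,y,\eta)$ is a smooth diffeomorphism of $\mathbb R^d$ onto itself. Its inverse $x\mapsto y(t,x,\eta)$ and the function $\xi(t,x,\eta):=\xi(t,y(t,x,\eta),\eta)$ are, for each such $t$, smooth in $(x,\eta)\in\mathbb R^d\times(\mathbb R^d\setminus\{0\})$. For all $|t|\le 1$, $x\in\mathbb R^d$, $\eta\ne0$, one has $|\partial_x y(t,x,\eta)-{\rm I}|\le K_d\,c$, and $$|\partial_x^\beta\partial_\eta^\alpha y(t,x,\eta)|\le C_{\alpha,\beta}\,M^{|\alpha|+|\beta|-1}|\eta|^{-|\alpha|},\qquad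 |\alpha|+|\beta|\ge 1,$$ $$|\partial_x^\beta\partial_\eta^\alpha y(t,x,\eta)|\le C_{\alpha,\beta}\,|t|\,M^{|\alpha|+|\beta|-1}|\eta|^{-|\alpha|},\qquad |\alpha|\ge 1\ \text{ or }\ |\beta|\ge 2,$$ $$|\partial_x^\beta\partial_\eta^\alpha \xi(t,x,\eta)|\le C_{\alpha,\beta}\,M^{|\alpha|+|\beta|-1}|\eta|^{1-|\alpha|},\qquad |\alpha|+|\beta|\ge 1.$$ -/

import Mathlib

open scoped ENNReal ContDiff Gradient

noncomputable section

namespace RoughWave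

/-- Euclidean space of dimension `d`. -/
abbrev E (d : ℕ) : Type := EuclideanSpace ℝ (Fin d)

/-! ### Partial derivatives and multi-indices -/

/-- The partial derivative `∂_i f`. -/
def partialDeriv {d : ℕ} {F : Type*} [NormedAddCommGroup F] [NormedSpace ℝ F]
    (i : Fin d) (f : E d → F) : E d → F :=
  fun x => fderiv ℝ f x (EuclideanSpace.single i (1 : ℝ))

/-- The length `|β| = β_1 + ... + β_d` of a multi-index. -/
def order {d : ℕ} (β : Fin d → ℕ) : ℕ := ∑ i, β i

/-- `∂^β f = ∂_1^{β_1} ... ∂_d^{β_d} f`. -/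
def multiDeriv {d : ℕ} {F : Type*} [NormedAddCommGroup F] [NormedSpace ℝ F]
    (β : Fin d → ℕ) (f : E d → F) : E d → F :=
  (List.finRange d).foldr (fun i h => (partialDeriv i)^[β i] h) f

/-- `∂_x^β ∂_η^α u (x, η)` for a function `u` of two variables `x` and `η`. -/
def mixedDeriv {d : ℕ} (β α : Fin d → ℕ) (u : E d → E d → E d) (x η : E d) : E d :=
  multiDeriv β (fun x' => multiDeriv α (fun η' => u x' η') η) x

/-! ### Norms of functions -/

/-- The supremum norm; it is the `L^∞` norm for the continuous functions it is applied to. -/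
def supNorm {d : ℕ} (f : E d → ℝ) : ℝ≥0∞ := ⨆ x, ‖f x‖ₑ

/-- The Lipschitz norm: supremum norm plus best Lipschitz constant. -/
def lipNorm {d : ℕ} (f : E d → ℝ) : ℝ≥0∞ :=
  supNorm f + ⨆ (x : E d) (y : E d), edist (f x) (f y) / edist x y

/-- The BMO seminorm: the supremum over balls of the mean oscillation. -/
def bmoNorm {d : ℕ} (f : E d → ℝ) : ℝ≥0∞ :=
  ⨆ (x : E d) (r : ℝ) (_ : 0 < r),
    ⨍⁻ z in Metric.ball x r, ‖f z - ⨍ w in Metric.ball x r, f w ∂MeasureTheory.volume‖ₑ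
      ∂MeasureTheory.volume

/-! ### Riemannian metrics on Euclidean space -/

/-- `g = (g_ij)` is a smooth Riemannian metric (`PosDef` includes symmetry). -/
structure IsSmoothMetric {d : ℕ} (g : E d → Matrix (Fin d) (Fin d) ℝ) : Prop where
  smooth : ∀ i j, ContDiff ℝ ∞ (fun x => g x i j)
  posDef : ∀ x, (g x).PosDef

/-- The components `g^{ij}` of the inverse matrix. -/
def metricInv {d : ℕ} (g : E d → Matrix (Fin d) (Fin d) ℝ) (i j : Fin d) (x : E d) : ℝ :=
  (g x)⁻¹ i j

/-- The Christoffel symbols `Γ^n_{ij}`. -/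
def christoffel {d : ℕ} (g : E d → Matrix (Fin d) (Fin d) ℝ) (n i j : Fin d) (x : E d) : ℝ :=
  (1 / 2 : ℝ) * ∑ m, metricInv g n m x *
    (partialDeriv i (fun z => g z j m) x + partialDeriv j (fun z => g z i m) x
      - partialDeriv m (fun z => g z i j) x)

/-- The curvature components `R^n_{jkl}`, i.e. `R(∂_k, ∂_l) ∂_j = ∑ n, R^n_{jkl} ∂_n`. -/
def riemannUp {d : ℕ} (g : E d → Matrix (Fin d) (Fin d) ℝ) (n j k l : Fin d) (x : E d) : ℝ :=
  partialDeriv k (christoffel g n l j) x - partialDeriv l (christoffel g n k j) x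
    + ∑ m, (christoffel g n k m x * christoffel g m l j x
      - christoffel g n l m x * christoffel g m k j x)

/-- The Riemann curvature tensor `R_{ijkl} = ∑ n, g_{in} R^n_{jkl}`. -/
def riemann {d : ℕ} (g : E d → Matrix (Fin d) (Fin d) ℝ) (i j k l : Fin d) (x : E d) : ℝ :=
  ∑ n, g x i n * riemannUp g n j k l x

/-- The smallness condition
`‖R_{ijkl}‖_{L^∞} + ‖g_{ij} - δ_{ij}‖_{Lip} + ‖∇² g_{ij}‖_{BMO} ≤ c`,
each norm being the largest one among the components. -/
def SmallMetric {d : ℕ} (g : E d → Matrix (Fin d) (Fin d) ℝ) (c : ℝ) : Prop :=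
  (⨆ (i : Fin d) (j : Fin d) (k : Fin d) (l : Fin d), supNorm (riemann g i j k l))
    + (⨆ (i : Fin d) (j : Fin d),
        lipNorm (fun x => g x i j - (1 : Matrix (Fin d) (Fin d) ℝ) i j))
    + (⨆ (i : Fin d) (j : Fin d) (k : Fin d) (l : Fin d),
        bmoNorm (partialDeriv k (partialDeriv l (fun x => g x i j))))
    ≤ ENNReal.ofReal c

/-- The derivative bounds with parameter `M` and constants `B β`:
`|∂^β g^{ij}| ≤ B_β M^{|β|-1}` for `|β| ≥ 1`, and `|∂^β R_{ijkl}| ≤ B_β M^{|β|}` for all `β`. -/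
structure DerivBounds {d : ℕ} (g : E d → Matrix (Fin d) (Fin d) ℝ)
    (B : (Fin d → ℕ) → ℝ) (M : ℝ) : Prop where
  metric : ∀ β : Fin d → ℕ, 1 ≤ order β → ∀ i j x,
    |multiDeriv β (metricInv g i j) x| ≤ B β * M ^ (order β - 1)
  curvature : ∀ β : Fin d → ℕ, ∀ i j k l x,
    |multiDeriv β (riemann g i j k l) x| ≤ B β * M ^ order β

/-! ### The Hamiltonian flow -/

/-- `p(x, η) = (∑ g^{ij}(x) η_i η_j)^{1/2}`. -/
def hamiltonian {d : ℕ} (g : E d → Matrix (Fin d) (Fin d) ℝ) (x η : E d) : ℝ :=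
  Real.sqrt (∑ i, ∑ j, metricInv g i j x * η i * η j)

/-- `(X t y η, Ξ t y η)` is the solution of Hamilton's equations for `p` with initial data
`(y, η)`, `η ≠ 0`; it is a curve in the set `ξ ≠ 0`, where `p` is smooth. -/
structure IsHamiltonianFlow {d : ℕ} (g : E d → Matrix (Fin d) (Fin d) ℝ)
    (X Ξ : ℝ → E d → E d → E d) : Prop where
  init_pos : ∀ y η, η ≠ 0 → X 0 y η = y
  init_mom : ∀ y η, η ≠ 0 → Ξ 0 y η = η
  mom_ne_zero : ∀ t y η, η ≠ 0 → Ξ t y η ≠ 0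
  deriv_pos : ∀ t y η, η ≠ 0 →
    HasDerivAt (fun s => X s y η) (∇ (fun ζ => hamiltonian g (X t y η) ζ) (Ξ t y η)) t
  deriv_mom : ∀ t y η, η ≠ 0 →
    HasDerivAt (fun s => Ξ s y η) (-∇ (fun z => hamiltonian g z (Ξ t y η)) (X t y η)) t

end RoughWave

end

section

open Set Filter Topology Metric
open scoped NNReal

universe u
set_option maxSynthPendingDepth 3

/-! ### Smooth dependence of solutions of ordinary differential equations on parameters -/

/-! Linearizing Hamilton's equations naively brings in second derivatives of the metric, which the
hypotheses bound only by a multiple of `M`; Grönwall's inequality would then produce factors like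
`exp M`. The remedy is geometric. In terms of the Christoffel symbols the system reads `ẋ = v(x,
ξ)`, `ξ̇ = Q(x)(v, ξ)`. If `(J, T)` is a variation of a solution, the covariant variation `(J, T -
Q(J, ξ))` solves a linear equation whose coefficients contain only `v`, `Dv`, `Q` and the
antisymmetrized derivative of `Q` (`hasDerivAt_covar`). That last tensor is curvature plus products
of Christoffel symbols, so it is bounded and each of its derivatives costs one factor `M`
(`symb_curv_coeff`).

The bookkeeping is the class `Symb`. In weight `0` the `k`-th derivative is `O(M ^ k)`; in weight
`1` it is `O(M ^ (k - 1))` with truncated subtraction, so the function and its first derivative are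
both bounded. The metric and the velocity have weight `1`, the connection and the curvature weight
`0`. Derivatives of order `n` of the coefficients along the flow involve derivatives of the flow of
order at most `n`, that is, derivatives of order less than `n` of its differential. Hence the linear
equation bounds the differential of the flow by induction on `n` (`symb_fderiv`), and the formula
for the differential of the inverse position map bounds that map in the same way
(`symb_fderiv_inv`). The index set of the families consists of all admissible metrics, flows and
times `|t| ≤ 1`, so uniformity over it says that the constants depend only on `d` and `B`.

Smallness of `c` enters twice. It makes `g` comparable to the Euclidean metric, and it makes `Q`,
the curvature tensor and the `x`-derivative of `v` of size `O(c)`. A covariant variation starting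
near `(h, 0)` then stays `O(c) ‖h‖`-close to it, and its first component is `∂_y x` applied to `h`
(`exists_norm_posJac_sub_one_le`). A Jacobian within `1 / 2` of the identity gives a global
diffeomorphism. The factor `|t|` comes from the same bounds for the displacement divided by `t`.

All this takes place for `ξ` in an annulus: conservation of `p` keeps trajectories in a larger
annulus, where the field is smooth and bounded and can be cut off outside. Homogeneity in `η`
carries the results to all `η ≠ 0` with the stated powers of `‖η‖`. -/

theorem norm_le_of_deriv_le_Icc {F : Type*} [NormedAddCommGroup F] [NormedSpace ℝ F]
    {f f' : ℝ → F} {K ε : ℝ} (hK : 0 ≤ K) (hε : 0 ≤ ε)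
    (hf : ∀ t ∈ Icc (0 : ℝ) 1, HasDerivWithinAt f (f' t) (Icc 0 1) t)
    (hb : ∀ t ∈ Icc (0 : ℝ) 1, ‖f' t‖ ≤ K * ‖f t‖ + ε) :
    ∀ t ∈ Icc (0 : ℝ) 1, ‖f t‖ ≤ (‖f 0‖ + ε) * Real.exp (K + 1) := by
  intro t ht
  -- The rate `K + 1` instead of `K` is never zero, so `gronwallBound` has its exponential form and
  -- `ε / (K + 1) ≤ ε`.
  have h := norm_le_gronwallBound_of_norm_deriv_right_le (f := f) (f' := f') (δ := ‖f 0‖)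
    (K := K + 1) (ε := ε) (a := 0) (b := 1)
    (fun s hs => (hf s hs).continuousWithinAt)
    (fun s hs => (hf s ⟨hs.1, hs.2.le⟩).mono_of_mem_nhdsWithin
      (mem_of_superset (Icc_mem_nhdsGE hs.2) (Icc_subset_Icc_left hs.1))) le_rfl
    (fun s hs => (hb s ⟨hs.1, hs.2.le⟩).trans (by nlinarith [norm_nonneg (f s)])) t ht
  refine h.trans ?_
  rw [gronwallBound_of_K_ne_0 (by positivity)]
  have h1 : Real.exp ((K + 1) * (t - 0)) ≤ Real.exp (K + 1) :=
    Real.exp_le_exp.2 (by nlinarith [ht.2])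
  have h2 : ε / (K + 1) ≤ ε := div_le_self hε (by linarith)
  have h3 : 0 ≤ Real.exp ((K + 1) * (t - 0)) - 1 := by
    have := Real.add_one_le_exp ((K + 1) * (t - 0))
    nlinarith [ht.1]
  have h4 : ε / (K + 1) * (Real.exp ((K + 1) * (t - 0)) - 1) ≤ ε * Real.exp (K + 1) :=
    mul_le_mul h2 (by linarith) h3 hε
  nlinarith [norm_nonneg (f 0)]

theorem norm_le_of_deriv_le_abs {F : Type*} [NormedAddCommGroup F] [NormedSpace ℝ F]
    {f f' : ℝ → F} {K ε : ℝ} (hK : 0 ≤ K) (hε : 0 ≤ ε)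
    (hf : ∀ t, |t| ≤ 1 → HasDerivAt f (f' t) t)
    (hb : ∀ t, |t| ≤ 1 → ‖f' t‖ ≤ K * ‖f t‖ + ε) :
    ∀ t, |t| ≤ 1 → ‖f t‖ ≤ (‖f 0‖ + ε) * Real.exp (K + 1) := by
  intro t ht
  rcases le_total 0 t with h0 | h0
  · refine norm_le_of_deriv_le_Icc (f' := f') hK hε (fun s hs => (hf s ?_).hasDerivWithinAt)
      (fun s hs => hb s ?_) t ⟨h0, (abs_le.1 ht).2⟩ <;>
    exact abs_le.2 ⟨by linarith [hs.1], hs.2⟩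
  · have h := norm_le_of_deriv_le_Icc (f := fun s => f (-s)) (f' := fun s => -f' (-s)) hK hε
      (fun s hs => ?_) (fun s hs => ?_) (-t) ⟨by linarith, by linarith [(abs_le.1 ht).1]⟩
    · simpa using h
    · have hs' : |(-s)| ≤ 1 := by rw [abs_neg]; exact abs_le.2 ⟨by linarith [hs.1], hs.2⟩
      have := (hf (-s) hs').scomp s (hasDerivAt_neg s)
      simpa [Function.comp_def] using this.hasDerivWithinAt
    · rw [norm_neg]
      exact hb (-s) (by rw [abs_neg]; exact abs_le.2 ⟨by linarith [hs.1], hs.2⟩)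

/-- A curve of speed at most `L` cannot leave the ball of radius `L` times the length of the time
interval, so Picard–Lindelöf applies on the whole interval at once. -/
theorem exists_solution_of_bounded_lipschitz {F : Type*} [NormedAddCommGroup F] [NormedSpace ℝ F]
    [CompleteSpace F] {f : ℝ → F → F} {a b t₀ : ℝ} (ht₀ : t₀ ∈ Icc a b) {K L : ℝ≥0}
    (hl : ∀ t ∈ Icc a b, LipschitzWith K (f t)) (hc : ∀ x, ContinuousOn (f · x) (Icc a b))
    (hL : ∀ t ∈ Icc a b, ∀ x, ‖f t x‖ ≤ L) (x₀ : F) :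
    ∃ u : ℝ → F, u t₀ = x₀ ∧ ∀ t ∈ Icc a b, HasDerivWithinAt u (f t (u t)) (Icc a b) t := by
  have hm : 0 ≤ max (b - t₀) (t₀ - a) := le_max_of_le_left (by linarith [ht₀.2])
  have h : IsPicardLindelof f (⟨t₀, ht₀⟩ : Icc a b) x₀ (L * (max (b - t₀) (t₀ - a)).toNNReal) 0 L K :=
    { lipschitzOnWith := fun t ht => (hl t ht).lipschitzOnWith
      continuousOn := fun x _ => hc x
      norm_le := fun t ht x _ => hL t ht x
      mul_max_le := by
        rw [NNReal.coe_mul, Real.coe_toNNReal _ hm, NNReal.coe_zero, sub_zero] }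
  exact h.exists_eq_forall_mem_Icc_hasDerivWithinAt₀

/-- A linear field is not bounded, so it is composed with a cutoff. The cutoff has values in `[0,
1]`, hence the truncated equation obeys the same Grönwall bound, and this bound shows that the
solution never meets the region where the cutoff differs from `1`. -/
theorem exists_solution_of_linear {F : Type*} [NormedAddCommGroup F] [NormedSpace ℝ F]
    [FiniteDimensional ℝ F] {a : ℝ → F →L[ℝ] F} (ha : ContinuousOn a (Icc 0 1)) (x₀ : F) :
    ∃ u : ℝ → F, u 0 = x₀ ∧
      ∀ t ∈ Icc (0 : ℝ) 1, HasDerivWithinAt u (a t (u t)) (Icc 0 1) t := by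
  have : ProperSpace F := FiniteDimensional.proper_real F
  have : CompleteSpace F := FiniteDimensional.complete ℝ F
  obtain ⟨K, hK⟩ := isCompact_Icc.exists_bound_of_continuousOn ha
  have hK0 : 0 ≤ K := (norm_nonneg _).trans (hK 0 (by simp))
  -- The Grönwall bound for the solution, plus `1` to make the radius positive.
  set ρ : ℝ := ‖x₀‖ * Real.exp (K + 1) + 1 with hρ
  have hρ0 : 0 < ρ := by positivity
  let χ : ContDiffBump (0 : F) := ⟨ρ, ρ + 1, hρ0, by linarith⟩
  let h : F → F := fun z => χ z • z
  have hh : ContDiff ℝ 1 h := χ.contDiff.smul contDiff_id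
  have hs : HasCompactSupport h := χ.hasCompactSupport.smul_right
  obtain ⟨k, hk⟩ := ContDiff.lipschitzWith_of_hasCompactSupport hs hh (by norm_num)
  have hh1 : ∀ z, ‖h z‖ ≤ ρ + 1 := by
    intro z
    by_cases hz : z ∈ ball (0 : F) (ρ + 1)
    · rw [mem_ball_zero_iff] at hz
      calc ‖h z‖ = χ z * ‖z‖ := by simp [h, norm_smul, abs_of_nonneg χ.nonneg]
        _ ≤ 1 * ‖z‖ := by gcongr; exact χ.le_one
        _ ≤ ρ + 1 := by linarith
    · have : χ z = 0 := χ.zero_of_le_dist (by simpa [not_lt] using hz)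
      simp only [h, this, zero_smul, norm_zero]; positivity
  obtain ⟨u, hu0, hu⟩ := exists_solution_of_bounded_lipschitz (f := fun t z => a t (h z))
    (a := 0) (b := 1) (t₀ := 0) (K := ⟨K, hK0⟩ * k) (L := ⟨K * (ρ + 1), by positivity⟩) (by simp)
    (fun t ht => ((a t).lipschitz.weaken (by exact hK t ht)).comp hk)
    (fun x => ha.clm_apply continuousOn_const)
    (fun t ht x => by
      refine ((a t).le_opNorm _).trans ?_
      exact mul_le_mul (hK t ht) (hh1 x) (norm_nonneg _) hK0) x₀
  have hb := norm_le_of_deriv_le_Icc hK0 le_rfl hu (fun t ht => by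
    rw [add_zero]
    refine ((a t).le_opNorm _).trans ?_
    refine mul_le_mul (hK t ht) ?_ (norm_nonneg _) hK0
    calc ‖h (u t)‖ = χ (u t) * ‖u t‖ := by simp [h, norm_smul, abs_of_nonneg χ.nonneg]
      _ ≤ 1 * ‖u t‖ := by gcongr; exact χ.le_one
      _ = ‖u t‖ := one_mul _)
  refine ⟨u, hu0, fun t ht => ?_⟩
  have h1 : h (u t) = u t := by
    have : χ (u t) = 1 := χ.one_of_mem_closedBall (by
      rw [mem_closedBall_zero_iff]
      refine (hb t ht).trans ?_
      rw [hu0, add_zero]; simp only [χ, hρ]; linarith)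
    simp [h, this]
  have := hu t ht
  rwa [h1] at this

theorem ContDiff.exists_lipschitzOnWith_closedBall {F G : Type*} [NormedAddCommGroup F]
    [NormedSpace ℝ F] [FiniteDimensional ℝ F] [NormedAddCommGroup G] [NormedSpace ℝ G]
    {V : F → G} (hV : ContDiff ℝ 1 V) (R : ℝ) :
    ∃ K : ℝ≥0, (∀ z ∈ closedBall (0 : F) R, ‖fderiv ℝ V z‖ ≤ K) ∧
      LipschitzOnWith K V (closedBall 0 R) := by
  have : ProperSpace F := FiniteDimensional.proper_real F
  obtain ⟨K, hK⟩ := (isCompact_closedBall (0 : F) R).exists_bound_of_continuousOn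
    (hV.continuous_fderiv one_ne_zero).continuousOn
  have h : ∀ z ∈ closedBall (0 : F) R, ‖fderiv ℝ V z‖ ≤ (K.toNNReal : ℝ) := fun z hz =>
    (hK z hz).trans (Real.le_coe_toNNReal K)
  exact ⟨K.toNNReal, h, (convex_closedBall 0 R).lipschitzOnWith_of_nnnorm_fderiv_le
    (fun z _ => hV.differentiable one_ne_zero z) h⟩

/-- Solutions of an autonomous equation depend differentiably on parameters, and the derivative
solves the linearized equation. -/
theorem exists_hasFDerivAt_flow {F P : Type*} [NormedAddCommGroup F] [NormedSpace ℝ F]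
    [FiniteDimensional ℝ F] [NormedAddCommGroup P] [NormedSpace ℝ P] [FiniteDimensional ℝ P]
    {V : F → F} (hV : ContDiff ℝ ∞ V) {W : ℝ → P → F} {U : Set P} (hU : IsOpen U)
    (hW : ∀ p ∈ U, ∀ t ∈ Icc (0 : ℝ) 1, HasDerivWithinAt (W · p) (V (W t p)) (Icc 0 1) t)
    {p₀ : P} (hp₀ : p₀ ∈ U) (hW0 : DifferentiableAt ℝ (W 0) p₀) :
    ∃ T : ℝ → P →L[ℝ] F, T 0 = fderiv ℝ (W 0) p₀ ∧
      (∀ t ∈ Icc (0 : ℝ) 1,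
        HasDerivWithinAt T ((fderiv ℝ V (W t p₀)).comp (T t)) (Icc 0 1) t) ∧
      ∀ t ∈ Icc (0 : ℝ) 1, HasFDerivAt (W t) (T t) p₀ := by
  have hγc : ContinuousOn (W · p₀) (Icc 0 1) := fun t ht => (hW p₀ hp₀ t ht).continuousWithinAt
  have hVd : ContDiff ℝ 1 (fderiv ℝ V) := hV.fderiv_right (by norm_cast)
  have ha : ContinuousOn (fun t => ContinuousLinearMap.compL ℝ P F F (fderiv ℝ V (W t p₀)))
      (Icc 0 1) :=
    (ContinuousLinearMap.continuous _).comp_continuousOn (hVd.continuous.comp_continuousOn hγc)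
  obtain ⟨T, hT0, hT⟩ := exists_solution_of_linear ha (fderiv ℝ (W 0) p₀)
  refine ⟨T, hT0, hT, fun t ht => ?_⟩
  -- The reference trajectory lies in the ball of radius `R'`. The Lipschitz and Taylor constants
  -- are taken on radius `R' + 1`, which leaves room for trajectories at distance at most `1`.
  obtain ⟨R', hR'⟩ := isCompact_Icc.exists_bound_of_continuousOn hγc
  obtain ⟨K, hK, hKl⟩ := (hV.of_le (by norm_cast)).exists_lipschitzOnWith_closedBall
    (G := F) (V := V) (R' + 1)
  obtain ⟨K2, -, hK2⟩ := hVd.exists_lipschitzOnWith_closedBall (R' + 1)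
  have hγR : ∀ s ∈ Icc (0 : ℝ) 1, W s p₀ ∈ closedBall (0 : F) (R' + 1) := fun s hs => by
    rw [mem_closedBall_zero_iff]; linarith [hR' s hs]
  have htaylor : ∀ w ∈ closedBall (0 : F) (R' + 1), ∀ z ∈ closedBall (0 : F) (R' + 1),
      ‖V z - V w - fderiv ℝ V w (z - w)‖ ≤ K2 * ‖z - w‖ ^ 2 := by
    intro w hw z hz
    have hconv := (convex_closedBall (0 : F) (R' + 1)).inter (convex_closedBall w ‖z - w‖)
    have := hconv.norm_image_sub_le_of_norm_fderiv_le' (f := V) (φ := fderiv ℝ V w)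
      (C := K2 * ‖z - w‖) (x := w) (y := z)
      (fun x _ => hV.differentiable (by simp) x) (fun x hx => by
        have h1 := hK2.norm_sub_le hx.1 hw
        refine h1.trans ?_
        gcongr
        simpa [dist_eq_norm] using hx.2) ⟨hw, by simp⟩ ⟨hz, by simp [dist_eq_norm]⟩
    rw [pow_two, ← mul_assoc]; exact this
  obtain ⟨C0', hC0'⟩ := hW0.hasFDerivAt.isBigO_sub.bound
  -- Positivity of `C0` makes the barrier used for `hclose` strictly positive when `p ≠ p₀`.
  set C0 := max C0' 1
  have hC0 : 0 < C0 := lt_max_of_lt_right one_pos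
  set C1 := C0 * Real.exp (K + 1) with hC1
  have hC1p : 0 < C1 := by positivity
  have hsmall : ∀ᶠ p in 𝓝 p₀, C1 * ‖p - p₀‖ ≤ 1 := by
    have : Tendsto (fun p => C1 * ‖p - p₀‖) (𝓝 p₀) (𝓝 (C1 * ‖p₀ - p₀‖)) :=
      Continuous.tendsto (by fun_prop) _
    refine this.eventually_le_const ?_
    simp
  have hmain : ∀ᶠ p in 𝓝 p₀, ‖W t p - W t p₀ - T t (p - p₀)‖ ≤
      Real.exp (K + 1) * ‖‖W 0 p - W 0 p₀ - fderiv ℝ (W 0) p₀ (p - p₀)‖ +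
        K2 * C1 ^ 2 * ‖p - p₀‖ ^ 2‖ := by
    filter_upwards [hsmall, hC0', hU.mem_nhds hp₀] with p hp1 hp2 hpU
    rcases eq_or_ne p p₀ with rfl | hne
    · simp
    have hpp : 0 < ‖p - p₀‖ := norm_pos_iff.2 (sub_ne_zero.2 hne)
    have hdiff : ∀ s ∈ Icc (0 : ℝ) 1, HasDerivWithinAt (fun s => W s p - W s p₀)
        (V (W s p) - V (W s p₀)) (Icc 0 1) s := fun s hs =>
      (hW p hpU s hs).sub (hW p₀ hp₀ s hs)
    have hBd : ∀ s, HasDerivAt (fun s => C0 * ‖p - p₀‖ * Real.exp ((K + 1) * s))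
        (C0 * ‖p - p₀‖ * (Real.exp ((K + 1) * s) * (K + 1))) s := fun s => by
      have := ((hasDerivAt_id s).const_mul ((K : ℝ) + 1)).exp.const_mul (C0 * ‖p - p₀‖)
      simpa using this
    have hB1 : ∀ s ∈ Icc (0 : ℝ) 1, C0 * ‖p - p₀‖ * Real.exp ((K + 1) * s) ≤ C1 * ‖p - p₀‖ := by
      intro s hs
      have : Real.exp ((K + 1) * s) ≤ Real.exp (K + 1) :=
        Real.exp_le_exp.2 (by nlinarith [hs.2, K.coe_nonneg])
      rw [hC1]
      calc _ ≤ C0 * ‖p - p₀‖ * Real.exp (K + 1) := by gcongr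
        _ = _ := by ring
    have hclose : ∀ s ∈ Icc (0 : ℝ) 1,
        ‖W s p - W s p₀‖ ≤ C0 * ‖p - p₀‖ * Real.exp ((K + 1) * s) := by
      -- Continuation argument: the Lipschitz bound is available only while `W s p` is in the larger
      -- ball. At a contact time with the barrier it still is, because the barrier is at most `C1 *
      -- ‖p - p₀‖ ≤ 1`, and the barrier grows at rate `K + 1 > K`, so it cannot be crossed.
      refine image_norm_le_of_norm_deriv_right_lt_deriv_boundary
        (f' := fun s => V (W s p) - V (W s p₀))
        (B' := fun s => C0 * ‖p - p₀‖ * (Real.exp ((K + 1) * s) * (K + 1)))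
        (fun s hs => (hdiff s hs).continuousWithinAt)
        (fun s hs => (hdiff s ⟨hs.1, hs.2.le⟩).mono_of_mem_nhdsWithin
          (mem_of_superset (Icc_mem_nhdsGE hs.2) (Icc_subset_Icc_left hs.1))) ?_ hBd ?_
      · simp only [mul_zero, Real.exp_zero, mul_one]
        exact hp2.trans (by gcongr; exact le_max_left _ _)
      · intro s hs heq
        have hs' : s ∈ Icc (0 : ℝ) 1 := ⟨hs.1, hs.2.le⟩
        have hin : W s p ∈ closedBall (0 : F) (R' + 1) := by
          rw [mem_closedBall_zero_iff]
          have h1 := norm_sub_norm_le (W s p) (W s p₀)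
          linarith [hB1 s hs', hR' s hs']
        have h2 := hKl.norm_sub_le hin (hγR s hs')
        refine h2.trans_lt ?_
        rw [heq]
        have : 0 < C0 * ‖p - p₀‖ * Real.exp ((K + 1) * s) := by positivity
        nlinarith
    have hclose' : ∀ s ∈ Icc (0 : ℝ) 1, ‖W s p - W s p₀‖ ≤ C1 * ‖p - p₀‖ := fun s hs =>
      (hclose s hs).trans (hB1 s hs)
    -- The first-order remainder solves the linearized equation up to the quadratic Taylor error of
    -- `V`, so it is bounded by its initial value plus `O(‖p - p₀‖ ^ 2)`.
    have hr := norm_le_of_deriv_le_Icc (f := fun s => W s p - W s p₀ - T s (p - p₀))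
      (f' := fun s => V (W s p) - V (W s p₀) - (fderiv ℝ V (W s p₀)).comp (T s) (p - p₀))
      (K := K) (ε := K2 * C1 ^ 2 * ‖p - p₀‖ ^ 2) K.coe_nonneg (by positivity)
      (fun s hs => (hdiff s hs).sub ((hT s hs).clm_apply (hasDerivWithinAt_const _ _ _) |>.congr_deriv
        (by simp)))
      (fun s hs => by
        have hin : W s p ∈ closedBall (0 : F) (R' + 1) := by
          rw [mem_closedBall_zero_iff]
          have h1 := norm_sub_norm_le (W s p) (W s p₀)
          linarith [hclose' s hs, hR' s hs]
        have h1 := htaylor _ (hγR s hs) _ hin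
        have h2 : V (W s p) - V (W s p₀) - (fderiv ℝ V (W s p₀)).comp (T s) (p - p₀) =
            fderiv ℝ V (W s p₀) (W s p - W s p₀ - T s (p - p₀)) +
            (V (W s p) - V (W s p₀) - fderiv ℝ V (W s p₀) (W s p - W s p₀)) := by
          simp only [ContinuousLinearMap.comp_apply, map_sub]; abel
        rw [h2]
        refine (norm_add_le _ _).trans (add_le_add ?_ (h1.trans ?_))
        · exact ((fderiv ℝ V (W s p₀)).le_opNorm _).trans
            (mul_le_mul_of_nonneg_right (hK _ (hγR s hs)) (norm_nonneg _))
        · calc (K2 : ℝ) * ‖W s p - W s p₀‖ ^ 2 ≤ K2 * (C1 * ‖p - p₀‖) ^ 2 := by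
                gcongr; exact hclose' s hs
            _ = _ := by ring) t ht
    rw [hT0] at hr
    refine hr.trans (le_of_eq ?_)
    rw [Real.norm_of_nonneg (by positivity)]; ring
  rw [hasFDerivAt_iff_isLittleO]
  refine (Asymptotics.IsBigO.of_bound _ hmain).trans_isLittleO ?_
  refine Asymptotics.IsLittleO.add ?_ ?_
  · exact (hasFDerivAt_iff_isLittleO.1 hW0.hasFDerivAt).norm_left
  · have h1 := (Asymptotics.isLittleO_norm_pow_id (E' := P) one_lt_two).comp_tendsto
      (show Tendsto (fun p : P => p - p₀) (𝓝 p₀) (𝓝 0) from by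
        simpa using (continuous_id.sub continuous_const).tendsto (x := p₀) (f := fun p : P => p - p₀))
    exact h1.const_mul_left _

/-- The pair `(W, DW)` again solves a smooth autonomous equation, now on `F × (P →L[ℝ] F)`. Applying
the `n`-th step to the pair gives one more derivative of `W`; this is why the space `F` is
quantified inside the induction. -/
theorem contDiffOn_nat_flow {P : Type u} [NormedAddCommGroup P] [NormedSpace ℝ P]
    [FiniteDimensional ℝ P] {U : Set P} (hU : IsOpen U) (n : ℕ) :
    ∀ {F : Type u} [NormedAddCommGroup F] [NormedSpace ℝ F] [FiniteDimensional ℝ F]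
    {V : F → F} (_ : ContDiff ℝ ∞ V) {W : ℝ → P → F}
    (_ : ∀ p ∈ U, ∀ t ∈ Icc (0 : ℝ) 1, HasDerivWithinAt (W · p) (V (W t p)) (Icc 0 1) t)
    (_ : ContDiffOn ℝ ∞ (W 0) U), ∀ t ∈ Icc (0 : ℝ) 1, ContDiffOn ℝ n (W t) U := by
  induction n with
  | zero =>
    intro F _ _ _ V hV W hW hW0 t ht
    rw [Nat.cast_zero, contDiffOn_zero]
    intro p hp
    obtain ⟨T, -, -, h⟩ := exists_hasFDerivAt_flow hV hU hW hp
      ((hW0.contDiffAt (hU.mem_nhds hp)).differentiableAt (by simp))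
    exact (h t ht).continuousAt.continuousWithinAt
  | succ n ih =>
    intro F _ _ _ V hV W hW hW0 t ht
    have key : ∀ p ∈ U, ∃ T : ℝ → P →L[ℝ] F, T 0 = fderiv ℝ (W 0) p ∧
      (∀ t ∈ Icc (0 : ℝ) 1,
        HasDerivWithinAt T ((fderiv ℝ V (W t p)).comp (T t)) (Icc 0 1) t) ∧
      ∀ t ∈ Icc (0 : ℝ) 1, HasFDerivAt (W t) (T t) p := fun p hp =>
      exists_hasFDerivAt_flow hV hU hW hp
        ((hW0.contDiffAt (hU.mem_nhds hp)).differentiableAt (by simp))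
    have hd : ∀ t ∈ Icc (0 : ℝ) 1, DifferentiableOn ℝ (W t) U := fun t ht p hp => by
      obtain ⟨T, -, -, h⟩ := key p hp
      exact (h t ht).differentiableAt.differentiableWithinAt
    have h2 := ih (F := F × (P →L[ℝ] F))
      (V := fun z => (V z.1, (fderiv ℝ V z.1).comp z.2))
      (hV.fst'.prodMk (((hV.fderiv_right (m := ∞) (by norm_cast)).comp contDiff_fst).clm_comp
        contDiff_snd))
      (W := fun t p => (W t p, fderiv ℝ (W t) p))
      (fun p hp t ht => by
        refine (hW p hp t ht).prodMk ?_
        obtain ⟨T, -, hT, h⟩ := key p hp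
        rw [(h t ht).fderiv]
        exact (hT t ht).congr_of_mem (fun s hs => (h s hs).fderiv) ht)
      (hW0.prodMk ((contDiffOn_infty_iff_fderiv_of_isOpen hU).1 hW0).2) t ht
    rw [Nat.cast_add, Nat.cast_one, contDiffOn_succ_iff_fderiv_of_isOpen hU]
    exact ⟨hd t ht, by simp, h2.snd⟩

/-- The solutions of a smooth autonomous equation, with initial values depending smoothly on a
parameter, are jointly smooth in time and the parameter. -/
theorem contDiffOn_flow {P F : Type u} [NormedAddCommGroup P] [NormedSpace ℝ P]
    [FiniteDimensional ℝ P] {U : Set P} (hU : IsOpen U) [NormedAddCommGroup F] [NormedSpace ℝ F]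
    [FiniteDimensional ℝ F] {V : F → F} (hV : ContDiff ℝ ∞ V) {W : ℝ → P → F}
    (hW : ∀ p ∈ U, ∀ t, HasDerivAt (W · p) (V (W t p)) t) (hW0 : ContDiffOn ℝ ∞ (W 0) U) :
    ContDiffOn ℝ ∞ (fun z : ℝ × P => W z.1 z.2) (univ ×ˢ U) := by
  -- Time is about to become both a parameter and a state variable, so it has to live in the
  -- universe of `P` and `F`.
  let R := ULift.{u} ℝ
  let e : R ≃L[ℝ] ℝ := ContinuousLinearEquiv.ulift
  have h : ContDiffOn ℝ ∞ (fun z : R × P => W (e z.1) z.2) (univ ×ˢ U) := by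
    rw [contDiffOn_infty]
    intro n
    -- Rescaling: `τ ↦ (t, W (t τ) p)` solves the autonomous equation with field `(0, t V)`. Its
    -- value at `τ = 1` is smooth in the parameter `(t, p)`, which is joint smoothness.
    have := contDiffOn_nat_flow (P := R × P) (isOpen_univ.prod hU) n (F := R × F)
      (V := fun z => (0, e z.1 • V z.2))
      (contDiff_const.prodMk (((e : R →L[ℝ] ℝ).contDiff.comp contDiff_fst).smul
        (hV.comp contDiff_snd)))
      (W := fun τ z => (z.1, W (e z.1 * τ) z.2))
      (fun z hz τ _ => by
        refine (hasDerivWithinAt_const _ _ _).prodMk ?_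
        have h1 := (hW z.2 hz.2 (e z.1 * τ)).scomp τ ((hasDerivAt_id τ).const_mul (e z.1))
        simpa [Function.comp_def] using h1.hasDerivWithinAt)
      (by
        simp only [mul_zero]
        exact contDiffOn_fst.prodMk (hW0.comp contDiffOn_snd fun z hz => hz.2)) 1 (by simp)
    simpa using this.snd
  exact h.comp (((e.symm : ℝ →L[ℝ] R).contDiff.comp contDiff_fst).prodMk contDiff_snd).contDiffOn
    (fun z hz => ⟨trivial, hz.2⟩) |>.congr fun z _ => by simp

/-! ### Families of functions with uniform symbol bounds -/

/-- `f i` is smooth on the open set `Ω i`, and `‖D^k (f i)‖ ≤ C_k (M i) ^ (k - a)` there for `k ≤ N`,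
with constants `C_k` that do not depend on `i`. -/
structure Symb {ι F G : Type*} [NormedAddCommGroup F] [NormedSpace ℝ F] [NormedAddCommGroup G]
    [NormedSpace ℝ G] (N a : ℕ) (M : ι → ℝ) (Ω : ι → Set F) (f : ι → F → G) : Prop where
  one_le : ∀ i, 1 ≤ M i
  isOpen : ∀ i, IsOpen (Ω i)
  smooth : ∀ i, ContDiffOn ℝ ∞ (f i) (Ω i)
  bound : ∀ k ≤ N, ∃ C : ℝ, ∀ i, ∀ w ∈ Ω i, ‖iteratedFDeriv ℝ k (f i) w‖ ≤ C * M i ^ (k - a)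

/-- A dilation by `N` is inserted between `f` and `φ`. It normalizes the factors `N ^ k` in the
derivatives of `φ` and costs a single factor `N` in each derivative of `f`. Inner derivatives of
size `N ^ (k - 1)` and outer ones of size `N ^ k` therefore compose to `N ^ n` without loss. -/
theorem norm_iteratedFDeriv_comp_le_of_isOpen {F G H : Type*} [NormedAddCommGroup F]
    [NormedSpace ℝ F] [NormedAddCommGroup G] [NormedSpace ℝ G] [NormedAddCommGroup H]
    [NormedSpace ℝ H] {φ : G → H} {f : F → G} {Ω : Set F} {Ω' : Set G} (hΩ : IsOpen Ω)
    (hΩ' : IsOpen Ω') (hφ : ContDiffOn ℝ ∞ φ Ω') (hf : ContDiffOn ℝ ∞ f Ω) (hm : MapsTo f Ω Ω')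
    {x : F} (hx : x ∈ Ω) {n : ℕ} {C D N : ℝ} (hN : 0 < N)
    (hC : ∀ k ≤ n, ‖iteratedFDeriv ℝ k φ (f x)‖ ≤ C * N ^ k)
    (hD : ∀ k, 1 ≤ k → k ≤ n → N * ‖iteratedFDeriv ℝ k f x‖ ≤ D ^ k) :
    ‖iteratedFDeriv ℝ n (φ ∘ f) x‖ ≤ n.factorial * C * D ^ n := by
  let g : G →L[ℝ] G := N⁻¹ • ContinuousLinearMap.id ℝ G
  have hg : ∀ z, g (N • z) = z := fun z => by simp [g, smul_smul, hN.ne']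
  have hgo : IsOpen (g ⁻¹' Ω') := hΩ'.preimage g.continuous
  have hle : ‖g‖ ≤ N⁻¹ := by
    refine (norm_smul_le N⁻¹ (ContinuousLinearMap.id ℝ G)).trans ?_
    rw [Real.norm_of_nonneg (by positivity)]
    exact mul_le_of_le_one_right (by positivity) ContinuousLinearMap.norm_id_le
  have hmaps : MapsTo (fun y => N • f y) Ω (g ⁻¹' Ω') := fun y hy => by
    rw [mem_preimage, hg]; exact hm hy
  have h := norm_iteratedFDerivWithin_comp_le (𝕜 := ℝ) (g := φ ∘ g) (f := fun y => N • f y)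
    (n := n) (N := ∞) (C := C) (D := D) (s := Ω) (t := g ⁻¹' Ω') (x := x)
    (hφ.comp g.contDiff.contDiffOn fun z hz => hz) (contDiffOn_const.smul hf) (by norm_cast; simp)
    hgo.uniqueDiffOn hΩ.uniqueDiffOn hmaps hx
    (fun k hk => by
      have hmem : g (N • f x) ∈ Ω' := hmaps hx
      rw [g.iteratedFDerivWithin_comp_right hφ hΩ'.uniqueDiffOn hgo.uniqueDiffOn hmem
        (by norm_cast; simp), hg, iteratedFDerivWithin_of_isOpen k hΩ' (hm hx)]
      refine (ContinuousMultilinearMap.norm_compContinuousLinearMap_le _ _).trans ?_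
      rw [Finset.prod_const, Finset.card_univ, Fintype.card_fin]
      calc _ ≤ C * N ^ k * N⁻¹ ^ k := by
            have := hC k hk
            have h0 := (norm_nonneg _).trans this
            gcongr
        _ = C := by rw [mul_assoc, ← mul_pow, mul_inv_cancel₀ hN.ne', one_pow, mul_one])
    (fun k hk hk' => by
      rw [iteratedFDerivWithin_of_isOpen k hΩ hx]
      have : (fun y => N • f y) = N • f := rfl
      rw [this, iteratedFDeriv_const_smul_apply
        ((hf.contDiffAt (hΩ.mem_nhds hx)).of_le (by norm_cast; simp)), norm_smul,
        Real.norm_of_nonneg hN.le]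
      exact hD k hk hk')
  rw [iteratedFDerivWithin_of_isOpen n hΩ hx] at h
  have he : (φ ∘ g) ∘ (fun y => N • f y) = φ ∘ f := by
    funext y; simp only [Function.comp_apply, hg]
  rwa [he] at h

/-- Brings arbitrary constants into the geometric form required by the composition estimate: the
powers of a number `≥ 1` that dominates all the constants dominate them too. -/
theorem exists_pow_bound (C : ℕ → ℝ) (n : ℕ) :
    ∃ D : ℝ, 1 ≤ D ∧ ∀ k, 1 ≤ k → k ≤ n → C k ≤ D ^ k := by
  refine ⟨1 + ∑ k ∈ Finset.range (n + 1), |C k|, ?_, fun k hk hkn => ?_⟩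
  · have : 0 ≤ ∑ k ∈ Finset.range (n + 1), |C k| := Finset.sum_nonneg fun _ _ => abs_nonneg _
    linarith
  · have h0 : 0 ≤ ∑ k ∈ Finset.range (n + 1), |C k| := Finset.sum_nonneg fun _ _ => abs_nonneg _
    have h1 : |C k| ≤ ∑ k ∈ Finset.range (n + 1), |C k| :=
      Finset.single_le_sum (f := fun k => |C k|) (fun _ _ => abs_nonneg _)
        (Finset.mem_range.2 (by omega))
    calc C k ≤ |C k| := le_abs_self _
      _ ≤ 1 + ∑ k ∈ Finset.range (n + 1), |C k| := by linarith
      _ ≤ _ := le_self_pow₀ (by linarith) (by omega)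

/-! ### Calculus of symbol classes: products, linear maps, derivatives, compositions. -/

namespace Symb

variable {ι κ F G H K P : Type*} [NormedAddCommGroup F] [NormedSpace ℝ F] [NormedAddCommGroup G]
  [NormedSpace ℝ G] [NormedAddCommGroup H] [NormedSpace ℝ H] [NormedAddCommGroup K]
  [NormedSpace ℝ K] [NormedAddCommGroup P] [NormedSpace ℝ P]
  {N N' a : ℕ} {M : ι → ℝ} {Ω : ι → Set F} {f g : ι → F → G}

theorem bound_nonneg (hf : Symb N a M Ω f) {k : ℕ} (hk : k ≤ N) :
    ∃ C : ℝ, 0 ≤ C ∧ ∀ i, ∀ w ∈ Ω i, ‖iteratedFDeriv ℝ k (f i) w‖ ≤ C * M i ^ (k - a) := by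
  obtain ⟨C, hC⟩ := hf.bound k hk
  refine ⟨max C 0, le_max_right _ _, fun i w hw => (hC i w hw).trans ?_⟩
  have := hf.one_le i
  gcongr
  exact le_max_left _ _

theorem mono (hf : Symb N a M Ω f) (h : N' ≤ N) : Symb N' a M Ω f :=
  ⟨hf.one_le, hf.isOpen, hf.smooth, fun k hk => hf.bound k (hk.trans h)⟩

theorem mono_weight (hf : Symb N a M Ω f) {b : ℕ} (h : b ≤ a) : Symb N b M Ω f := by
  refine ⟨hf.one_le, hf.isOpen, hf.smooth, fun k hk => ?_⟩
  obtain ⟨C, hC0, hC⟩ := hf.bound_nonneg hk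
  refine ⟨C, fun i w hw => (hC i w hw).trans ?_⟩
  have := hf.one_le i
  gcongr

theorem mono_set {Ω' : ι → Set F} (hf : Symb N a M Ω f) (ho : ∀ i, IsOpen (Ω' i))
    (h : ∀ i, Ω' i ⊆ Ω i) : Symb N a M Ω' f := by
  refine ⟨hf.one_le, ho, fun i => (hf.smooth i).mono (h i), fun k hk => ?_⟩
  obtain ⟨C, hC⟩ := hf.bound k hk
  exact ⟨C, fun i w hw => hC i w (h i hw)⟩

theorem reindex (hf : Symb N a M Ω f) (e : κ → ι) :
    Symb N a (fun j => M (e j)) (fun j => Ω (e j)) (fun j => f (e j)) := by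
  refine ⟨fun j => hf.one_le _, fun j => hf.isOpen _, fun j => hf.smooth _, fun k hk => ?_⟩
  obtain ⟨C, hC⟩ := hf.bound k hk
  exact ⟨C, fun j w hw => hC _ w hw⟩

theorem congr (hf : Symb N a M Ω f) (h : ∀ i, EqOn (g i) (f i) (Ω i)) : Symb N a M Ω g := by
  refine ⟨hf.one_le, hf.isOpen, fun i => (hf.smooth i).congr (h i), fun k hk => ?_⟩
  obtain ⟨C, hC⟩ := hf.bound k hk
  refine ⟨C, fun i w hw => ?_⟩
  rw [((h i).eventuallyEq_of_mem ((hf.isOpen i).mem_nhds hw)).iteratedFDeriv ℝ k |>.eq_of_nhds]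
  exact hC i w hw

theorem contDiffAt (hf : Symb N a M Ω f) {i : ι} {w : F} (hw : w ∈ Ω i) :
    ContDiffAt ℝ ∞ (f i) w := (hf.smooth i).contDiffAt ((hf.isOpen i).mem_nhds hw)

theorem differentiableAt (hf : Symb N a M Ω f) {i : ι} {w : F} (hw : w ∈ Ω i) :
    DifferentiableAt ℝ (f i) w := (hf.contDiffAt hw).differentiableAt (by simp)

theorem norm_le (hf : Symb N a M Ω f) : ∃ C : ℝ, 0 ≤ C ∧ ∀ i, ∀ w ∈ Ω i, ‖f i w‖ ≤ C := by
  obtain ⟨C, h0, hC⟩ := hf.bound_nonneg (Nat.zero_le _)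
  exact ⟨C, h0, fun i w hw => by simpa using hC i w hw⟩

theorem const_family (hM : ∀ i, 1 ≤ M i) (hΩ : ∀ i, IsOpen (Ω i)) {c : ι → G} {C : ℝ}
    (hc : ∀ i, ‖c i‖ ≤ C) : Symb N a M Ω (fun i _ => c i) := by
  refine ⟨hM, hΩ, fun i => contDiffOn_const, fun k _ => ?_⟩
  rcases k with _ | k
  · exact ⟨C, fun i w _ => by simpa using hc i⟩
  · exact ⟨0, fun i w _ => by simp [iteratedFDeriv_succ_const]⟩

theorem const (hM : ∀ i, 1 ≤ M i) (hΩ : ∀ i, IsOpen (Ω i)) (c : G) :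
    Symb N a M Ω (fun _ _ => c) := const_family hM hΩ (C := ‖c‖) fun _ => le_rfl

theorem bilin {h : ι → F → H} (B : G →L[ℝ] H →L[ℝ] K) (ha : a ≤ 1) (hf : Symb N a M Ω f)
    (hh : Symb N a M Ω h) : Symb N a M Ω (fun i w => B (f i w) (h i w)) := by
  refine ⟨hf.one_le, hf.isOpen, fun i => ?_, fun k hk => ?_⟩
  · exact (B.contDiff.comp_contDiffOn (hf.smooth i)).clm_apply (hh.smooth i)
  choose! C hC0 hC using fun k (hk : k ≤ N) => hf.bound_nonneg hk
  choose! D hD0 hD using fun k (hk : k ≤ N) => hh.bound_nonneg hk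
  refine ⟨‖B‖ * ∑ j ∈ Finset.range (k + 1), (k.choose j : ℝ) * C j * D (k - j), fun i w hw => ?_⟩
  have hU := (hf.isOpen i).uniqueDiffOn (𝕜 := ℝ)
  have h1 := B.norm_iteratedFDerivWithin_le_of_bilinear (hf.smooth i) (hh.smooth i) hU hw
    (n := k) (by norm_cast; simp)
  rw [iteratedFDerivWithin_of_isOpen k (hf.isOpen i) hw] at h1
  refine h1.trans ?_
  rw [mul_assoc, Finset.sum_mul]
  refine mul_le_mul_of_nonneg_left (Finset.sum_le_sum fun j hj => ?_) B.opNorm_nonneg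
  have hj : j ≤ k := Nat.lt_succ_iff.1 (Finset.mem_range.1 hj)
  rw [iteratedFDerivWithin_of_isOpen j (hf.isOpen i) hw,
    iteratedFDerivWithin_of_isOpen (k - j) (hf.isOpen i) hw]
  have hM := hf.one_le i
  have e1 := hC j (hj.trans hk) i w hw
  have e2 := hD (k - j) ((Nat.sub_le _ _).trans hk) i w hw
  have c1 := hC0 j (hj.trans hk)
  have c2 := hD0 (k - j) ((Nat.sub_le _ _).trans hk)
  calc _ ≤ (k.choose j : ℝ) * (C j * M i ^ (j - a)) * (D (k - j) * M i ^ (k - j - a)) := by gcongr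
    _ = (k.choose j : ℝ) * C j * D (k - j) * M i ^ (j - a + (k - j - a)) := by rw [pow_add]; ring
    -- With truncated subtraction `(j - a) + (k - j - a) ≤ k - a`, so the Leibniz rule preserves the
    -- weight.
    _ ≤ _ := by
      gcongr
      omega

theorem clm (L : G →L[ℝ] H) (ha : a ≤ 1) (hf : Symb N a M Ω f) :
    Symb N a M Ω (fun i w => L (f i w)) :=
  bilin (ContinuousLinearMap.id ℝ (G →L[ℝ] H)) ha (const hf.one_le hf.isOpen L) hf

theorem add (hf : Symb N a M Ω f) (hg : Symb N a M Ω g) :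
    Symb N a M Ω (fun i w => f i w + g i w) := by
  refine ⟨hf.one_le, hf.isOpen, fun i => (hf.smooth i).add (hg.smooth i), fun k hk => ?_⟩
  obtain ⟨C, hC⟩ := hf.bound k hk
  obtain ⟨D, hD⟩ := hg.bound k hk
  refine ⟨C + D, fun i w hw => ?_⟩
  rw [fun_iteratedFDeriv_add_apply ((hf.contDiffAt hw).of_le (by norm_cast; simp))
    ((hg.contDiffAt hw).of_le (by norm_cast; simp)), add_mul]
  exact (norm_add_le _ _).trans (add_le_add (hC i w hw) (hD i w hw))

theorem neg (ha : a ≤ 1) (hf : Symb N a M Ω f) : Symb N a M Ω (fun i w => -f i w) := by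
  simpa using clm (-ContinuousLinearMap.id ℝ G) ha hf

theorem sub (ha : a ≤ 1) (hf : Symb N a M Ω f) (hg : Symb N a M Ω g) :
    Symb N a M Ω (fun i w => f i w - g i w) := by
  simpa [sub_eq_add_neg] using hf.add (hg.neg ha)

theorem sum (hM : ∀ i, 1 ≤ M i) (hΩ : ∀ i, IsOpen (Ω i)) {J : Type*} (s : Finset J)
    {f : J → ι → F → G} (hf : ∀ j ∈ s, Symb N a M Ω (f j)) :
    Symb N a M Ω (fun i w => ∑ j ∈ s, f j i w) := by
  classical
  induction s using Finset.induction_on with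
  | empty => simpa using const hM hΩ (0 : G)
  | insert j s hj ih =>
    simp only [Finset.sum_insert hj]
    exact (hf j (by simp)).add (ih fun l hl => hf l (by simp [hl]))

theorem prodMk {h : ι → F → H} (ha : a ≤ 1) (hf : Symb N a M Ω f) (hh : Symb N a M Ω h) :
    Symb N a M Ω (fun i w => (f i w, h i w)) := by
  simpa using (clm (ContinuousLinearMap.inl ℝ G H) ha hf).add
    (clm (ContinuousLinearMap.inr ℝ G H) ha hh)

theorem smul {c : ι → F → ℝ} (ha : a ≤ 1) (hc : Symb N a M Ω c) (hf : Symb N a M Ω f) :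
    Symb N a M Ω (fun i w => c i w • f i w) :=
  bilin (ContinuousLinearMap.lsmul ℝ ℝ) ha hc hf

theorem mul {b c : ι → F → ℝ} (ha : a ≤ 1) (hb : Symb N a M Ω b) (hc : Symb N a M Ω c) :
    Symb N a M Ω (fun i w => b i w * c i w) :=
  bilin (ContinuousLinearMap.mul ℝ ℝ) ha hb hc

theorem clm_apply {A : ι → F → G →L[ℝ] H} (ha : a ≤ 1) (hA : Symb N a M Ω A)
    (hf : Symb N a M Ω f) : Symb N a M Ω (fun i w => A i w (f i w)) :=
  bilin (ContinuousLinearMap.id ℝ (G →L[ℝ] H)) ha hA hf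

theorem clm_comp {A : ι → F → G →L[ℝ] H} {B : ι → F → K →L[ℝ] G} (ha : a ≤ 1)
    (hA : Symb N a M Ω A) (hB : Symb N a M Ω B) : Symb N a M Ω (fun i w => (A i w).comp (B i w)) :=
  bilin (ContinuousLinearMap.compL ℝ K G H) ha hA hB

/-- Since `(k + 1) - 1 = k - 0`, differentiation trades weight `1` for weight `0`. This is the only
way in which the weight is spent. -/
theorem fderiv (hf : Symb (N + 1) 1 M Ω f) : Symb N 0 M Ω (fun i => fderiv ℝ (f i)) := by
  refine ⟨hf.one_le, hf.isOpen, fun i =>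
    ((contDiffOn_infty_iff_fderiv_of_isOpen (hf.isOpen i)).1 (hf.smooth i)).2, fun k hk => ?_⟩
  obtain ⟨C, hC⟩ := hf.bound (k + 1) (by omega)
  refine ⟨C, fun i w hw => ?_⟩
  rw [norm_iteratedFDeriv_fderiv]
  exact hC i w hw

/-- The way back from weight `0` to weight `1`. The derivative does not see order zero, hence the
separate bound `C`. Used to prove weight `1` from differential identities. -/
theorem of_fderiv (hs : ∀ i, ContDiffOn ℝ ∞ (f i) (Ω i)) {C : ℝ}
    (hb : ∀ i, ∀ w ∈ Ω i, ‖f i w‖ ≤ C) (hf : Symb N 0 M Ω (fun i => _root_.fderiv ℝ (f i))) :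
    Symb (N + 1) 1 M Ω f := by
  refine ⟨hf.one_le, hf.isOpen, hs, fun k hk => ?_⟩
  rcases k with _ | k
  · exact ⟨C, fun i w hw => by simpa using hb i w hw⟩
  · obtain ⟨C, hC⟩ := hf.bound k (by omega)
    refine ⟨C, fun i w hw => ?_⟩
    rw [← norm_iteratedFDeriv_fderiv]
    exact hC i w hw

/-- A linear map that is bounded on the domains. -/
theorem of_clm (hM : ∀ i, 1 ≤ M i) (hΩ : ∀ i, IsOpen (Ω i)) (L : F →L[ℝ] G) {C : ℝ}
    (hb : ∀ i, ∀ w ∈ Ω i, ‖L w‖ ≤ C) : Symb N 1 M Ω (fun _ w => L w) := by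
  refine (of_fderiv (N := N) (fun i => L.contDiff.contDiffOn) hb ?_).mono (Nat.le_succ N)
  have h : (fun _ : ι => _root_.fderiv ℝ fun w => L w) = fun _ _ => L := by
    funext _ w; exact L.fderiv
  rw [h]
  exact const hM hΩ L

/-- For `N` derivatives of the composition only derivatives of `fderiv W` of order strictly below
`N` are needed. This gain of one order is what closes the inductions for the flow and for its
inverse. -/
theorem comp {U : ι → Set P} {W : ι → P → F} (hf : Symb N 0 M Ω f) (hU : ∀ i, IsOpen (U i))
    (hW : ∀ i, ContDiffOn ℝ ∞ (W i) (U i)) (hm : ∀ i, MapsTo (W i) (U i) (Ω i))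
    (hWd : ∀ k < N, ∃ C : ℝ, ∀ i, ∀ p ∈ U i, ‖iteratedFDeriv ℝ k (_root_.fderiv ℝ (W i)) p‖ ≤
      C * M i ^ k) :
    Symb N 0 M U (fun i p => f i (W i p)) := by
  refine ⟨hf.one_le, hU, fun i => (hf.smooth i).comp (hW i) (hm i), fun n hn => ?_⟩
  choose! C hC0 hC using fun k (hk : k ≤ N) => hf.bound_nonneg hk
  choose! D hD using hWd
  -- The shift `k - 1` appears because the `k`-th derivative of `W` is the `(k - 1)`-st derivative
  -- of `fderiv W`.
  obtain ⟨E, hE1, hE⟩ := exists_pow_bound (fun k => D (k - 1)) n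
  refine ⟨n.factorial * (∑ k ∈ Finset.range (n + 1), C k) * E ^ n, fun i p hp => ?_⟩
  have hM := hf.one_le i
  have h := norm_iteratedFDeriv_comp_le_of_isOpen (hU i) (hf.isOpen i) (hf.smooth i) (hW i) (hm i)
    hp (n := n) (C := ∑ k ∈ Finset.range (n + 1), C k) (D := E * M i) (N := M i) (by linarith)
    (fun k hk => by
      refine (hC k (hk.trans hn) i _ (hm i hp)).trans ?_
      rw [Nat.sub_zero]
      gcongr
      exact Finset.single_le_sum (f := C)
        (fun j hj => hC0 j (by have := Finset.mem_range.1 hj; omega))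
        (Finset.mem_range.2 (by omega)))
    (fun k hk hk' => by
      obtain ⟨l, rfl⟩ : ∃ l, k = l + 1 := ⟨k - 1, by omega⟩
      rw [← norm_iteratedFDeriv_fderiv]
      have h1 := hD l (by omega) i p hp
      have h2 := hE (l + 1) hk hk'
      simp only [Nat.add_sub_cancel] at h2
      calc _ ≤ M i * (D l * M i ^ l) := by gcongr
        _ = D l * M i ^ (l + 1) := by ring
        _ ≤ E ^ (l + 1) * M i ^ (l + 1) := by gcongr
        _ = _ := (mul_pow _ _ _).symm)
  refine h.trans (le_of_eq ?_)
  rw [mul_pow, Nat.sub_zero]; ring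

theorem comp_symb {U : ι → Set P} {W : ι → P → F} (hf : Symb N 0 M Ω f)
    (hW : ∀ i, ContDiffOn ℝ ∞ (W i) (U i)) (hm : ∀ i, MapsTo (W i) (U i) (Ω i))
    (hWd : Symb N' 0 M U (fun i => _root_.fderiv ℝ (W i))) (hN : N ≤ N' + 1) :
    Symb N 0 M U (fun i p => f i (W i p)) :=
  hf.comp hWd.isOpen hW hm fun k hk => by simpa using hWd.bound k (by omega)

/-- Composition with a fixed smooth function with bounded derivatives. -/
theorem fixed_comp {Ω₀ : Set G} (hΩ₀ : IsOpen Ω₀) {φ : G → H} (hφ : ContDiffOn ℝ ∞ φ Ω₀)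
    (hb : ∀ k ≤ N, ∃ C : ℝ, ∀ z ∈ Ω₀, ‖iteratedFDeriv ℝ k φ z‖ ≤ C) (hf : Symb N 0 M Ω f)
    (hm : ∀ i, MapsTo (f i) (Ω i) Ω₀) : Symb N 0 M Ω (fun i w => φ (f i w)) := by
  refine ⟨hf.one_le, hf.isOpen, fun i => hφ.comp (hf.smooth i) (hm i), fun n hn => ?_⟩
  choose! C hC using hb
  choose! D hD0 hD using fun k (hk : k ≤ N) => hf.bound_nonneg hk
  obtain ⟨E, hE1, hE⟩ := exists_pow_bound D n
  refine ⟨n.factorial * (∑ k ∈ Finset.range (n + 1), |C k|) * E ^ n, fun i p hp => ?_⟩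
  have hM := hf.one_le i
  have h := norm_iteratedFDeriv_comp_le_of_isOpen (hf.isOpen i) hΩ₀ hφ (hf.smooth i) (hm i)
    hp (n := n) (C := ∑ k ∈ Finset.range (n + 1), |C k|) (D := E * M i) (N := 1) one_pos
    (fun k hk => by
      rw [one_pow, mul_one]
      refine (hC k (hk.trans hn) _ (hm i hp)).trans ((le_abs_self _).trans ?_)
      exact Finset.single_le_sum (f := fun k => |C k|) (fun j _ => abs_nonneg _)
        (Finset.mem_range.2 (by omega)))
    (fun k hk hk' => by
      have h1 := hD k (by omega) i p hp
      rw [Nat.sub_zero] at h1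
      rw [one_mul, mul_pow]
      exact h1.trans (by gcongr; exact hE k hk hk'))
  refine h.trans (le_of_eq ?_)
  rw [mul_pow, Nat.sub_zero]; ring

/-- The direct composition estimate only gives weight `0`. The chain rule writes the derivative as a
product of weight `0` symbols, and integrating this information back gives weight `1`. -/
theorem fixed_comp_one {Ω₀ : Set G} (hΩ₀ : IsOpen Ω₀) {φ : G → H} (hφ : ContDiffOn ℝ ∞ φ Ω₀)
    (hb : ∀ k, ∃ C : ℝ, ∀ z ∈ Ω₀, ‖iteratedFDeriv ℝ k φ z‖ ≤ C) (hf : Symb (N + 1) 1 M Ω f)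
    (hm : ∀ i, MapsTo (f i) (Ω i) Ω₀) : Symb (N + 1) 1 M Ω (fun i w => φ (f i w)) := by
  have hs : ∀ i, ContDiffOn ℝ ∞ (fun w => φ (f i w)) (Ω i) := fun i => hφ.comp (hf.smooth i) (hm i)
  obtain ⟨C, hC⟩ := hb 0
  refine of_fderiv hs (C := C) (fun i w hw => by simpa using hC _ (hm i hw)) ?_
  have h1 : Symb N 0 M Ω (fun i w => _root_.fderiv ℝ φ (f i w)) :=
    fixed_comp hΩ₀ ((contDiffOn_infty_iff_fderiv_of_isOpen hΩ₀).1 hφ).2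
      (fun k _ => by simpa only [norm_iteratedFDeriv_fderiv] using hb (k + 1))
      ((hf.mono_weight zero_le_one).mono (Nat.le_succ N)) hm
  refine (h1.clm_comp zero_le_one hf.fderiv).congr fun i w hw => ?_
  exact fderiv_comp w ((hφ.contDiffAt (hΩ₀.mem_nhds (hm i hw))).differentiableAt (by simp))
    (hf.differentiableAt hw)

/-- Weight `1` survives a substitution whose differential has weight `0`: by the chain rule the
derivative of the composition is a product of two weight `0` symbols. -/
theorem comp_one {U : ι → Set P} {W : ι → P → F} (hf : Symb (N + 1) 1 M Ω f)
    (hW : ∀ i, ContDiffOn ℝ ∞ (W i) (U i)) (hm : ∀ i, MapsTo (W i) (U i) (Ω i))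
    (hWd : Symb N 0 M U (fun i => _root_.fderiv ℝ (W i))) :
    Symb (N + 1) 1 M U (fun i p => f i (W i p)) := by
  obtain ⟨C, -, hC⟩ := hf.norm_le
  refine of_fderiv (C := C) (fun i => (hf.smooth i).comp (hW i) (hm i))
    (fun i p hp => hC i _ (hm i hp)) ?_
  refine ((hf.fderiv.comp_symb hW hm hWd (Nat.le_succ N)).clm_comp zero_le_one hWd).congr
    fun i p hp => ?_
  exact fderiv_comp p (hf.differentiableAt (hm i hp))
    (((hW i).contDiffAt ((hWd.isOpen i).mem_nhds hp)).differentiableAt (by simp))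

end Symb

/-- Derivatives of a smooth function are bounded on a set with compact closure in its domain. -/
theorem exists_bound_iteratedFDeriv_of_isCompact {G H : Type*} [NormedAddCommGroup G]
    [NormedSpace ℝ G] [NormedAddCommGroup H] [NormedSpace ℝ H] {φ : G → H} {Ω K : Set G}
    (hΩ : IsOpen Ω) (hφ : ContDiffOn ℝ ∞ φ Ω) (hK : IsCompact K) (hKΩ : K ⊆ Ω) (k : ℕ) :
    ∃ C : ℝ, ∀ z ∈ K, ‖iteratedFDeriv ℝ k φ z‖ ≤ C := by
  refine hK.exists_bound_of_continuousOn (f := iteratedFDeriv ℝ k φ) ?_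
  have h := hφ.continuousOn_iteratedFDerivWithin (m := k) (by norm_cast; simp) hΩ.uniqueDiffOn
  exact (h.congr fun z hz => (iteratedFDerivWithin_of_isOpen k hΩ hz).symm).mono hKΩ

/-! ### Commuting time and parameter derivatives -/

section Commute

variable {P G : Type u} [NormedAddCommGroup P] [NormedSpace ℝ P] [NormedAddCommGroup G]
  [NormedSpace ℝ G] {U : Set P} {f f' : ℝ → P → G}

theorem hasFDerivAt_slice (hU : IsOpen U)
    (hf : ContDiffOn ℝ ∞ (fun z : ℝ × P => f z.1 z.2) (univ ×ˢ U)) (t : ℝ) {p : P} (hp : p ∈ U) :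
    HasFDerivAt (f t) ((fderiv ℝ (fun z : ℝ × P => f z.1 z.2) (t, p)).comp
      (ContinuousLinearMap.inr ℝ ℝ P)) p := by
  have h := ((hf.contDiffAt ((isOpen_univ.prod hU).mem_nhds (x := (t, p))
    ⟨trivial, hp⟩)).differentiableAt (by simp)).hasFDerivAt
  exact h.comp p (hasFDerivAt_prodMk_right t p)

theorem contDiffOn_fderiv_slice (hU : IsOpen U)
    (hf : ContDiffOn ℝ ∞ (fun z : ℝ × P => f z.1 z.2) (univ ×ˢ U)) :
    ContDiffOn ℝ ∞ (fun z : ℝ × P => fderiv ℝ (f z.1) z.2) (univ ×ˢ U) :=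
  (((contDiffOn_infty_iff_fderiv_of_isOpen (isOpen_univ.prod hU)).1 hf).2.clm_comp
    contDiffOn_const).congr fun z hz => (hasFDerivAt_slice hU hf z.1 hz.2).fderiv

/-- Both sides are mixed second derivatives of the jointly smooth function, so this is the symmetry
of its second derivative in the directions `(1, 0)` and `(0, h)`. -/
theorem hasDerivAt_fderiv_slice (hU : IsOpen U)
    (hf : ContDiffOn ℝ ∞ (fun z : ℝ × P => f z.1 z.2) (univ ×ˢ U))
    (hd : ∀ p ∈ U, ∀ t, HasDerivAt (f · p) (f' t p) t) {p : P} (hp : p ∈ U) (t : ℝ) :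
    HasDerivAt (fun s => fderiv ℝ (f s) p) (fderiv ℝ (f' t) p) t := by
  set F := fun z : ℝ × P => f z.1 z.2 with hF
  have ho := isOpen_univ (X := ℝ).prod hU
  have hFa : ContDiffAt ℝ ∞ F (t, p) := hf.contDiffAt (ho.mem_nhds ⟨trivial, hp⟩)
  have hD : HasFDerivAt (fderiv ℝ F) (fderiv ℝ (fderiv ℝ F) (t, p)) (t, p) :=
    ((hFa.fderiv_right (m := ∞) (by norm_cast)).differentiableAt (by simp)).hasFDerivAt
  have h1 : HasDerivAt (fun s => (fderiv ℝ F (s, p)).comp (ContinuousLinearMap.inr ℝ ℝ P))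
      ((fderiv ℝ (fderiv ℝ F) (t, p) (1, 0)).comp (ContinuousLinearMap.inr ℝ ℝ P)) t := by
    have h2 : HasDerivAt (fun s : ℝ => (s, p)) ((1 : ℝ), (0 : P)) t :=
      (hasDerivAt_id t).prodMk (hasDerivAt_const t p)
    have h3 : HasDerivAt (fun s => fderiv ℝ F (s, p)) (fderiv ℝ (fderiv ℝ F) (t, p) (1, 0)) t :=
      HasFDerivAt.comp_hasDerivAt (f := fun s : ℝ => (s, p)) t hD h2
    exact (h3.clm_comp (hasDerivAt_const t (ContinuousLinearMap.inr ℝ ℝ P))).congr_deriv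
      (by simp)
  have h4 : (fun s => fderiv ℝ (f s) p) =
      fun s => (fderiv ℝ F (s, p)).comp (ContinuousLinearMap.inr ℝ ℝ P) := by
    funext s; exact (hasFDerivAt_slice hU hf s hp).fderiv
  have h5 : f' t =ᶠ[𝓝 p] fun q => fderiv ℝ F (t, q) (1, 0) := by
    filter_upwards [hU.mem_nhds hp] with q hq
    have h6 := ((hf.contDiffAt (ho.mem_nhds (x := (t, q))
      ⟨trivial, hq⟩)).differentiableAt (by simp)).hasFDerivAt
    have h7 : HasDerivAt (fun s : ℝ => (s, q)) ((1 : ℝ), (0 : P)) t :=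
      (hasDerivAt_id t).prodMk (hasDerivAt_const t q)
    exact (hd q hq t).unique (HasFDerivAt.comp_hasDerivAt (f := fun s : ℝ => (s, q)) t h6 h7)
  have h8 : HasFDerivAt (fun q => fderiv ℝ F (t, q) (1, 0))
      (((fderiv ℝ (fderiv ℝ F) (t, p)).comp (ContinuousLinearMap.inr ℝ ℝ P)).flip (1, 0)) p := by
    have h9 : HasFDerivAt (fun q => fderiv ℝ F (t, q))
        ((fderiv ℝ (fderiv ℝ F) (t, p)).comp (ContinuousLinearMap.inr ℝ ℝ P)) p :=
      HasFDerivAt.comp (f := fun q => (t, q)) p hD (hasFDerivAt_prodMk_right t p)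
    exact (h9.clm_apply (hasFDerivAt_const ((1 : ℝ), (0 : P)) p)).congr_fderiv (by simp)
  rw [h4, h5.fderiv_eq, h8.fderiv]
  convert h1 using 1
  ext h
  have hsymm := hFa.isSymmSndFDerivAt (by
    simp only [minSmoothness_of_isRCLikeNormedField]; norm_cast) (1, 0) (0, h)
  simpa using hsymm.symm

end Commute

theorem hasDerivAt_iteratedFDeriv_slice {P : Type u} [NormedAddCommGroup P] [NormedSpace ℝ P]
    {U : Set P} (hU : IsOpen U) (k : ℕ) : ∀ {G : Type u} [NormedAddCommGroup G]
    [NormedSpace ℝ G] {f f' : ℝ → P → G}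
    (_ : ContDiffOn ℝ ∞ (fun z : ℝ × P => f z.1 z.2) (univ ×ˢ U))
    (_ : ∀ p ∈ U, ∀ t, HasDerivAt (f · p) (f' t p) t) {p : P} (_ : p ∈ U) (t : ℝ),
    HasDerivAt (fun s => iteratedFDeriv ℝ k (f s) p) (iteratedFDeriv ℝ k (f' t) p) t := by
  induction k with
  | zero =>
    intro G _ _ f f' hf hd p hp t
    simp only [iteratedFDeriv_zero_eq_comp, Function.comp_apply]
    exact (continuousMultilinearCurryFin0 ℝ P G).symm.toContinuousLinearEquiv.toContinuousLinearMap.hasFDerivAt.comp_hasDerivAt t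
      (hd p hp t)
  | succ k ih =>
    intro G _ _ f f' hf hd p hp t
    simp only [iteratedFDeriv_succ_eq_comp_right, Function.comp_apply]
    have := ih (contDiffOn_fderiv_slice hU hf)
      (fun q hq s => hasDerivAt_fderiv_slice hU hf hd hq s) hp t
    exact (continuousMultilinearCurryRightEquiv' ℝ k P G).symm.toContinuousLinearEquiv.toContinuousLinearMap.hasFDerivAt.comp_hasDerivAt
      t this

/-! ### Symbol bounds for linear evolution equations -/

/-- Times are made part of the index of a family, so that symbol bounds are uniform for `|t| ≤ 1`.
-/
abbrev UnitTime : Type := {t : ℝ // |t| ≤ 1}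

/-- Induction on the order: the `k`-th derivative of `Z` solves the same linear equation with a
source made of lower derivatives of `Z` and at least one derivative of `A`, which is `O(M ^ k)`. The
Grönwall rate is the order zero bound of `A`, which does not involve `M`. -/
theorem symb_of_linear_ode {ι : Type*} {P G : Type u} [NormedAddCommGroup P] [NormedSpace ℝ P]
    [NormedAddCommGroup G] [NormedSpace ℝ G] {n : ℕ} {M : ι → ℝ} {U : ι → Set P}
    {Z : ι → ℝ → P → G} {A : ι → ℝ → P → G →L[ℝ] G}
    (hZ : ∀ i, ContDiffOn ℝ ∞ (fun z : ℝ × P => Z i z.1 z.2) (univ ×ˢ U i))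
    (hd : ∀ i, ∀ p ∈ U i, ∀ t, HasDerivAt (Z i · p) (A i t p (Z i t p)) t)
    (hZ0 : Symb n 0 M U (fun i => Z i 0))
    (hA : Symb n 0 (fun j : ι × UnitTime => M j.1) (fun j => U j.1) (fun j => A j.1 j.2)) :
    Symb n 0 (fun j : ι × UnitTime => M j.1) (fun j => U j.1) (fun j => Z j.1 j.2) := by
  have hsm : ∀ i t, ContDiffOn ℝ ∞ (Z i t) (U i) := fun i t =>
    (hZ i).comp (contDiff_prodMk_right t).contDiffOn fun p hp => ⟨trivial, hp⟩
  refine ⟨hA.one_le, hA.isOpen, fun j => hsm _ _, fun k => ?_⟩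
  induction k using Nat.strong_induction_on with
  | _ k ih =>
  intro hk
  choose! C hC0 hC using fun l (hl : l ≤ n) => hA.bound_nonneg hl
  have ih' : ∀ l < k, ∃ D : ℝ, 0 ≤ D ∧ ∀ j : ι × UnitTime, ∀ w ∈ U j.1,
      ‖iteratedFDeriv ℝ l (Z j.1 j.2) w‖ ≤ D * M j.1 ^ l := fun l hl => by
    have hS : Symb l 0 (fun j : ι × UnitTime => M j.1) (fun j => U j.1) (fun j => Z j.1 j.2) :=
      ⟨hA.one_le, hA.isOpen, fun j => hsm _ _, fun m hm => ih m (by omega) (by omega)⟩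
    exact hS.bound_nonneg le_rfl
  choose! D hD0 hD using ih'
  obtain ⟨C0, hC00, hC0b⟩ := hZ0.bound_nonneg hk
  -- The Leibniz terms with `l + 1 ≥ 1` derivatives on `A`; the remaining term, with none, is the
  -- one absorbed by Grönwall.
  set ε := ∑ l ∈ Finset.range k, (k.choose (l + 1) : ℝ) * C (l + 1) * D (k - (l + 1)) with hε
  have hε0 : 0 ≤ ε := Finset.sum_nonneg fun l hl => by
    have hl := Finset.mem_range.1 hl
    have := hC0 (l + 1) (by omega)
    have := hD0 (k - (l + 1)) (by omega)
    positivity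
  refine ⟨(C0 + ε) * Real.exp (C 0 + 1), fun j w hw => ?_⟩
  have hM := hA.one_le j
  have h := norm_le_of_deriv_le_abs (f := fun s => iteratedFDeriv ℝ k (Z j.1 s) w)
    (f' := fun s => iteratedFDeriv ℝ k (fun p => A j.1 s p (Z j.1 s p)) w) (K := C 0)
    (ε := ε * M j.1 ^ k) (hC0 0 (Nat.zero_le _)) (by positivity)
    (fun s _ => hasDerivAt_iteratedFDeriv_slice (hA.isOpen j) k (hZ j.1) (hd j.1) hw s)
    (fun s hs => by
      have h1 := (ContinuousLinearMap.id ℝ (G →L[ℝ] G)).norm_iteratedFDerivWithin_le_of_bilinear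
        (hA.smooth (j.1, ⟨s, hs⟩)) (hsm j.1 s) ((hA.isOpen j).uniqueDiffOn (𝕜 := ℝ)) hw
        (n := k) (by norm_cast; simp)
      rw [iteratedFDerivWithin_of_isOpen k (hA.isOpen j) hw] at h1
      refine h1.trans ((mul_le_of_le_one_left (Finset.sum_nonneg fun _ _ => by positivity)
        ContinuousLinearMap.norm_id_le).trans ?_)
      rw [Finset.sum_range_succ', add_comm]
      refine add_le_add ?_ ?_
      · rw [iteratedFDerivWithin_of_isOpen _ (hA.isOpen j) hw,
          iteratedFDerivWithin_of_isOpen _ (hA.isOpen j) hw]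
        have := hC 0 (Nat.zero_le _) (j.1, ⟨s, hs⟩) w hw
        simp only [Nat.choose_zero_right, Nat.cast_one, one_mul, Nat.sub_zero]
        gcongr
        simpa using this
      · rw [hε, Finset.sum_mul]
        refine Finset.sum_le_sum fun l hl => ?_
        have hl := Finset.mem_range.1 hl
        rw [iteratedFDerivWithin_of_isOpen _ (hA.isOpen j) hw,
          iteratedFDerivWithin_of_isOpen _ (hA.isOpen j) hw]
        have e1 := hC (l + 1) (by omega) (j.1, ⟨s, hs⟩) w hw
        have e2 := hD (k - (l + 1)) (by omega) (j.1, ⟨s, hs⟩) w hw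
        have c1 := hC0 (l + 1) (by omega)
        simp only [Nat.sub_zero] at e1
        calc _ ≤ (k.choose (l + 1) : ℝ) * (C (l + 1) * M j.1 ^ (l + 1)) *
              (D (k - (l + 1)) * M j.1 ^ (k - (l + 1))) := by gcongr
          _ = (k.choose (l + 1) : ℝ) * C (l + 1) * D (k - (l + 1)) *
              M j.1 ^ (l + 1 + (k - (l + 1))) := by rw [pow_add]; ring
          _ = _ := by congr 2; omega) j.2 j.2.2
  refine h.trans ?_
  have h0 := hC0b j.1 w hw
  simp only [Nat.sub_zero] at h0 ⊢
  calc _ ≤ (C0 * M j.1 ^ k + ε * M j.1 ^ k) * Real.exp (C 0 + 1) := by gcongr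
    _ = _ := by ring

/-! ### The flow of a spray-like system -/

namespace PhaseFlow

variable {E : Type u} [NormedAddCommGroup E] [NormedSpace ℝ E]

/-- The vector field `(v, Q(v, ξ))`. -/
noncomputable def field (v : E × E → E) (Q : E → E →L[ℝ] E →L[ℝ] E) (w : E × E) : E × E :=
  (v w, Q w.1 (v w) w.2)

/-- `(J, T) ↦ (0, Q(J, ξ))`. -/
noncomputable def shift (Q : E → E →L[ℝ] E →L[ℝ] E) (w : E × E) : E × E →L[ℝ] E × E :=
  (ContinuousLinearMap.inr ℝ E E).comp
    (((Q w.1).flip w.2).comp (ContinuousLinearMap.fst ℝ E E))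

theorem shift_apply (Q : E → E →L[ℝ] E →L[ℝ] E) (w h : E × E) :
    shift Q w h = (0, Q w.1 h.1 w.2) := by simp [shift]

/-- The derivative of the variation, after the change of variables `1 - shift`. -/
noncomputable def preCoeff (v : E × E → E) (Q : E → E →L[ℝ] E →L[ℝ] E)
    (R : E → E →L[ℝ] E →L[ℝ] E →L[ℝ] E) (w : E × E) : E × E →L[ℝ] E × E :=
  (ContinuousLinearMap.inl ℝ E E).comp (fderiv ℝ v w) + (ContinuousLinearMap.inr ℝ E E).comp
    (((((R w.1).flip (v w)).flip w.2) - (Q w.1).flip (Q w.1 (v w) w.2)).comp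
      (ContinuousLinearMap.fst ℝ E E) + (Q w.1 (v w)).comp (ContinuousLinearMap.snd ℝ E E))

theorem preCoeff_apply (v : E × E → E) (Q : E → E →L[ℝ] E →L[ℝ] E)
    (R : E → E →L[ℝ] E →L[ℝ] E →L[ℝ] E) (w h : E × E) :
    preCoeff v Q R w h = (fderiv ℝ v w h,
      R w.1 h.1 (v w) w.2 - Q w.1 h.1 (Q w.1 (v w) w.2) + Q w.1 (v w) h.2) := by
  simp [preCoeff]

/-- The coefficient of the linear equation for the covariant variation. -/
noncomputable def coeff (v : E × E → E) (Q : E → E →L[ℝ] E →L[ℝ] E)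
    (R : E → E →L[ℝ] E →L[ℝ] E →L[ℝ] E) (w : E × E) : E × E →L[ℝ] E × E :=
  (preCoeff v Q R w).comp (ContinuousLinearMap.id ℝ _ + shift Q w)

/-- The covariant variation of a flow. -/
noncomputable def covar (Q : E → E →L[ℝ] E →L[ℝ] E) (W : ℝ → E × E → E × E) (t : ℝ) (p : E × E) :
    E × E →L[ℝ] E × E :=
  (ContinuousLinearMap.id ℝ _ - shift Q (W t p)).comp (fderiv ℝ (W t) p)

theorem covar_apply (Q : E → E →L[ℝ] E →L[ℝ] E) (W : ℝ → E × E → E × E) (t : ℝ)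
    (p h : E × E) : covar Q W t p h = ((fderiv ℝ (W t) p h).1,
      (fderiv ℝ (W t) p h).2 - Q (W t p).1 (fderiv ℝ (W t) p h).1 (W t p).2) := by
  simp only [covar, ContinuousLinearMap.comp_apply, sub_apply,
    ContinuousLinearMap.id_apply, shift_apply]
  ext <;> simp

/-- The shift maps into the second factor and depends only on the first, so its square vanishes and
`1 + shift` inverts `1 - shift`. -/
theorem fderiv_eq_comp_covar (Q : E → E →L[ℝ] E →L[ℝ] E) (W : ℝ → E × E → E × E) (t : ℝ)
    (p : E × E) : fderiv ℝ (W t) p =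
      (ContinuousLinearMap.id ℝ _ + shift Q (W t p)).comp (covar Q W t p) := by
  refine ContinuousLinearMap.ext fun h => ?_
  simp only [ContinuousLinearMap.comp_apply, add_apply,
    ContinuousLinearMap.id_apply, shift_apply, covar_apply]
  ext <;> simp

variable {v : E × E → E} {Q : E → E →L[ℝ] E →L[ℝ] E} {R : E → E →L[ℝ] E →L[ℝ] E →L[ℝ] E}
  {Ω U : Set (E × E)} {W : ℝ → E × E → E × E}

/-- The covariant variation solves a linear equation in which `Q` is only differentiated through
the curvature-like tensor `R`. -/
theorem hasDerivAt_covar (hQ : ContDiff ℝ ∞ Q)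
    (hR : ∀ x J y z, R x J y z = fderiv ℝ Q x J y z - fderiv ℝ Q x y J z)
    (hΩ : IsOpen Ω) (hv : ContDiffOn ℝ ∞ v Ω) (hU : IsOpen U)
    (hWs : ContDiffOn ℝ ∞ (fun z : ℝ × (E × E) => W z.1 z.2) (univ ×ˢ U))
    (hW : ∀ p ∈ U, ∀ t, HasDerivAt (W · p) (field v Q (W t p)) t)
    (hWΩ : ∀ p ∈ U, ∀ t, W t p ∈ Ω) {p : E × E} (hp : p ∈ U) (t : ℝ) :
    HasDerivAt (covar Q W · p) ((coeff v Q R (W t p)).comp (covar Q W t p)) t := by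
  set w := W t p with hw
  have hvd : HasFDerivAt v (fderiv ℝ v w) w :=
    ((hv.contDiffAt (hΩ.mem_nhds (hWΩ p hp t))).differentiableAt (by simp)).hasFDerivAt
  have hQd : HasFDerivAt Q (fderiv ℝ Q w.1) w.1 :=
    (hQ.differentiable (by simp) w.1).hasFDerivAt
  have hQ1 : HasFDerivAt (fun z : E × E => Q z.1)
      ((fderiv ℝ Q w.1).comp (ContinuousLinearMap.fst ℝ E E)) w := by
    have hf : HasFDerivAt (fun z : E × E => z.1) (ContinuousLinearMap.fst ℝ E E) w :=
      hasFDerivAt_fst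
    exact HasFDerivAt.comp (g := Q) (f := fun z : E × E => z.1) w hQd hf
  have hfield : HasFDerivAt (field v Q) _ w :=
    hvd.prodMk ((hQ1.clm_apply hvd).clm_apply (hasFDerivAt_snd (𝕜 := ℝ) (E := E) (F := E)))
  have hWd := hasFDerivAt_slice hU hWs t hp
  have h1 := hasDerivAt_fderiv_slice hU hWs hW hp t
  change HasDerivAt _ (fderiv ℝ (field v Q ∘ W t) p) t at h1
  rw [(hfield.comp p (hWd.differentiableAt.hasFDerivAt)).fderiv] at h1
  have hx : HasDerivAt (fun s => (W s p).1) (v w) t := (hW p hp t).fst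
  have hξ : HasDerivAt (fun s => (W s p).2) (Q w.1 (v w) w.2) t := (hW p hp t).snd
  have hQt : HasDerivAt (fun s => Q (W s p).1) (fderiv ℝ Q w.1 (v w)) t :=
    HasFDerivAt.comp_hasDerivAt (f := fun s => (W s p).1) t hQd hx
  have hQf : HasDerivAt (fun s => (Q (W s p).1).flip) ((fderiv ℝ Q w.1 (v w)).flip) t :=
    (ContinuousLinearMap.flipₗᵢ ℝ E E E).toContinuousLinearEquiv.toContinuousLinearMap.hasFDerivAt.comp_hasDerivAt
      t hQt
  have hsh : HasDerivAt (fun s => shift Q (W s p)) _ t :=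
    (hasDerivAt_const t (ContinuousLinearMap.inr ℝ E E)).clm_comp
      ((hQf.clm_apply hξ).clm_comp (hasDerivAt_const t (ContinuousLinearMap.fst ℝ E E)))
  have h2 := ((hasDerivAt_const t (ContinuousLinearMap.id ℝ (E × E))).sub hsh).clm_comp h1
  -- Differentiating `T` gives `DQ(J)(v, ξ)` and differentiating `Q(J, ξ)` gives `DQ(v)(J, ξ)`; only
  -- their difference survives, and this is `R`. The terms `Q(Dv (J, T), ξ)` cancel.
  refine HasDerivAt.congr_deriv h2 ?_
  refine ContinuousLinearMap.ext fun h => ?_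
  simp only [coeff, ContinuousLinearMap.comp_apply, add_apply,
    ContinuousLinearMap.id_apply, shift_apply, covar_apply, preCoeff_apply, hR, ← hw,
    sub_apply, Pi.sub_apply]
  ext <;> simp
  abel

/-- A family of flows with uniformly controlled data. -/
structure IsSymbFlow {ι : Type*} (M : ι → ℝ) (Ω U : ι → Set (E × E)) (v : ι → E × E → E)
    (Q : ι → E → E →L[ℝ] E →L[ℝ] E) (R : ι → E → E →L[ℝ] E →L[ℝ] E →L[ℝ] E)
    (W : ι → ℝ → E × E → E × E) : Prop where
  one_le : ∀ i, 1 ≤ M i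
  isOpen_dom : ∀ i, IsOpen (Ω i)
  isOpen_par : ∀ i, IsOpen (U i)
  sub : ∀ i, U i ⊆ Ω i
  bounded : ∃ C : ℝ, ∀ i, ∀ w ∈ Ω i, ‖w.2‖ ≤ C
  smooth_conn : ∀ i, ContDiff ℝ ∞ (Q i)
  curv : ∀ i x J y z, R i x J y z = fderiv ℝ (Q i) x J y z - fderiv ℝ (Q i) x y J z
  symb_vel : ∀ N, Symb N 1 M Ω v
  symb_conn : ∀ N, Symb N 0 M Ω (fun i w => Q i w.1)
  symb_curv : ∀ N, Symb N 0 M Ω (fun i w => R i w.1)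
  init : ∀ i, ∀ p ∈ U i, W i 0 p = p
  smooth : ∀ i, ContDiffOn ℝ ∞ (fun z : ℝ × (E × E) => W i z.1 z.2) (univ ×ˢ U i)
  deriv : ∀ i, ∀ p ∈ U i, ∀ t, HasDerivAt (W i · p) (field (v i) (Q i) (W i t p)) t
  mem : ∀ i, ∀ p ∈ U i, ∀ t, W i t p ∈ Ω i

/-! ### Symbol bounds for the differential of the flow. -/

namespace IsSymbFlow

variable {ι : Type*} {M : ι → ℝ} {Ω U : ι → Set (E × E)} {v : ι → E × E → E}
  {Q : ι → E → E →L[ℝ] E →L[ℝ] E} {R : ι → E → E →L[ℝ] E →L[ℝ] E →L[ℝ] E}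
  {W : ι → ℝ → E × E → E × E}

theorem symb_snd (h : IsSymbFlow M Ω U v Q R W) (N : ℕ) :
    Symb N 0 M Ω (fun _ (w : E × E) => w.2) := by
  obtain ⟨C, hC⟩ := h.bounded
  exact (Symb.of_clm (N := N) h.one_le h.isOpen_dom (ContinuousLinearMap.snd ℝ E E)
    hC).mono_weight zero_le_one

theorem symb_flip_conn (h : IsSymbFlow M Ω U v Q R W) (N : ℕ) :
    Symb N 0 M Ω (fun i w => (Q i w.1).flip) :=
  Symb.clm (ContinuousLinearMap.flipₗᵢ ℝ E E E).toContinuousLinearEquiv.toContinuousLinearMap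
    zero_le_one (h.symb_conn N)

theorem symb_shift (h : IsSymbFlow M Ω U v Q R W) (N : ℕ) :
    Symb N 0 M Ω (fun i => shift (Q i)) :=
  (Symb.const h.one_le h.isOpen_dom (ContinuousLinearMap.inr ℝ E E)).clm_comp zero_le_one
    (((h.symb_flip_conn N).clm_apply zero_le_one (h.symb_snd N)).clm_comp zero_le_one
      (Symb.const h.one_le h.isOpen_dom (ContinuousLinearMap.fst ℝ E E)))

/-- The weight `1` of the velocity pays for `fderiv v`, and the connection enters undifferentiated
except through `R`; hence every factor has weight `0`. -/
theorem symb_coeff (h : IsSymbFlow M Ω U v Q R W) (N : ℕ) :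
    Symb N 0 M Ω (fun i => coeff (v i) (Q i) (R i)) := by
  have hv : Symb N 0 M Ω v := (h.symb_vel N).mono_weight zero_le_one
  have hdv : Symb N 0 M Ω (fun i => fderiv ℝ (v i)) := (h.symb_vel (N + 1)).fderiv
  have hc : ∀ {G : Type u} [NormedAddCommGroup G] [NormedSpace ℝ G] (c : G),
      Symb N 0 M Ω (fun _ _ => c) := fun c => Symb.const h.one_le h.isOpen_dom c
  have hR1 : Symb N 0 M Ω (fun i w => ((R i w.1).flip (v i w)).flip w.2) := by
    have h1 : Symb N 0 M Ω (fun i w => (R i w.1).flip) :=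
      Symb.clm (ContinuousLinearMap.flipₗᵢ ℝ E E
        (E →L[ℝ] E)).toContinuousLinearEquiv.toContinuousLinearMap zero_le_one (h.symb_curv N)
    have h2 : Symb N 0 M Ω (fun i w => ((R i w.1).flip (v i w)).flip) :=
      Symb.clm (ContinuousLinearMap.flipₗᵢ ℝ E E E).toContinuousLinearEquiv.toContinuousLinearMap
        zero_le_one (h1.clm_apply zero_le_one hv)
    exact h2.clm_apply zero_le_one (h.symb_snd N)
  have hQv := (h.symb_conn N).clm_apply zero_le_one hv
  have hQ2 := (h.symb_flip_conn N).clm_apply zero_le_one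
    (hQv.clm_apply zero_le_one (h.symb_snd N))
  have hpre : Symb N 0 M Ω (fun i => preCoeff (v i) (Q i) (R i)) :=
    ((hc _).clm_comp zero_le_one hdv).add ((hc _).clm_comp zero_le_one
      (((hR1.sub zero_le_one hQ2).clm_comp zero_le_one (hc _)).add
        (hQv.clm_comp zero_le_one (hc _))))
  exact hpre.clm_comp zero_le_one ((hc _).add (h.symb_shift N))

theorem smooth_slice (h : IsSymbFlow M Ω U v Q R W) (i : ι) (t : ℝ) :
    ContDiffOn ℝ ∞ (W i t) (U i) :=
  (h.smooth i).comp (contDiff_prodMk_right t).contDiffOn fun _ hp => ⟨trivial, hp⟩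

theorem fderiv_zero (h : IsSymbFlow M Ω U v Q R W) (i : ι) {p : E × E} (hp : p ∈ U i) :
    fderiv ℝ (W i 0) p = ContinuousLinearMap.id ℝ _ := by
  have : W i 0 =ᶠ[𝓝 p] id := by
    filter_upwards [(h.isOpen_par i).mem_nhds hp] with q hq using h.init i q hq
  rw [this.fderiv_eq, fderiv_id]

/-- The derivative of the flow, uniformly for `|t| ≤ 1`. -/
theorem symb_fderiv (h : IsSymbFlow M Ω U v Q R W) (n : ℕ) :
    Symb n 0 (fun j : ι × UnitTime => M j.1) (fun j => U j.1)
      (fun j => fderiv ℝ (W j.1 j.2)) := by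
  -- Bootstrap: orders below `n` of the differential control order `n` of the coefficient and of the
  -- shift along the flow. The linear equation then controls order `n` of the covariant variation,
  -- and undoing the shift gives order `n` of the differential.
  have hstep : ∀ n, (∀ k < n, ∃ C : ℝ, ∀ j : ι × UnitTime, ∀ p ∈ U j.1,
      ‖iteratedFDeriv ℝ k (fderiv ℝ (W j.1 j.2)) p‖ ≤ C * M j.1 ^ k) →
      Symb n 0 (fun j : ι × UnitTime => M j.1) (fun j => U j.1)
        (fun j => fderiv ℝ (W j.1 j.2)) := by
    intro n hn
    have hm : ∀ j : ι × UnitTime, MapsTo (W j.1 j.2) (U j.1) (Ω j.1) := fun j p hp =>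
      h.mem j.1 p hp j.2
    have hA := ((h.symb_coeff n).reindex (Prod.fst : ι × UnitTime → ι)).comp
      (fun j => h.isOpen_par j.1) (fun j => h.smooth_slice j.1 j.2) hm hn
    have hN := ((h.symb_shift n).reindex (Prod.fst : ι × UnitTime → ι)).comp
      (fun j => h.isOpen_par j.1) (fun j => h.smooth_slice j.1 j.2) hm hn
    have hshift0 := (h.symb_shift n).mono_set h.isOpen_par h.sub
    have hZ0 : Symb n 0 M U (fun i => covar (Q i) (W i) 0) := by
      refine ((Symb.const h.one_le h.isOpen_par (ContinuousLinearMap.id ℝ (E × E))).sub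
        zero_le_one hshift0).congr fun i p hp => ?_
      simp only [covar, h.fderiv_zero i hp, h.init i p hp, ContinuousLinearMap.comp_id]
    have hZs : ∀ i, ContDiffOn ℝ ∞ (fun z : ℝ × (E × E) => covar (Q i) (W i) z.1 z.2)
        (univ ×ˢ U i) := fun i => by
      have h1 : ContDiffOn ℝ ∞ (fun z : ℝ × (E × E) => shift (Q i) (W i z.1 z.2))
          (univ ×ˢ U i) :=
        ((h.symb_shift n).smooth i).comp (h.smooth i) fun z hz => h.mem i z.2 hz.2 z.1
      exact (contDiffOn_const.sub h1).clm_comp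
        (contDiffOn_fderiv_slice (h.isOpen_par i) (h.smooth i))
    have hZ := symb_of_linear_ode (U := U) (Z := fun i => covar (Q i) (W i))
      (A := fun i t p => ContinuousLinearMap.compL ℝ (E × E) (E × E) (E × E)
        (coeff (v i) (Q i) (R i) (W i t p))) hZs
      (fun i p hp t => hasDerivAt_covar (h.smooth_conn i) (h.curv i) (h.isOpen_dom i)
        ((h.symb_vel 0).smooth i) (h.isOpen_par i) (h.smooth i) (h.deriv i) (h.mem i) hp t)
      hZ0 (hA.clm (ContinuousLinearMap.compL ℝ (E × E) (E × E) (E × E)) zero_le_one)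
    refine (((Symb.const hA.one_le hA.isOpen (ContinuousLinearMap.id ℝ (E × E))).add hN).clm_comp
      zero_le_one hZ).congr fun j p hp => ?_
    exact fderiv_eq_comp_covar _ _ _ _
  induction n with
  | zero => exact hstep 0 fun k hk => absurd hk (Nat.not_lt_zero k)
  | succ n ih => exact hstep _ fun k hk => by simpa using ih.bound k (by omega)

/-- The displacement of the position, divided by time. -/
theorem symb_fderiv_displacement (h : IsSymbFlow M Ω U v Q R W) (n : ℕ) :
    Symb n 0 (fun j : ι × UnitTime => M j.1) (fun j => U j.1)
      (fun j => fderiv ℝ (fun p => (j.2 : ℝ)⁻¹ • ((W j.1 j.2 p).1 - p.1))) := by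
  have hDW := h.symb_fderiv n
  have hd : ∀ i t, ContDiffOn ℝ ∞ (fun p => (W i t p).1 - p.1) (U i) := fun i t =>
    (h.smooth_slice i t).fst.sub contDiffOn_fst
  refine ⟨hDW.one_le, hDW.isOpen, fun j =>
    ((contDiffOn_infty_iff_fderiv_of_isOpen (hDW.isOpen j)).1
      (contDiffOn_const.smul (hd j.1 j.2))).2, fun k hk => ?_⟩
  have hvW : Symb (n + 1) 1 (fun j : ι × UnitTime => M j.1) (fun j => U j.1)
      (fun j p => v j.1 (W j.1 j.2 p)) :=
    ((h.symb_vel (n + 1)).reindex (Prod.fst : ι × UnitTime → ι)).comp_one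
      (fun j => h.smooth_slice j.1 j.2) (fun j p hp => h.mem j.1 p hp j.2) hDW
  obtain ⟨C, hC0, hC⟩ := hvW.bound_nonneg (k := k + 1) (by omega)
  refine ⟨C, fun j p hp => ?_⟩
  have hM := h.one_le j.1
  rw [norm_iteratedFDeriv_fderiv]
  have hsm : ContDiffAt ℝ (k + 1 : ℕ) (fun p => (W j.1 j.2 p).1 - p.1) p :=
    ((hd j.1 j.2).contDiffAt ((h.isOpen_par j.1).mem_nhds hp)).of_le (by norm_cast; simp)
  have e1 : (fun p => (j.2 : ℝ)⁻¹ • ((W j.1 j.2 p).1 - p.1)) =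
      (j.2 : ℝ)⁻¹ • fun p => (W j.1 j.2 p).1 - p.1 := rfl
  rw [e1, iteratedFDeriv_const_smul_apply hsm, norm_smul]
  have hder := fun s : ℝ => hasDerivAt_iteratedFDeriv_slice (h.isOpen_par j.1) (k + 1)
    (f := fun s p => (W j.1 s p).1 - p.1) (f' := fun s p => v j.1 (W j.1 s p))
    ((h.smooth j.1).fst.sub (contDiff_snd.fst.contDiffOn))
    (fun q hq s => (h.deriv j.1 q hq s).fst.sub_const _) hp s
  have h0 : iteratedFDeriv ℝ (k + 1) (fun p => (W j.1 0 p).1 - p.1) p = 0 := by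
    have : (fun p => (W j.1 0 p).1 - p.1) =ᶠ[𝓝 p] fun _ => (0 : E) := by
      filter_upwards [(h.isOpen_par j.1).mem_nhds hp] with q hq
      rw [h.init j.1 q hq, sub_self]
    rw [(this.iteratedFDeriv ℝ (k + 1)).eq_of_nhds, iteratedFDeriv_succ_const]; rfl
  -- The displacement vanishes at time `0` and has time derivative `v` along the flow, a symbol of
  -- weight `1`. The mean value inequality supplies the factor `|t|` that is divided out.
  have hmv := (convex_Icc (-1 : ℝ) 1).norm_image_sub_le_of_norm_hasDerivWithin_le
    (C := C * M j.1 ^ k) (fun s _ => (hder s).hasDerivWithinAt)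
    (fun s hs => by simpa using hC (j.1, ⟨s, abs_le.2 hs⟩) p hp)
    (x := 0) (y := (j.2 : ℝ)) (by simp) (abs_le.1 j.2.2)
  rw [h0, sub_zero, sub_zero] at hmv
  rw [norm_inv, Nat.sub_zero]
  -- At `t = 0` the quotient is zero because `0⁻¹ = 0`.
  rcases eq_or_ne (j.2 : ℝ) 0 with ht | ht
  · rw [ht, norm_zero, inv_zero, zero_mul]; positivity
  · rw [inv_mul_le_iff₀ (norm_pos_iff.2 ht)]
    linarith

end IsSymbFlow

end PhaseFlow

/-! ### Inverting the position map -/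

/-- The mean value inequality makes `f - id` a contraction with constant `1 / 2`, and a map this
close to an invertible linear map on the whole space is injective and onto. -/
theorem bijective_of_norm_fderiv_sub_id_le {E : Type*} [NormedAddCommGroup E] [NormedSpace ℝ E]
    [CompleteSpace E] {f : E → E} (hf : Differentiable ℝ f)
    (h : ∀ y, ‖fderiv ℝ f y - ContinuousLinearMap.id ℝ E‖ ≤ 1 / 2) : Function.Bijective f := by
  have ha : ApproximatesLinearOn f
      ((ContinuousLinearEquiv.refl ℝ E : E ≃L[ℝ] E) : E →L[ℝ] E) univ (1 / 2 : ℝ≥0) := by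
    intro x _ y _
    have := convex_univ.norm_image_sub_le_of_norm_fderiv_le' (f := f)
      (φ := ContinuousLinearMap.id ℝ E) (C := 1 / 2) (fun z _ => hf z) (fun z _ => h z)
      (mem_univ y) (mem_univ x)
    simpa using this
  have hc : Subsingleton E ∨ (1 / 2 : ℝ≥0) <
      ‖((ContinuousLinearEquiv.refl ℝ E).symm : E →L[ℝ] E)‖₊⁻¹ := by
    rcases subsingleton_or_nontrivial E with h | h
    · exact Or.inl h
    · right
      have : ‖((ContinuousLinearEquiv.refl ℝ E).symm : E →L[ℝ] E)‖₊ = 1 :=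
        NNReal.eq ContinuousLinearMap.norm_id
      rw [this, inv_one]
      exact NNReal.half_lt_self one_ne_zero
  exact ⟨injOn_univ.1 (ha.injOn hc), ha.surjective hc⟩

namespace PhaseFlow

variable {E : Type u} [NormedAddCommGroup E] [NormedSpace ℝ E]

/-- `∂_y x`. -/
noncomputable def posJac (T : E × E →L[ℝ] E × E) : E →L[ℝ] E :=
  (ContinuousLinearMap.fst ℝ E E).comp (T.comp (ContinuousLinearMap.inl ℝ E E))

/-- The derivative of the inverse position map, in terms of the derivative `T` of the flow. -/
noncomputable def invDeriv (T : E × E →L[ℝ] E × E) : E × E →L[ℝ] E :=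
  (Ring.inverse (posJac T)).comp (ContinuousLinearMap.fst ℝ E E -
    (ContinuousLinearMap.fst ℝ E E).comp ((T.comp (ContinuousLinearMap.inr ℝ E E)).comp
      (ContinuousLinearMap.snd ℝ E E)))

/-- `(y, η) ↦ (x, η)`. -/
def posMap (W : E × E → E × E) (p : E × E) : E × E := ((W p).1, p.2)

theorem isUnit_of_norm_sub_one_lt [CompleteSpace E] {T : E →L[ℝ] E} (h : ‖T - 1‖ < 1) :
    IsUnit T := by
  have := isUnit_one_sub_of_norm_lt_one (x := 1 - T) (by rwa [norm_sub_rev])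
  simpa using this

/-- The derivative of `posMap` as an equivalence. -/
noncomputable def posEquiv [CompleteSpace E] (T : E × E →L[ℝ] E × E)
    (h : ‖posJac T - 1‖ < 1) : (E × E) ≃L[ℝ] (E × E) :=
  ContinuousLinearEquiv.equivOfInverse
    (((ContinuousLinearMap.fst ℝ E E).comp T).prod (ContinuousLinearMap.snd ℝ E E))
    ((invDeriv T).prod (ContinuousLinearMap.snd ℝ E E))
    (fun z => by
      have h1 := Ring.inverse_mul_cancel _ (isUnit_of_norm_sub_one_lt h)
      have h2 : T z = T (z.1, 0) + T (0, z.2) := by rw [← map_add]; simp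
      have h3 := ContinuousLinearMap.ext_iff.1 h1 z.1
      simp only [mul_apply_eq_comp, one_apply_eq_self] at h3
      have h4 : posJac T z.1 = (T (z.1, 0)).1 := by simp [posJac]
      refine Prod.ext ?_ rfl
      rw [h4] at h3
      simp [invDeriv, h2, h3])
    (fun z => by
      have h1 := Ring.mul_inverse_cancel _ (isUnit_of_norm_sub_one_lt h)
      set a := invDeriv T z with ha
      have h3 : posJac T a = z.1 - (T (0, z.2)).1 := by
        have := ContinuousLinearMap.ext_iff.1 h1 (z.1 - (T (0, z.2)).1)
        simp only [mul_apply_eq_comp, one_apply_eq_self] at this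
        rw [← this, ha]
        simp [invDeriv]
      have h4 : posJac T a = (T (a, 0)).1 := by simp [posJac]
      have h2 : T (a, z.2) = T (a, 0) + T (0, z.2) := by rw [← map_add]; simp
      refine Prod.ext ?_ rfl
      simp [← ha, h2, ← h4, h3])

theorem hasFDerivAt_posMap {W : E × E → E × E} {p : E × E} (h : DifferentiableAt ℝ W p) :
    HasFDerivAt (posMap W) (((ContinuousLinearMap.fst ℝ E E).comp (fderiv ℝ W p)).prod
      (ContinuousLinearMap.snd ℝ E E)) p :=
  h.hasFDerivAt.fst.prodMk hasFDerivAt_snd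

/-- A right inverse of an injective position map is smooth. -/
theorem contDiffAt_inverse [CompleteSpace E] {W Ψ : E × E → E × E} {U : Set (E × E)}
    (hU : IsOpen U) (hW : ContDiffOn ℝ ∞ W U)
    (hJ : ∀ p ∈ U, ‖posJac (fderiv ℝ W p) - 1‖ < 1) (hinj : InjOn (posMap W) U)
    (hm : MapsTo Ψ U U) (hr : ∀ z ∈ U, posMap W (Ψ z) = z) {z : E × E} (hz : z ∈ U) :
    ContDiffAt ℝ ∞ Ψ z ∧ HasFDerivAt Ψ ((invDeriv (fderiv ℝ W (Ψ z))).prod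
      (ContinuousLinearMap.snd ℝ E E)) z := by
  have ha := hm hz
  have hWa : ContDiffAt ℝ ∞ W (Ψ z) := hW.contDiffAt (hU.mem_nhds ha)
  have hΦ : ContDiffAt ℝ ∞ (posMap W) (Ψ z) := hWa.fst.prodMk contDiffAt_snd
  let e := posEquiv (fderiv ℝ W (Ψ z)) (hJ _ ha)
  have hΦd : HasFDerivAt (posMap W) (e : E × E →L[ℝ] E × E) (Ψ z) :=
    hasFDerivAt_posMap (hWa.differentiableAt (by simp))
  have hloc := hΦ.to_localInverse hΦd (by simp)
  rw [hr z hz] at hloc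
  -- No continuity of `Ψ` is known in advance. The local inverse is continuous, so near `z` it takes
  -- values in `U`, where injectivity of the position map forces it to agree with `Ψ`.
  have heq : Ψ =ᶠ[𝓝 z] hΦ.localInverse hΦd (by simp) := by
    have h1 : hΦ.localInverse hΦd (by simp) z = Ψ z := by
      have := hΦ.localInverse_apply_image hΦd (by simp)
      rwa [hr z hz] at this
    have h2 : ∀ᶠ y in 𝓝 z, hΦ.localInverse hΦd (by simp) y ∈ U :=
      hloc.continuousAt.eventually_mem (by rw [h1]; exact hU.mem_nhds ha)
    have h3 := (hΦ.hasStrictFDerivAt' hΦd (by simp)).eventually_right_inverse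
    rw [hr z hz] at h3
    filter_upwards [h2, h3, hU.mem_nhds hz] with y hy1 hy2 hy3
    exact hinj (hm hy3) hy1 ((hr y hy3).trans hy2.symm)
  have hs : ContDiffAt ℝ ∞ Ψ z := hloc.congr_of_eventuallyEq heq
  refine ⟨hs, ?_⟩
  have hd := (hs.differentiableAt (by simp)).hasFDerivAt
  have hid : posMap W ∘ Ψ =ᶠ[𝓝 z] id := by
    filter_upwards [hU.mem_nhds hz] with y hy using hr y hy
  have hcomp := ((hΦd.comp z hd).congr_of_eventuallyEq hid.symm).unique (hasFDerivAt_id z)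
  have : fderiv ℝ Ψ z = (e.symm : E × E →L[ℝ] E × E) := by
    refine ContinuousLinearMap.ext fun h => ?_
    have h1 := ContinuousLinearMap.ext_iff.1 hcomp h
    simp only [ContinuousLinearMap.comp_apply, ContinuousLinearMap.id_apply,
      ContinuousLinearEquiv.coe_coe] at h1
    rw [ContinuousLinearEquiv.coe_coe, ← ContinuousLinearEquiv.eq_symm_apply] at *
    exact h1
  rw [this] at hd
  exact hd

theorem Symb.clm_prod {ι F G H K : Type*} [NormedAddCommGroup F] [NormedSpace ℝ F]
    [NormedAddCommGroup G] [NormedSpace ℝ G] [NormedAddCommGroup H] [NormedSpace ℝ H]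
    [NormedAddCommGroup K] [NormedSpace ℝ K] {N : ℕ} {M : ι → ℝ} {Ω : ι → Set F}
    {f : ι → F → G →L[ℝ] H} {g : ι → F → G →L[ℝ] K} (hf : Symb N 0 M Ω f) (hg : Symb N 0 M Ω g) :
    Symb N 0 M Ω (fun i w => (f i w).prod (g i w)) := by
  refine (((Symb.const hf.one_le hf.isOpen (ContinuousLinearMap.inl ℝ H K)).clm_comp zero_le_one
    hf).add ((Symb.const hf.one_le hf.isOpen (ContinuousLinearMap.inr ℝ H K)).clm_comp zero_le_one
    hg)).congr fun i w _ => ?_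
  ext <;> simp

/-! ### Symbol bounds for the inverse position map and the momentum. -/

namespace IsSymbFlow

variable {ι : Type*} {M : ι → ℝ} {Ω U : ι → Set (E × E)} {v : ι → E × E → E}
  {Q : ι → E → E →L[ℝ] E →L[ℝ] E} {R : ι → E → E →L[ℝ] E →L[ℝ] E →L[ℝ] E}
  {W : ι → ℝ → E × E → E × E} {Ψ : ι → ℝ → E × E → E × E}

theorem symb_invDeriv [FiniteDimensional ℝ E] (h : IsSymbFlow M Ω U v Q R W)
    (hJ : ∀ i, ∀ p ∈ U i, ∀ t, |t| ≤ 1 → ‖posJac (fderiv ℝ (W i t) p) - 1‖ ≤ 1 / 2) (n : ℕ) :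
    Symb n 0 (fun j : ι × UnitTime => M j.1) (fun j => U j.1)
      (fun j p => invDeriv (fderiv ℝ (W j.1 j.2) p)) := by
  have : CompleteSpace E := FiniteDimensional.complete ℝ E
  have : ProperSpace (E →L[ℝ] E) := FiniteDimensional.proper_real _
  have hD := h.symb_fderiv n
  have hc : ∀ {G : Type u} [NormedAddCommGroup G] [NormedSpace ℝ G] (c : G),
      Symb n 0 (fun j : ι × UnitTime => M j.1) (fun j => U j.1) (fun _ _ => c) :=
    fun c => Symb.const hD.one_le hD.isOpen c
  have hJs : Symb n 0 (fun j : ι × UnitTime => M j.1) (fun j => U j.1)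
      (fun j p => posJac (fderiv ℝ (W j.1 j.2) p)) :=
    (hc _).clm_comp zero_le_one (hD.clm_comp zero_le_one (hc _))
  have hinv : ContDiffOn ℝ ∞ (Ring.inverse : (E →L[ℝ] E) → _) (ball 1 1) := fun T hT => by
    obtain ⟨T', rfl⟩ := isUnit_of_norm_sub_one_lt (by simpa [dist_eq_norm] using hT)
    exact (contDiffAt_ringInverse ℝ T').contDiffWithinAt
  -- The Jacobian stays within `1 / 2` of the identity. Radius `3 / 4` gives an open set containing
  -- it whose closure is a compact subset of the unit ball, where inversion is smooth; so all
  -- derivatives of inversion are bounded there.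
  have hball : ball (1 : E →L[ℝ] E) (3 / 4) ⊆ ball 1 1 := ball_subset_ball (by norm_num)
  have hI := Symb.fixed_comp (isOpen_ball (x := (1 : E →L[ℝ] E)) (ε := 3 / 4)) (hinv.mono hball)
    (fun k _ => by
      obtain ⟨C, hC⟩ := exists_bound_iteratedFDeriv_of_isCompact isOpen_ball hinv
        (isCompact_closedBall (1 : E →L[ℝ] E) (3 / 4))
        (closedBall_subset_ball (by norm_num)) k
      exact ⟨C, fun z hz => hC z (ball_subset_closedBall hz)⟩) hJs
    (fun j p hp => by
      rw [mem_ball, dist_eq_norm]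
      exact (hJ j.1 p hp j.2 j.2.2).trans_lt (by norm_num))
  exact hI.clm_comp zero_le_one ((hc _).sub zero_le_one ((hc _).clm_comp zero_le_one
    ((hD.clm_comp zero_le_one (hc _)).clm_comp zero_le_one (hc _))))

/-- Hypotheses on a family of inverses of the position maps. -/
structure IsInverse (U : ι → Set (E × E)) (W Ψ : ι → ℝ → E × E → E × E) : Prop where
  jac : ∀ i, ∀ p ∈ U i, ∀ t, |t| ≤ 1 → ‖posJac (fderiv ℝ (W i t) p) - 1‖ ≤ 1 / 2
  inj : ∀ i t, |t| ≤ 1 → InjOn (posMap (W i t)) (U i)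
  maps : ∀ i t, |t| ≤ 1 → MapsTo (Ψ i t) (U i) (U i)
  right_inv : ∀ i t, |t| ≤ 1 → ∀ z ∈ U i, posMap (W i t) (Ψ i t z) = z

variable [FiniteDimensional ℝ E]

theorem contDiffAt_inv (h : IsSymbFlow M Ω U v Q R W) (hΨ : IsInverse U W Ψ) (i : ι) {t : ℝ}
    (ht : |t| ≤ 1) {z : E × E} (hz : z ∈ U i) :
    ContDiffAt ℝ ∞ (Ψ i t) z ∧ HasFDerivAt (Ψ i t) ((invDeriv (fderiv ℝ (W i t) (Ψ i t z))).prod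
      (ContinuousLinearMap.snd ℝ E E)) z :=
  have : CompleteSpace E := FiniteDimensional.complete ℝ E
  contDiffAt_inverse (h.isOpen_par i) (h.smooth_slice i t)
    (fun p hp => (hΨ.jac i p hp t ht).trans_lt (by norm_num)) (hΨ.inj i t ht) (hΨ.maps i t ht)
    (hΨ.right_inv i t ht) hz

/-- The differential of `Ψ` is an expression in the differential of the flow evaluated at `Ψ`. Its
order `n` needs only orders below `n` of the differential of `Ψ`, so induction closes as for the
flow. -/
theorem symb_fderiv_inv (h : IsSymbFlow M Ω U v Q R W) (hΨ : IsInverse U W Ψ) (n : ℕ) :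
    Symb n 0 (fun j : ι × UnitTime => M j.1) (fun j => U j.1) (fun j => fderiv ℝ (Ψ j.1 j.2)) := by
  have hstep : ∀ n, (∀ k < n, ∃ C : ℝ, ∀ j : ι × UnitTime, ∀ p ∈ U j.1,
      ‖iteratedFDeriv ℝ k (fderiv ℝ (Ψ j.1 j.2)) p‖ ≤ C * M j.1 ^ k) →
      Symb n 0 (fun j : ι × UnitTime => M j.1) (fun j => U j.1)
        (fun j => fderiv ℝ (Ψ j.1 j.2)) := by
    intro n hn
    have hH := (h.symb_invDeriv hΨ.jac n).comp (fun j => h.isOpen_par j.1)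
      (fun j z hz => (h.contDiffAt_inv hΨ j.1 j.2.2 hz).1.contDiffWithinAt)
      (fun j => hΨ.maps j.1 j.2 j.2.2) hn
    exact (Symb.clm_prod hH (Symb.const hH.one_le hH.isOpen (ContinuousLinearMap.snd ℝ E E))).congr
      fun j z hz => (h.contDiffAt_inv hΨ j.1 j.2.2 hz).2.fderiv
  induction n with
  | zero => exact hstep 0 fun k hk => absurd hk (Nat.not_lt_zero k)
  | succ n ih => exact hstep _ fun k hk => by simpa using ih.bound k (by omega)

theorem contDiffOn_inv (h : IsSymbFlow M Ω U v Q R W) (hΨ : IsInverse U W Ψ) (i : ι) {t : ℝ}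
    (ht : |t| ≤ 1) : ContDiffOn ℝ ∞ (Ψ i t) (U i) := fun _ hz =>
  (h.contDiffAt_inv hΨ i ht hz).1.contDiffWithinAt

theorem symb_fderiv_comp_inv {G : Type*} [NormedAddCommGroup G] [NormedSpace ℝ G]
    (h : IsSymbFlow M Ω U v Q R W) (hΨ : IsInverse U W Ψ) {n : ℕ}
    {f : ι × UnitTime → E × E → G} (hs : ∀ j, ContDiffOn ℝ ∞ (f j) (U j.1))
    (hf : Symb n 0 (fun j : ι × UnitTime => M j.1) (fun j => U j.1) (fun j => fderiv ℝ (f j))) :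
    Symb n 0 (fun j : ι × UnitTime => M j.1) (fun j => U j.1)
      (fun j => fderiv ℝ (fun z => f j (Ψ j.1 j.2 z))) := by
  refine ((hf.comp_symb (fun j => h.contDiffOn_inv hΨ j.1 j.2.2)
    (fun j => hΨ.maps j.1 j.2 j.2.2) (h.symb_fderiv_inv hΨ n) (Nat.le_succ n)).clm_comp
    zero_le_one (h.symb_fderiv_inv hΨ n)).congr fun j z hz => ?_
  exact fderiv_comp z (((hs j).contDiffAt ((h.isOpen_par j.1).mem_nhds
    (hΨ.maps j.1 j.2 j.2.2 hz))).differentiableAt (by simp))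
    ((h.contDiffAt_inv hΨ j.1 j.2.2 hz).1.differentiableAt (by simp))

/-- The momentum as a function of the final position. -/
theorem symb_fderiv_momentum (h : IsSymbFlow M Ω U v Q R W) (hΨ : IsInverse U W Ψ) (n : ℕ) :
    Symb n 0 (fun j : ι × UnitTime => M j.1) (fun j => U j.1)
      (fun j => fderiv ℝ (fun z => (W j.1 j.2 (Ψ j.1 j.2 z)).2)) := by
  refine h.symb_fderiv_comp_inv hΨ (f := fun j p => (W j.1 j.2 p).2)
    (fun j => (h.smooth_slice j.1 j.2).snd) ?_
  refine ((Symb.const (h.symb_fderiv n).one_le (h.symb_fderiv n).isOpen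
    (ContinuousLinearMap.snd ℝ E E)).clm_comp zero_le_one (h.symb_fderiv n)).congr
    fun j p hp => ?_
  exact (((h.symb_fderiv n).isOpen j |>.mem_nhds hp |> (h.smooth_slice j.1 j.2).contDiffAt
    |>.differentiableAt (by simp)).hasFDerivAt.snd).fderiv

/-- The displacement of the inverse position map, divided by time. -/
theorem symb_fderiv_inv_displacement (h : IsSymbFlow M Ω U v Q R W) (hΨ : IsInverse U W Ψ)
    (n : ℕ) : Symb n 0 (fun j : ι × UnitTime => M j.1) (fun j => U j.1)
      (fun j => fderiv ℝ (fun z => (j.2 : ℝ)⁻¹ • ((Ψ j.1 j.2 z).1 - z.1))) := by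
  have h1 := (h.symb_fderiv_comp_inv hΨ (fun j => contDiffOn_const.smul
    ((h.smooth_slice j.1 j.2).fst.sub contDiffOn_fst))
    (h.symb_fderiv_displacement n)).neg zero_le_one
  refine h1.congr fun j z hz => ?_
  -- The trajectory from `Ψ z` ends at position `z.1`, so the displacement of the inverse is minus
  -- the displacement of the flow evaluated at `Ψ z`.
  have heq : (fun z => (j.2 : ℝ)⁻¹ • ((Ψ j.1 j.2 z).1 - z.1)) =ᶠ[𝓝 z]
      fun z => -((j.2 : ℝ)⁻¹ • ((W j.1 j.2 (Ψ j.1 j.2 z)).1 - (Ψ j.1 j.2 z).1)) := by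
    filter_upwards [(h.isOpen_par j.1).mem_nhds hz] with y hy
    have := congrArg Prod.fst (hΨ.right_inv j.1 j.2 j.2.2 y hy)
    simp only [posMap] at this
    rw [this, ← smul_neg, neg_sub]
  rw [heq.fderiv_eq]
  exact fderiv_fun_neg

end IsSymbFlow

end PhaseFlow

/-! ### Pointwise identities for a smooth metric -/

namespace RoughWave

variable {d : ℕ}

theorem fderiv_apply_eq_sum {F : Type*} [NormedAddCommGroup F] [NormedSpace ℝ F] (f : E d → F)
    (x h : E d) : fderiv ℝ f x h = ∑ i, h i • partialDeriv i f x := by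
  have hh : h = ∑ i, h i • EuclideanSpace.single i (1 : ℝ) := by
    ext j
    simp [Finset.sum_apply, Pi.single_apply]
  conv_lhs => rw [hh]
  simp [partialDeriv]

/-- Differentiating the inverse of a matrix-valued function. -/
theorem fderiv_inverse_entries {X : Type*} [NormedAddCommGroup X] [NormedSpace ℝ X]
    {A B : Fin d → Fin d → X → ℝ} {x : X} (hA : ∀ i j, DifferentiableAt ℝ (A i j) x)
    (hB : ∀ i j, DifferentiableAt ℝ (B i j) x)
    (hAB : ∀ y i k, ∑ j, A i j y * B j k y = (1 : Matrix (Fin d) (Fin d) ℝ) i k)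
    (hBA : ∀ y i k, ∑ j, B i j y * A j k y = (1 : Matrix (Fin d) (Fin d) ℝ) i k)
    (i j : Fin d) :
    fderiv ℝ (B i j) x = -∑ a, ∑ b, (B i a x * B b j x) • fderiv ℝ (A a b) x := by
  have h1 : ∀ a, ∑ b, (A a b x • fderiv ℝ (B b j) x + B b j x • fderiv ℝ (A a b) x) = 0 := by
    intro a
    have h2 : HasFDerivAt (fun y => ∑ b, A a b y * B b j y)
        (∑ b, (A a b x • fderiv ℝ (B b j) x + B b j x • fderiv ℝ (A a b) x)) x :=
      HasFDerivAt.fun_sum fun b _ => (hA a b).hasFDerivAt.mul (hB b j).hasFDerivAt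
    have h3 : (fun y => ∑ b, A a b y * B b j y) =
        fun _ => (1 : Matrix (Fin d) (Fin d) ℝ) a j := by funext y; exact hAB y a j
    rw [h3] at h2
    exact h2.unique (hasFDerivAt_const _ _)
  have h4 : ∑ a, B i a x • ∑ b, (A a b x • fderiv ℝ (B b j) x + B b j x • fderiv ℝ (A a b) x) = 0 := by
    simp [h1]
  have h5 : ∑ a, B i a x • ∑ b, A a b x • fderiv ℝ (B b j) x = fderiv ℝ (B i j) x := by
    simp only [Finset.smul_sum, smul_smul]
    rw [Finset.sum_comm]
    simp only [← Finset.sum_smul, hBA x i, Matrix.one_apply]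
    simp
  simp only [Finset.sum_add_distrib, smul_add, h5] at h4
  rw [eq_neg_iff_add_eq_zero, ← h4]
  simp only [Finset.smul_sum, smul_smul]

theorem IsSmoothMetric.isUnit_det {g : E d → Matrix (Fin d) (Fin d) ℝ} (hg : IsSmoothMetric g)
    (x : E d) : IsUnit (g x).det := (hg.posDef x).det_pos.ne'.isUnit

section Metric

variable {g : E d → Matrix (Fin d) (Fin d) ℝ}

theorem IsSmoothMetric.symm (hg : IsSmoothMetric g) (x : E d) (i j : Fin d) : g x i j = g x j i := by
  have := (hg.posDef x).isHermitian.apply i j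
  simpa using this.symm

theorem IsSmoothMetric.inv_symm (hg : IsSmoothMetric g) (x : E d) (i j : Fin d) :
    metricInv g i j x = metricInv g j i x := by
  have := (hg.posDef x).isHermitian.inv.apply i j
  simpa [metricInv] using this.symm

theorem IsSmoothMetric.inv_mul (hg : IsSmoothMetric g) (x : E d) (i k : Fin d) :
    ∑ j, metricInv g i j x * g x j k = (1 : Matrix (Fin d) (Fin d) ℝ) i k := by
  rw [← Matrix.nonsing_inv_mul _ (hg.isUnit_det x), Matrix.mul_apply]; rfl

theorem IsSmoothMetric.mul_inv (hg : IsSmoothMetric g) (x : E d) (i k : Fin d) :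
    ∑ j, g x i j * metricInv g j k x = (1 : Matrix (Fin d) (Fin d) ℝ) i k := by
  rw [← Matrix.mul_nonsing_inv _ (hg.isUnit_det x), Matrix.mul_apply]; rfl

theorem IsSmoothMetric.contDiff_inv (hg : IsSmoothMetric g) (i j : Fin d) : ContDiff ℝ ∞ (metricInv g i j) := by
  have hdet : ∀ A : E d → Matrix (Fin d) (Fin d) ℝ, (∀ i j, ContDiff ℝ ∞ fun x => A x i j) →
      ContDiff ℝ ∞ fun x => (A x).det := by
    intro A hA
    simp only [Matrix.det_apply]
    exact ContDiff.sum fun σ _ => (contDiff_prod fun i _ => hA _ _).const_smul _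
  have h1 : metricInv g i j = fun x => (g x).det⁻¹ * (g x).adjugate i j := by
    funext x
    simp [metricInv, Matrix.inv_def, Ring.inverse_eq_inv']
  rw [h1]
  refine ((hdet g hg.smooth).inv fun x => (hg.isUnit_det x).ne_zero).mul ?_
  simp only [Matrix.adjugate_apply]
  refine hdet _ fun a b => ?_
  by_cases ha : a = j
  · subst ha; simp only [Matrix.updateRow_self]; exact contDiff_const
  · simp only [Matrix.updateRow_ne ha]; exact hg.smooth a b

theorem IsSmoothMetric.fderiv_inv (hg : IsSmoothMetric g) (i j : Fin d) (x : E d) :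
    fderiv ℝ (metricInv g i j) x =
      -∑ a, ∑ b, (metricInv g i a x * metricInv g b j x) • fderiv ℝ (fun y => g y a b) x :=
  fderiv_inverse_entries (A := fun a b y => g y a b)
    (fun i j => (hg.smooth i j).differentiable (by simp) x)
    (fun i j => (hg.contDiff_inv i j).differentiable (by simp) x) hg.mul_inv hg.inv_mul i j

theorem IsSmoothMetric.fderiv_metric (hg : IsSmoothMetric g) (i j : Fin d) (x : E d) :
    fderiv ℝ (fun y => g y i j) x =
      -∑ a, ∑ b, (g x i a * g x b j) • fderiv ℝ (metricInv g a b) x :=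
  fderiv_inverse_entries (B := fun a b y => g y a b)
    (fun i j => (hg.contDiff_inv i j).differentiable (by simp) x)
    (fun i j => (hg.smooth i j).differentiable (by simp) x) hg.inv_mul hg.mul_inv i j

theorem IsSmoothMetric.riemannUp_eq (hg : IsSmoothMetric g) (n j k l : Fin d) (x : E d) :
    riemannUp g n j k l x = ∑ i, metricInv g n i x * riemann g i j k l x := by
  simp only [riemann, Finset.mul_sum, ← mul_assoc]
  rw [Finset.sum_comm]
  simp only [← Finset.sum_mul, hg.inv_mul x n, Matrix.one_apply]
  simp

theorem contDiff_partialDeriv {f : E d → ℝ} (hf : ContDiff ℝ ∞ f) (k : Fin d) :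
    ContDiff ℝ ∞ (partialDeriv k f) :=
  (hf.fderiv_right (m := ∞) (by norm_cast)).clm_apply contDiff_const

theorem IsSmoothMetric.contDiff_christoffel (hg : IsSmoothMetric g) (n i j : Fin d) : ContDiff ℝ ∞ (christoffel g n i j) :=
  contDiff_const.mul (ContDiff.sum fun m _ => (hg.contDiff_inv n m).mul
    (((contDiff_partialDeriv (hg.smooth _ _) _).add
      (contDiff_partialDeriv (hg.smooth _ _) _)).sub
      (contDiff_partialDeriv (hg.smooth _ _) _)))

/-- The antisymmetrized derivative of the Christoffel symbols is controlled by curvature. -/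
theorem IsSmoothMetric.partialDeriv_christoffel_sub (hg : IsSmoothMetric g) (n k l a : Fin d) (x : E d) :
    partialDeriv l (christoffel g n a k) x - partialDeriv a (christoffel g n l k) x =
      ∑ i, metricInv g n i x * riemann g i k l a x -
        ∑ m, (christoffel g n l m x * christoffel g m a k x
          - christoffel g n a m x * christoffel g m l k x) := by
  rw [← hg.riemannUp_eq, riemannUp]; ring

/-- `∑ Γ^n_{ak} ξ^a ξ_n = -(1/2) ∑ ∂_k g^{ij} ξ_i ξ_j`. -/
theorem IsSmoothMetric.sum_christoffel (hg : IsSmoothMetric g) (x ξ : E d) (k : Fin d) :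
    ∑ n, ∑ a, christoffel g n a k x * (∑ b, metricInv g a b x * ξ b) * ξ n =
      -(1 / 2 : ℝ) * ∑ i, ∑ j, partialDeriv k (metricInv g i j) x * ξ i * ξ j := by
  set u : Fin d → ℝ := fun a => ∑ b, metricInv g a b x * ξ b with hu
  have hu' : ∀ m, ∑ n, metricInv g n m x * ξ n = u m := fun m =>
    Finset.sum_congr rfl fun n _ => by rw [hg.inv_symm]
  set D : Fin d → Fin d → Fin d → ℝ := fun k i j => partialDeriv k (fun z => g z i j) x with hD
  have hDs : ∀ k i j, D k i j = D k j i := fun k i j => by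
    simp only [hD]; congr 1; funext z; exact hg.symm z i j
  have hleft : ∑ n, ∑ a, christoffel g n a k x * u a * ξ n =
      (1 / 2 : ℝ) * ∑ m, ∑ a, u m * u a * D k a m := by
    have e1 : ∀ n a, christoffel g n a k x * u a * ξ n = (1 / 2 : ℝ) *
        ∑ m, (metricInv g n m x * ξ n) * (u a * (D a k m + D k a m - D m a k)) := fun n a => by
      simp only [christoffel, hD, Finset.mul_sum, Finset.sum_mul]
      exact Finset.sum_congr rfl fun m _ => by ring
    simp only [e1, ← Finset.mul_sum]
    congr 1
    calc ∑ n, ∑ a, ∑ m, (metricInv g n m x * ξ n) * (u a * (D a k m + D k a m - D m a k))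
        = ∑ m, ∑ a, ∑ n, (metricInv g n m x * ξ n) * (u a * (D a k m + D k a m - D m a k)) := by
          rw [Finset.sum_comm]
          refine (Finset.sum_congr rfl fun a _ => Finset.sum_comm).trans ?_
          exact Finset.sum_comm
      _ = ∑ m, ∑ a, (u m * u a * D k a m + (u m * u a * D a k m - u m * u a * D m a k)) := by
          refine Finset.sum_congr rfl fun m _ => Finset.sum_congr rfl fun a _ => ?_
          rw [← Finset.sum_mul, hu' m]; ring
      -- The part of the Christoffel bracket that is antisymmetric in `a` and `m` drops out against
      -- the symmetric product `u m * u a`.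
      _ = ∑ m, ∑ a, u m * u a * D k a m := by
          simp only [Finset.sum_add_distrib, Finset.sum_sub_distrib]
          have : ∑ m, ∑ a, u m * u a * D a k m = ∑ m, ∑ a, u m * u a * D m a k := by
            rw [Finset.sum_comm]
            exact Finset.sum_congr rfl fun m _ => Finset.sum_congr rfl fun a _ => by
              rw [hDs m k a]; ring
          rw [this]; ring
  have hright : ∑ i, ∑ j, partialDeriv k (metricInv g i j) x * ξ i * ξ j =
      -∑ m, ∑ a, u m * u a * D k a m := by
    have e2 : ∀ i j, partialDeriv k (metricInv g i j) x * ξ i * ξ j =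
        -∑ a, ∑ b, (metricInv g i a x * ξ i) * ((metricInv g b j x * ξ j) * D k a b) := by
      intro i j
      simp only [partialDeriv, hg.fderiv_inv i j x, hD]
      simp only [sum_apply, neg_apply, smul_apply, smul_eq_mul,
        Finset.sum_mul, neg_mul]
      congr 1
      exact Finset.sum_congr rfl fun a _ => Finset.sum_congr rfl fun b _ => by ring
    simp only [e2, Finset.sum_neg_distrib]
    congr 1
    calc ∑ i, ∑ j, ∑ a, ∑ b, (metricInv g i a x * ξ i) * ((metricInv g b j x * ξ j) * D k a b)
        = ∑ i, ∑ a, ∑ b, (metricInv g i a x * ξ i) * (u b * D k a b) := by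
          refine Finset.sum_congr rfl fun i _ => ?_
          rw [Finset.sum_comm]
          refine Finset.sum_congr rfl fun a _ => ?_
          rw [Finset.sum_comm]
          refine Finset.sum_congr rfl fun b _ => ?_
          rw [← Finset.mul_sum, ← Finset.sum_mul]
      _ = ∑ a, ∑ b, u a * (u b * D k a b) := by
          rw [Finset.sum_comm]
          refine Finset.sum_congr rfl fun a _ => ?_
          rw [Finset.sum_comm]
          refine Finset.sum_congr rfl fun b _ => ?_
          rw [← Finset.sum_mul, hu' a]
      _ = ∑ m, ∑ a, u m * u a * D k a m :=
          Finset.sum_congr rfl fun m _ => Finset.sum_congr rfl fun a _ => by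
            rw [hDs k a m]; ring
  rw [hleft, hright]; ring

end Metric

end RoughWave

/-! ### The metric as a field of operators -/

namespace RoughWave

variable {d : ℕ}

/-- Elementary constant tensors. Every operator field below is a finite combination of them with
scalar coefficients, so bounds on components transfer to operators with constants depending only on
`d`. -/
noncomputable def tens2 (i j : Fin d) : E d →L[ℝ] E d :=
  (EuclideanSpace.proj (𝕜 := ℝ) j : E d →L[ℝ] ℝ).smulRight (EuclideanSpace.single i (1 : ℝ))

noncomputable def tens3 (a n k : Fin d) : E d →L[ℝ] E d →L[ℝ] E d :=
  (EuclideanSpace.proj (𝕜 := ℝ) a : E d →L[ℝ] ℝ).smulRight (tens2 k n)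

noncomputable def tens4 (l a n k : Fin d) : E d →L[ℝ] E d →L[ℝ] E d →L[ℝ] E d :=
  (EuclideanSpace.proj (𝕜 := ℝ) l : E d →L[ℝ] ℝ).smulRight (tens3 a n k)

theorem tens2_apply (i j : Fin d) (ξ : E d) :
    tens2 i j ξ = ξ j • EuclideanSpace.single i (1 : ℝ) := by simp [tens2]

theorem tens3_apply (a n k : Fin d) (v : E d) : tens3 a n k v = v a • tens2 k n := by simp [tens3]

theorem tens4_apply (l a n k : Fin d) (v : E d) : tens4 l a n k v = v l • tens3 a n k := by
  simp [tens4]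

noncomputable def matOp (A : Matrix (Fin d) (Fin d) ℝ) : E d →L[ℝ] E d :=
  ∑ i, ∑ j, A i j • tens2 i j

theorem matOp_apply (A : Matrix (Fin d) (Fin d) ℝ) (u : E d) (i : Fin d) :
    matOp A u i = ∑ j, A i j * u j := by
  simp [matOp, tens2_apply, sum_apply, Finset.sum_apply, Pi.single_apply]

theorem matOp_one : matOp (1 : Matrix (Fin d) (Fin d) ℝ) = ContinuousLinearMap.id ℝ (E d) := by
  ext u i
  simp [matOp_apply, Matrix.one_apply]

theorem matOp_comp (A B : Matrix (Fin d) (Fin d) ℝ) (u : E d) :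
    matOp A (matOp B u) = matOp (A * B) u := by
  ext i
  simp only [matOp_apply, Matrix.mul_apply, Finset.mul_sum, Finset.sum_mul]
  rw [Finset.sum_comm]
  exact Finset.sum_congr rfl fun _ _ => Finset.sum_congr rfl fun _ _ => by ring

theorem norm_matOp_sub_le {A B : Matrix (Fin d) (Fin d) ℝ} {c : ℝ}
    (h : ∀ i j, |A i j - B i j| ≤ c) :
    ‖matOp A - matOp B‖ ≤ c * ∑ i, ∑ j, ‖tens2 (d := d) i j‖ := by
  simp only [matOp, ← Finset.sum_sub_distrib, ← sub_smul, Finset.mul_sum]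
  refine norm_sum_le_of_le _ fun i _ => norm_sum_le_of_le _ fun j _ => ?_
  rw [norm_smul]
  gcongr
  exact h i j

/-- The operator with matrix `g^{ij}(x)`. -/
noncomputable def invOp (g : E d → Matrix (Fin d) (Fin d) ℝ) (x : E d) : E d →L[ℝ] E d :=
  ∑ i, ∑ j, metricInv g i j x • tens2 i j

theorem invOp_eq (g : E d → Matrix (Fin d) (Fin d) ℝ) (x : E d) : invOp g x = matOp (g x)⁻¹ := rfl

/-- The bilinear map `(v, ξ) ↦ ∑ Γ^n_{ak} v^a ξ_n e_k`. -/
noncomputable def conn (g : E d → Matrix (Fin d) (Fin d) ℝ) (x : E d) :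
    E d →L[ℝ] E d →L[ℝ] E d :=
  ∑ a, ∑ n, ∑ k, christoffel g n a k x • tens3 a n k

/-- The trilinear map with coefficients `∂_l Γ^n_{ak} - ∂_a Γ^n_{lk}`. -/
noncomputable def curvOp (g : E d → Matrix (Fin d) (Fin d) ℝ) (x : E d) :
    E d →L[ℝ] E d →L[ℝ] E d →L[ℝ] E d :=
  ∑ l, ∑ a, ∑ n, ∑ k, (partialDeriv l (christoffel g n a k) x -
    partialDeriv a (christoffel g n l k) x) • tens4 l a n k

/-- The quadratic form `∑ g^{ij} ξ_i ξ_j`. -/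
noncomputable def quad (g : E d → Matrix (Fin d) (Fin d) ℝ) (w : E d × E d) : ℝ :=
  inner ℝ (invOp g w.1 w.2) w.2

/-- The velocity `∇_ξ p`. -/
noncomputable def vel (g : E d → Matrix (Fin d) (Fin d) ℝ) (w : E d × E d) : E d :=
  (√(quad g w))⁻¹ • invOp g w.1 w.2

variable {g : E d → Matrix (Fin d) (Fin d) ℝ}

theorem hamiltonian_eq (x ξ : E d) : hamiltonian g x ξ = √(quad g (x, ξ)) := by
  rw [hamiltonian, quad]
  congr 1
  simp only [PiLp.inner_apply, invOp_eq, matOp_apply]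
  refine Finset.sum_congr rfl fun i _ => ?_
  simp only [RCLike.inner_apply, Finset.mul_sum, conj_trivial, metricInv]
  exact Finset.sum_congr rfl fun j _ => by ring

theorem IsSmoothMetric.contDiff_invOp (hg : IsSmoothMetric g) : ContDiff ℝ ∞ (invOp g) :=
  ContDiff.sum fun i _ => ContDiff.sum fun j _ => (hg.contDiff_inv i j).smul contDiff_const

theorem IsSmoothMetric.contDiff_conn (hg : IsSmoothMetric g) : ContDiff ℝ ∞ (conn g) :=
  ContDiff.sum fun a _ => ContDiff.sum fun n _ => ContDiff.sum fun k _ =>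
    (hg.contDiff_christoffel n a k).smul contDiff_const

theorem conn_apply (x v ξ : E d) (k : Fin d) :
    conn g x v ξ k = ∑ n, ∑ a, christoffel g n a k x * v a * ξ n := by
  simp only [conn, sum_apply, smul_apply, tens3_apply, tens2_apply, smul_eq_mul, PiLp.smul_apply,
    WithLp.ofLp_sum, Finset.sum_apply]
  rw [Finset.sum_comm]
  refine Finset.sum_congr rfl fun n _ => Finset.sum_congr rfl fun a _ => ?_
  rw [Finset.sum_eq_single k]
  · simp; ring
  · intro b _ hb
    simp [hb.symm]
  · simp

theorem IsSmoothMetric.fderiv_conn (hg : IsSmoothMetric g) (x J : E d) :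
    fderiv ℝ (conn g) x J =
      ∑ l, ∑ a, ∑ n, ∑ k, (J l * partialDeriv l (christoffel g n a k) x) • tens3 a n k := by
  have h : HasFDerivAt (conn g) (∑ a, ∑ n, ∑ k,
      (fderiv ℝ (christoffel g n a k) x).smulRight (tens3 a n k)) x :=
    HasFDerivAt.fun_sum fun a _ => HasFDerivAt.fun_sum fun n _ => HasFDerivAt.fun_sum fun k _ =>
      (((hg.contDiff_christoffel n a k).differentiable (by simp) x).hasFDerivAt).smul_const _
  rw [h.fderiv]
  simp only [sum_apply, ContinuousLinearMap.smulRight_apply, fderiv_apply_eq_sum _ x J,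
    Finset.sum_smul, smul_eq_mul]
  symm
  rw [Finset.sum_comm]
  refine Finset.sum_congr rfl fun a _ => ?_
  rw [Finset.sum_comm]
  refine Finset.sum_congr rfl fun n _ => ?_
  rw [Finset.sum_comm]

/-- Identifies the coordinate tensor, whose coefficients are controlled by the curvature, with the
antisymmetrized derivative demanded by the abstract flow argument. -/
theorem IsSmoothMetric.curvOp_apply (hg : IsSmoothMetric g) (x J y z : E d) :
    curvOp g x J y z = fderiv ℝ (conn g) x J y z - fderiv ℝ (conn g) x y J z := by
  rw [hg.fderiv_conn x J, hg.fderiv_conn x y]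
  conv_rhs => rhs; rw [Finset.sum_comm]
  simp only [curvOp, sum_apply, smul_apply, tens4_apply, tens3_apply, ← Finset.sum_sub_distrib]
  refine Finset.sum_congr rfl fun l _ => Finset.sum_congr rfl fun a _ =>
    Finset.sum_congr rfl fun n _ => Finset.sum_congr rfl fun k _ => ?_
  simp only [smul_smul, ← sub_smul]
  congr 1; ring

theorem IsSmoothMetric.inner_invOp_comm (hg : IsSmoothMetric g) (x u v : E d) :
    inner ℝ (invOp g x u) v = inner ℝ u (invOp g x v) := by
  simp only [PiLp.inner_apply, invOp_eq, matOp_apply, RCLike.inner_apply,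
    conj_trivial, Finset.mul_sum, Finset.sum_mul]
  rw [Finset.sum_comm]
  refine Finset.sum_congr rfl fun i _ => Finset.sum_congr rfl fun j _ => ?_
  have := hg.inv_symm x i j
  simp only [metricInv] at this
  rw [this]; ring

theorem IsSmoothMetric.fderiv_invOp (hg : IsSmoothMetric g) (x h : E d) :
    fderiv ℝ (invOp g) x h = ∑ i, ∑ j, fderiv ℝ (metricInv g i j) x h • tens2 i j := by
  have h1 : HasFDerivAt (invOp g) (∑ i, ∑ j,
      (fderiv ℝ (metricInv g i j) x).smulRight (tens2 i j)) x :=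
    HasFDerivAt.fun_sum fun i _ => HasFDerivAt.fun_sum fun j _ =>
      (((hg.contDiff_inv i j).differentiable (by simp) x).hasFDerivAt).smul_const _
  rw [h1.fderiv]
  simp only [sum_apply, ContinuousLinearMap.smulRight_apply]

/-- The momentum equation in terms of the connection. -/
theorem IsSmoothMetric.inner_conn (hg : IsSmoothMetric g) (x ξ h : E d) :
    inner ℝ (conn g x (invOp g x ξ) ξ) h =
      -(1 / 2 : ℝ) * inner ℝ (fderiv ℝ (invOp g) x h ξ) ξ := by
  have h1 : ∀ k, conn g x (invOp g x ξ) ξ k =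
      -(1 / 2 : ℝ) * ∑ i, ∑ j, partialDeriv k (metricInv g i j) x * ξ i * ξ j := fun k => by
    rw [conn_apply, ← hg.sum_christoffel]
    simp only [invOp_eq, matOp_apply, metricInv]
  have h2 : inner ℝ (fderiv ℝ (invOp g) x h ξ) ξ =
      ∑ i, ∑ j, ∑ k, h k * (partialDeriv k (metricInv g i j) x * ξ i * ξ j) := by
    rw [hg.fderiv_invOp]
    simp only [sum_apply, smul_apply, tens2_apply, sum_inner, inner_smul_left,
      EuclideanSpace.inner_single_left, fderiv_apply_eq_sum _ x h, conj_trivial, smul_eq_mul,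
      Finset.sum_mul]
    exact Finset.sum_congr rfl fun i _ => Finset.sum_congr rfl fun j _ =>
      Finset.sum_congr rfl fun k _ => by ring
  rw [h2]
  simp only [PiLp.inner_apply, h1, RCLike.inner_apply, conj_trivial,
    Finset.mul_sum]
  rw [Finset.sum_comm]
  refine Finset.sum_congr rfl fun i _ => ?_
  rw [Finset.sum_comm]
  exact Finset.sum_congr rfl fun j _ => Finset.sum_congr rfl fun k _ => by ring

/-! ### Consequences of smallness -/

theorem SmallMetric.bounds {c : ℝ} (hc : 0 < c) (h : SmallMetric g c) :
    (∀ i j k l x, |riemann g i j k l x| ≤ c) ∧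
    (∀ i j x, |g x i j - (1 : Matrix (Fin d) (Fin d) ℝ) i j| ≤ c) ∧
    ∀ i j x, ‖fderiv ℝ (fun y => g y i j) x‖ ≤ c := by
  have hsup : ∀ {f : E d → ℝ}, supNorm f ≤ ENNReal.ofReal c → ∀ x, |f x| ≤ c := by
    intro f hf x
    have := (le_iSup (fun x => ‖f x‖ₑ) x).trans hf
    rwa [Real.enorm_eq_ofReal_abs, ENNReal.ofReal_le_ofReal_iff hc.le] at this
  unfold SmallMetric at h
  have h1 := le_self_add.trans (le_self_add.trans h)
  have h2 := (le_add_self.trans (le_self_add.trans h))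
  have h3 : ∀ i j, lipNorm (fun x => g x i j - (1 : Matrix (Fin d) (Fin d) ℝ) i j) ≤
      ENNReal.ofReal c := fun i j => (le_iSup₂ (f := fun i j => lipNorm (fun x => g x i j -
        (1 : Matrix (Fin d) (Fin d) ℝ) i j)) i j).trans h2
  refine ⟨fun i j k l => hsup ?_, fun i j => hsup (le_self_add.trans (h3 i j)), fun i j x => ?_⟩
  · refine le_trans ?_ h1
    exact le_iSup_of_le i (le_iSup_of_le j (le_iSup_of_le k
      (le_iSup (fun l => supNorm (riemann g i j k l)) l)))
  · set f : E d → ℝ := fun x => g x i j - (1 : Matrix (Fin d) (Fin d) ℝ) i j with hf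
    have h4 : LipschitzWith c.toNNReal f := by
      intro y z
      rcases eq_or_ne y z with rfl | hne
      · simp
      have h5 := (le_iSup₂ (f := fun y z => edist (f y) (f z) / edist y z) y z).trans
        (le_add_self.trans (h3 i j))
      rwa [ENNReal.div_le_iff (by simpa using hne) (edist_ne_top _ _)] at h5
    have h6 := norm_fderiv_le_of_lipschitz ℝ h4 (x₀ := x)
    rw [hf, fderiv_sub_const, Real.coe_toNNReal c hc.le] at h6
    exact h6

/-- The smallness threshold. -/
noncomputable def small (d : ℕ) : ℝ := (2 * (1 + ∑ i, ∑ j, ‖tens2 (d := d) i j‖))⁻¹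

theorem small_aux (d : ℕ) : 0 < small d ∧ small d ≤ 1 ∧
    small d * ∑ i, ∑ j, ‖tens2 (d := d) i j‖ ≤ 1 / 2 := by
  have h : 0 ≤ ∑ i, ∑ j, ‖tens2 (d := d) i j‖ :=
    Finset.sum_nonneg fun _ _ => Finset.sum_nonneg fun _ _ => norm_nonneg _
  refine ⟨by unfold small; positivity, ?_, ?_⟩
  · exact inv_le_one_of_one_le₀ (by linarith)
  · rw [small, inv_mul_le_iff₀ (by positivity)]; linarith

theorem IsSmoothMetric.low_invOp (hg : IsSmoothMetric g) (x ξ : E d) :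
    matOp (g x) (invOp g x ξ) = ξ := by
  rw [invOp_eq, matOp_comp, Matrix.mul_nonsing_inv _ (hg.isUnit_det x), matOp_one]; rfl

/-! ### Pointwise bounds for a metric close to the Euclidean one. -/

section Small

variable {c : ℝ}

/-- The operator of `g` is within `1 / 2` of the identity. Applied to `u = g⁻¹ ξ` this says `‖ξ - u‖
≤ ‖u‖ / 2`, and everything follows from `⟨u, ξ⟩ = ‖u‖ ^ 2 + ⟨u, ξ - u⟩`. -/
theorem IsSmoothMetric.quad_bounds (hg : IsSmoothMetric g) (hc : 0 < c) (hcs : c ≤ small d)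
    (h : SmallMetric g c) (x ξ : E d) :
    ‖invOp g x ξ‖ ≤ 2 * ‖ξ‖ ∧ ‖ξ‖ ^ 2 / 8 ≤ quad g (x, ξ) ∧ quad g (x, ξ) ≤ 2 * ‖ξ‖ ^ 2 := by
  obtain ⟨-, h1, -⟩ := h.bounds hc
  have h2 : ‖matOp (g x) - ContinuousLinearMap.id ℝ (E d)‖ ≤ 1 / 2 := by
    rw [← matOp_one]
    refine (norm_matOp_sub_le (h1 · · x)).trans (le_trans ?_ (small_aux d).2.2)
    gcongr
  set u := invOp g x ξ with hu
  have h3 : ‖ξ - u‖ ≤ 1 / 2 * ‖u‖ := by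
    have := (matOp (g x) - ContinuousLinearMap.id ℝ (E d)).le_of_opNorm_le h2 u
    simpa [hu, hg.low_invOp] using this
  have h4 : quad g (x, ξ) = ‖u‖ ^ 2 + inner ℝ u (ξ - u) := by
    rw [inner_sub_right, real_inner_self_eq_norm_sq]; simp [quad, hu]
  have h5 := abs_le.1 (abs_real_inner_le_norm u (ξ - u))
  have h6 : quad g (x, ξ) ≤ ‖u‖ * ‖ξ‖ := real_inner_le_norm _ _
  have h7 : ‖ξ‖ ≤ 3 / 2 * ‖u‖ := by
    have := norm_add_le u (ξ - u)
    rw [add_sub_cancel] at this; linarith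
  have h0 := norm_nonneg u
  have h0' := norm_nonneg ξ
  have h8 : ‖u‖ * ‖ξ - u‖ ≤ ‖u‖ * (1 / 2 * ‖u‖) := by gcongr
  have h9 : 1 / 2 * ‖u‖ ^ 2 ≤ quad g (x, ξ) := by nlinarith
  have h10 : ‖u‖ ≤ 2 * ‖ξ‖ := by
    rcases h0.eq_or_lt with h | h
    · rw [← h]; positivity
    · have : ‖u‖ * ‖u‖ ≤ ‖u‖ * (2 * ‖ξ‖) := by nlinarith
      exact le_of_mul_le_mul_left this h
  exact ⟨h10, by nlinarith, by nlinarith⟩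

theorem IsSmoothMetric.quad_pos (hg : IsSmoothMetric g) (hc : 0 < c) (hcs : c ≤ small d)
    (h : SmallMetric g c) {w : E d × E d} (hw : w.2 ≠ 0) : 0 < quad g w := by
  have := (hg.quad_bounds hc hcs h w.1 w.2).2.1
  have h2 := norm_pos_iff.2 hw
  exact lt_of_lt_of_le (by positivity) this

theorem IsSmoothMetric.abs_inv_le (hg : IsSmoothMetric g) (hc : 0 < c) (hcs : c ≤ small d)
    (h : SmallMetric g c) (i j : Fin d) (x : E d) : |metricInv g i j x| ≤ 2 := by
  have h1 : metricInv g i j x = invOp g x (EuclideanSpace.single j 1) i := by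
    rw [invOp_eq, matOp_apply]
    simp [metricInv]
  rw [h1, ← Real.norm_eq_abs]
  refine (PiLp.norm_apply_le _ i).trans ((hg.quad_bounds hc hcs h x _).1.trans ?_)
  simp

theorem IsSmoothMetric.abs_metric_le (hc : 0 < c) (hcs : c ≤ small d)
    (h : SmallMetric g c) (i j : Fin d) (x : E d) : |g x i j| ≤ 2 := by
  have h1 := (h.bounds hc).2.1 i j x
  have h2 : |(1 : Matrix (Fin d) (Fin d) ℝ) i j| ≤ 1 := by
    rw [Matrix.one_apply]; split_ifs <;> simp
  have h3 := abs_add_le (g x i j - (1 : Matrix (Fin d) (Fin d) ℝ) i j)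
    ((1 : Matrix (Fin d) (Fin d) ℝ) i j)
  rw [sub_add_cancel] at h3
  linarith [(small_aux d).2.1]

theorem IsSmoothMetric.norm_fderiv_inv_le (hg : IsSmoothMetric g) (hc : 0 < c)
    (hcs : c ≤ small d) (h : SmallMetric g c) (i j : Fin d) (x : E d) :
    ‖fderiv ℝ (metricInv g i j) x‖ ≤ 4 * d ^ 2 * c := by
  rw [hg.fderiv_inv, norm_neg]
  have : ∀ a b, ‖(metricInv g i a x * metricInv g b j x) • fderiv ℝ (fun y => g y a b) x‖ ≤
      2 * 2 * c := fun a b => by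
    rw [norm_smul, norm_mul]
    gcongr
    · exact hg.abs_inv_le hc hcs h i a x
    · exact hg.abs_inv_le hc hcs h b j x
    · exact (h.bounds hc).2.2 a b x
  refine (norm_sum_le_of_le _ fun a _ => norm_sum_le_of_le _ fun b _ => this a b).trans ?_
  simp only [Finset.sum_const, Finset.card_univ, Fintype.card_fin, nsmul_eq_mul]
  exact le_of_eq (by ring)

theorem IsSmoothMetric.abs_partialDeriv_metric_le (hc : 0 < c) (h : SmallMetric g c)
    (k i j : Fin d) (x : E d) : |partialDeriv k (fun y => g y i j) x| ≤ c := by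
  have := (fderiv ℝ (fun y => g y i j) x).le_of_opNorm_le ((h.bounds hc).2.2 i j x)
    (EuclideanSpace.single k (1 : ℝ))
  simpa [partialDeriv] using this

theorem IsSmoothMetric.abs_christoffel_le (hg : IsSmoothMetric g) (hc : 0 < c)
    (hcs : c ≤ small d) (h : SmallMetric g c) (n i j : Fin d) (x : E d) :
    |christoffel g n i j x| ≤ 3 * d * c := by
  rw [christoffel, abs_mul]
  have h1 : |∑ m, metricInv g n m x * (partialDeriv i (fun z => g z j m) x +
      partialDeriv j (fun z => g z i m) x - partialDeriv m (fun z => g z i j) x)| ≤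
      ∑ _m : Fin d, 2 * (3 * c) := by
    refine (Finset.abs_sum_le_sum_abs _ _).trans (Finset.sum_le_sum fun m _ => ?_)
    rw [abs_mul]
    have e1 := abs_partialDeriv_metric_le hc h i j m x
    have e2 := abs_partialDeriv_metric_le hc h j i m x
    have e3 := abs_partialDeriv_metric_le hc h m i j x
    refine mul_le_mul (hg.abs_inv_le hc hcs h n m x) ?_ (abs_nonneg _) zero_le_two
    rw [abs_le] at *
    constructor <;> linarith [e1.1, e1.2, e2.1, e2.2, e3.1, e3.2]
  simp only [Finset.sum_const, Finset.card_univ, Fintype.card_fin, nsmul_eq_mul] at h1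
  rw [abs_of_pos (by norm_num : (0 : ℝ) < 1 / 2)]
  linarith

/-- The curvature identity replaces the derivatives of Christoffel symbols by curvature, which is
`O(c)`, and by products of two Christoffel symbols, which are `O(c ^ 2)` and hence `O(c)` as `c ≤
1`. -/
theorem IsSmoothMetric.abs_curv_coeff_le (hg : IsSmoothMetric g) (hc : 0 < c)
    (hcs : c ≤ small d) (h : SmallMetric g c) (n k l a : Fin d) (x : E d) :
    |partialDeriv l (christoffel g n a k) x - partialDeriv a (christoffel g n l k) x| ≤
      (2 * d + 18 * d ^ 3) * c := by
  rw [hg.partialDeriv_christoffel_sub]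
  have hΓ := fun n i j => hg.abs_christoffel_le hc hcs h n i j x
  have hK : (0 : ℝ) ≤ 3 * d * c := by positivity
  have h1 : |∑ i, metricInv g n i x * riemann g i k l a x| ≤ ∑ _i : Fin d, 2 * c := by
    refine (Finset.abs_sum_le_sum_abs _ _).trans (Finset.sum_le_sum fun i _ => ?_)
    rw [abs_mul]
    exact mul_le_mul (hg.abs_inv_le hc hcs h n i x) ((h.bounds hc).1 i k l a x) (abs_nonneg _)
      zero_le_two
  have h2 : |∑ m, (christoffel g n l m x * christoffel g m a k x
      - christoffel g n a m x * christoffel g m l k x)| ≤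
      ∑ _m : Fin d, 2 * ((3 * d * c) * (3 * d * c)) := by
    refine (Finset.abs_sum_le_sum_abs _ _).trans (Finset.sum_le_sum fun m _ => ?_)
    refine (abs_sub _ _).trans ?_
    rw [abs_mul, abs_mul, two_mul]
    exact add_le_add (mul_le_mul (hΓ _ _ _) (hΓ _ _ _) (abs_nonneg _) hK)
      (mul_le_mul (hΓ _ _ _) (hΓ _ _ _) (abs_nonneg _) hK)
  simp only [Finset.sum_const, Finset.card_univ, Fintype.card_fin, nsmul_eq_mul] at h1 h2
  refine (abs_sub _ _).trans ((add_le_add h1 h2).trans ?_)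
  have hc1 : c ≤ 1 := hcs.trans (small_aux d).2.1
  have hd : (0 : ℝ) ≤ d := Nat.cast_nonneg d
  have : (d : ℝ) ^ 3 * c * c ≤ d ^ 3 * c * 1 := by gcongr
  nlinarith

theorem norm_sum_smul_le {J G : Type*} [Fintype J] [NormedAddCommGroup G] [NormedSpace ℝ G]
    {f : J → ℝ} {b : ℝ} (hf : ∀ j, |f j| ≤ b) (T : J → G) :
    ‖∑ j, f j • T j‖ ≤ b * ∑ j, ‖T j‖ := by
  rw [Finset.mul_sum]
  refine norm_sum_le_of_le _ fun j _ => ?_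
  rw [norm_smul]
  exact mul_le_mul_of_nonneg_right (hf j) (norm_nonneg _)

theorem norm_sum_smul_bilin_le {J X : Type*} [Fintype J] [NormedAddCommGroup X] [NormedSpace ℝ X]
    {f : J → ℝ} {b : ℝ} (hf : ∀ j, |f j| ≤ b) (T : J → X →L[ℝ] X →L[ℝ] X) :
    ‖∑ j, f j • T j‖ ≤ b * ∑ j, ‖T j‖ := norm_sum_smul_le hf T

theorem norm_sum_smul_trilin_le {J X : Type*} [Fintype J] [NormedAddCommGroup X]
    [NormedSpace ℝ X] {f : J → ℝ} {b : ℝ} (hf : ∀ j, |f j| ≤ b)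
    (T : J → X →L[ℝ] X →L[ℝ] X →L[ℝ] X) :
    ‖∑ j, f j • T j‖ ≤ b * ∑ j, ‖T j‖ := norm_sum_smul_le hf T

theorem conn_eq_sum (x : E d) : conn g x = ∑ q : Fin d × Fin d × Fin d,
    christoffel g q.2.1 q.1 q.2.2 x • tens3 q.1 q.2.1 q.2.2 := by
  simp only [conn, Fintype.sum_prod_type]

theorem curvOp_eq_sum (x : E d) : curvOp g x = ∑ q : Fin d × Fin d × Fin d × Fin d,
    (partialDeriv q.1 (christoffel g q.2.2.1 q.2.1 q.2.2.2) x -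
      partialDeriv q.2.1 (christoffel g q.2.2.1 q.1 q.2.2.2) x) •
      tens4 q.1 q.2.1 q.2.2.1 q.2.2.2 := by
  simp only [curvOp, Fintype.sum_prod_type]

/-- Constants depending only on the dimension. -/
theorem exists_operator_bounds (d : ℕ) : ∃ K : ℝ, 0 ≤ K ∧
    ∀ (g : E d → Matrix (Fin d) (Fin d) ℝ) (c : ℝ), IsSmoothMetric g → 0 < c → c ≤ small d →
      SmallMetric g c → ∀ x, ‖conn g x‖ ≤ K * c ∧ ‖curvOp g x‖ ≤ K * c ∧
        ‖fderiv ℝ (invOp g) x‖ ≤ K * c := by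
  obtain ⟨N3, h3, hN3⟩ : ∃ N : ℝ, 0 ≤ N ∧
      ∑ q : Fin d × Fin d × Fin d, ‖tens3 q.1 q.2.1 q.2.2‖ = N :=
    ⟨_, Finset.sum_nonneg fun _ _ => norm_nonneg _, rfl⟩
  obtain ⟨N4, h4, hN4⟩ : ∃ N : ℝ, 0 ≤ N ∧
      ∑ q : Fin d × Fin d × Fin d × Fin d, ‖tens4 q.1 q.2.1 q.2.2.1 q.2.2.2‖ = N :=
    ⟨_, Finset.sum_nonneg fun _ _ => norm_nonneg _, rfl⟩
  obtain ⟨N2, h2, hN2⟩ : ∃ N : ℝ, 0 ≤ N ∧ ∑ i, ∑ j, ‖tens2 (d := d) i j‖ = N :=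
    ⟨_, Finset.sum_nonneg fun _ _ => Finset.sum_nonneg fun _ _ => norm_nonneg _, rfl⟩
  refine ⟨3 * d * N3 + (2 * d + 18 * d ^ 3) * N4 + 4 * d ^ 2 * N2, by positivity,
    fun g c hg hc hcs h x => ?_⟩
  have e3 : 0 ≤ 3 * d * N3 * c := by positivity
  have e4 : 0 ≤ (2 * d + 18 * d ^ 3) * N4 * c := by positivity
  have e2 : 0 ≤ 4 * d ^ 2 * N2 * c := by positivity
  refine ⟨?_, ?_, ?_⟩
  · rw [conn_eq_sum]
    have e := norm_sum_smul_bilin_le (X := E d)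
      (fun q : Fin d × Fin d × Fin d => hg.abs_christoffel_le hc hcs h q.2.1 q.1 q.2.2 x)
      (fun q => tens3 q.1 q.2.1 q.2.2)
    rw [hN3] at e
    exact e.trans (by linarith)
  · rw [curvOp_eq_sum]
    have e := norm_sum_smul_trilin_le (X := E d)
      (fun q : Fin d × Fin d × Fin d × Fin d =>
        hg.abs_curv_coeff_le hc hcs h q.2.2.1 q.2.2.2 q.1 q.2.1 x)
      (fun q => tens4 q.1 q.2.1 q.2.2.1 q.2.2.2)
    rw [hN4] at e
    exact e.trans (by linarith)
  · have : ‖fderiv ℝ (invOp g) x‖ ≤ 4 * d ^ 2 * N2 * c := by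
      refine ContinuousLinearMap.opNorm_le_bound _ (by positivity) fun y => ?_
      rw [hg.fderiv_invOp, ← hN2]
      simp only [Finset.mul_sum, Finset.sum_mul]
      refine norm_sum_le_of_le _ fun i _ => norm_sum_le_of_le _ fun j _ => ?_
      rw [norm_smul]
      have := (fderiv ℝ (metricInv g i j) x).le_of_opNorm_le
        (hg.norm_fderiv_inv_le hc hcs h i j x) y
      calc _ ≤ (4 * d ^ 2 * c * ‖y‖) * ‖tens2 i j‖ := by gcongr
        _ = _ := by ring
    linarith

end Small

end RoughWave

/-! ### Global existence, and flows close to the identity -/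

/-- Solutions on the intervals `(-(n + 1), n + 1)` agree where they overlap by uniqueness. The one
with `n = ⌈|t|⌉₊` is defined around `t`, so they glue. -/
theorem exists_global_solution {F : Type*} [NormedAddCommGroup F] [NormedSpace ℝ F]
    [CompleteSpace F] {V : F → F} {K L : ℝ≥0} (hV : LipschitzWith K V) (hL : ∀ x, ‖V x‖ ≤ L)
    (x₀ : F) : ∃ u : ℝ → F, u 0 = x₀ ∧ ∀ t, HasDerivAt u (V (u t)) t := by
  have h : ∀ n : ℕ, ∃ u : ℝ → F, u 0 = x₀ ∧
      ∀ t ∈ Ioo (-(n + 1 : ℝ)) (n + 1), HasDerivAt u (V (u t)) t := fun n => by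
    obtain ⟨u, hu0, hu⟩ := exists_solution_of_bounded_lipschitz (f := fun _ => V)
      (a := -(n + 1 : ℝ)) (b := n + 1) (t₀ := 0) ⟨by linarith [n.cast_nonneg (α := ℝ)],
        by linarith [n.cast_nonneg (α := ℝ)]⟩ (fun _ _ => hV) (fun _ => continuousOn_const)
      (fun _ _ => hL) x₀
    exact ⟨u, hu0, fun t ht => (hu t (Ioo_subset_Icc_self ht)).hasDerivAt
      (Icc_mem_nhds ht.1 ht.2)⟩
  choose u hu0 hu using h
  have hagree : ∀ m n : ℕ, m ≤ n → EqOn (u m) (u n) (Ioo (-(m + 1 : ℝ)) (m + 1)) := by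
    intro m n hmn
    have hmn' : (m : ℝ) ≤ n := by exact_mod_cast hmn
    refine ODE_solution_unique_of_mem_Ioo (v := fun _ => V) (s := fun _ => univ) (t₀ := 0)
      (fun _ _ => hV.lipschitzOnWith) ⟨by linarith [m.cast_nonneg (α := ℝ)],
        by linarith [m.cast_nonneg (α := ℝ)]⟩ (fun t ht => ⟨hu m t ht, trivial⟩)
      (fun t ht => ⟨hu n t ⟨by linarith [ht.1], by linarith [ht.2]⟩, trivial⟩) ?_
    rw [hu0, hu0]
  refine ⟨fun t => u ⌈|t|⌉₊ t, by simp [hu0], fun t => ?_⟩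
  set n := ⌈|t|⌉₊ with hn
  have htn : |t| ≤ n := Nat.le_ceil _
  have ht : t ∈ Ioo (-(n + 1 : ℝ)) (n + 1) := by
    have := abs_le.1 htn
    constructor <;> linarith [this.1, this.2]
  have heq : (fun s => u ⌈|s|⌉₊ s) =ᶠ[𝓝 t] u (n + 1) := by
    have h1 : ∀ᶠ s : ℝ in 𝓝 t, |s| < (n : ℝ) + 1 :=
      continuous_abs.continuousAt.eventually_lt_const (by linarith)
    filter_upwards [h1] with s hs
    have hs2 : ⌈|s|⌉₊ ≤ n + 1 := Nat.ceil_le.2 (by push_cast; exact hs.le)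
    refine hagree _ _ hs2 ?_
    have := abs_le.1 (Nat.le_ceil |s|)
    constructor <;> linarith [this.1, this.2]
  have h2 : HasDerivAt (u (n + 1)) (V (u (n + 1) t)) t := by
    refine hu (n + 1) t ?_
    push_cast
    constructor <;> linarith [ht.1, ht.2]
  have h3 : u (n + 1) t = u n t := (hagree n (n + 1) (Nat.le_succ n) ht).symm
  rw [h3] at h2
  exact h2.congr_of_eventuallyEq heq

namespace PhaseFlow

variable {E : Type u} [NormedAddCommGroup E] [NormedSpace ℝ E]
  {v : E × E → E} {Q : E → E →L[ℝ] E →L[ℝ] E} {R : E → E →L[ℝ] E →L[ℝ] E →L[ℝ] E}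
  {Ω U : Set (E × E)} {W : ℝ → E × E → E × E}

theorem norm_apply₂_le (A : E →L[ℝ] E →L[ℝ] E) {a b c : ℝ} {x y : E} (hA : ‖A‖ ≤ a)
    (hx : ‖x‖ ≤ b) (hy : ‖y‖ ≤ c) : ‖A x y‖ ≤ a * b * c := by
  have ha := A.opNorm_nonneg.trans hA
  have hb := (norm_nonneg _).trans hx
  exact (A.le_opNorm₂ x y).trans (by gcongr)

theorem norm_apply₃_le (A : E →L[ℝ] E →L[ℝ] E →L[ℝ] E) {a b c e : ℝ} {x y z : E}
    (hA : ‖A‖ ≤ a) (hx : ‖x‖ ≤ b) (hy : ‖y‖ ≤ c) (hz : ‖z‖ ≤ e) :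
    ‖A x y z‖ ≤ a * b * c * e :=
  norm_apply₂_le (A x) (A.le_of_opNorm_le_of_le hA hx) hy hz

/-- If the coefficients other than `∂_ξ v` are `O(c)`, then the position map differs from the
identity by `O(c)`. -/
theorem exists_norm_posJac_sub_one_le (K : ℝ) (hK : 0 ≤ K) : ∃ K' : ℝ, 0 ≤ K' ∧
    ∀ {E : Type u} [NormedAddCommGroup E] [NormedSpace ℝ E]
    {v : E × E → E} {Q : E → E →L[ℝ] E →L[ℝ] E} {R : E → E →L[ℝ] E →L[ℝ] E →L[ℝ] E}
    {Ω U : Set (E × E)} {W : ℝ → E × E → E × E} {c : ℝ}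
    (_ : ContDiff ℝ ∞ Q)
    (_ : ∀ x J y z, R x J y z = fderiv ℝ Q x J y z - fderiv ℝ Q x y J z)
    (_ : IsOpen Ω) (_ : ContDiffOn ℝ ∞ v Ω) (_ : IsOpen U)
    (_ : ContDiffOn ℝ ∞ (fun z : ℝ × (E × E) => W z.1 z.2) (univ ×ˢ U))
    (_ : ∀ p ∈ U, ∀ t, HasDerivAt (W · p) (field v Q (W t p)) t)
    (_ : ∀ p ∈ U, ∀ t, W t p ∈ Ω) (_ : ∀ p ∈ U, W 0 p = p)
    (_ : 0 ≤ c) (_ : c ≤ 1) (_ : ∀ x, ‖Q x‖ ≤ K * c) (_ : ∀ x, ‖R x‖ ≤ K * c)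
    (_ : ∀ w ∈ Ω, ‖w.2‖ ≤ K) (_ : ∀ w ∈ Ω, ‖v w‖ ≤ K)
    (_ : ∀ w ∈ Ω, ‖fderiv ℝ v w‖ ≤ K) (_ : ∀ w ∈ Ω, ∀ h, ‖fderiv ℝ v w (h, 0)‖ ≤ K * c * ‖h‖),
    ∀ p ∈ U, ∀ t, |t| ≤ 1 → ‖posJac (fderiv ℝ (W t) p) - 1‖ ≤ K' * c := by
  set A := K * (1 + K * K) + (K * K * K + K * (K * K * K) + K * K * (1 + K * K)) with hA
  set B := K + K * (K * K) + (K * K * K + K * (K * K * K) + K * K * (K * K)) with hB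
  have hA0 : 0 ≤ A := by positivity
  have hB0 : 0 ≤ B := by positivity
  refine ⟨(K * K + B) * Real.exp (A + 1), by positivity, ?_⟩
  intro E _ _ v Q R Ω U W c hQ hR hΩ hv hU hWs hW hWΩ hW0 hc0 hc1 hQb hRb hξb hvb hdv hdv0 p hp t ht
  have hQK : ∀ x, ‖Q x‖ ≤ K := fun x => (hQb x).trans (mul_le_of_le_one_right hK hc1)
  have hRK : ∀ x, ‖R x‖ ≤ K := fun x => (hRb x).trans (mul_le_of_le_one_right hK hc1)
  have happ : ∀ w (h : E × E), coeff v Q R w h = (fderiv ℝ v w (h + (0, Q w.1 h.1 w.2)),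
      R w.1 h.1 (v w) w.2 - Q w.1 h.1 (Q w.1 (v w) w.2) +
        Q w.1 (v w) (h.2 + Q w.1 h.1 w.2)) := fun w h => by
    simp [coeff, shift_apply, preCoeff_apply, add_assoc]
  have hcoeff : ∀ w ∈ Ω, ∀ h : E × E, ‖coeff v Q R w h‖ ≤ A * ‖h‖ := by
    intro w hw h
    have n1 : ‖h.1‖ ≤ ‖h‖ := norm_fst_le h
    have n2 : ‖h.2‖ ≤ ‖h‖ := norm_snd_le h
    have e1 : ‖Q w.1 h.1 w.2‖ ≤ K * ‖h‖ * K := norm_apply₂_le _ (hQK _) n1 (hξb w hw)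
    have e2 : ‖h + ((0 : E), Q w.1 h.1 w.2)‖ ≤ ‖h‖ + K * ‖h‖ * K := by
      refine (norm_add_le _ _).trans (add_le_add le_rfl ?_)
      simpa [Prod.norm_def] using e1
    have e3 := (fderiv ℝ v w).le_of_opNorm_le_of_le (hdv w hw) e2
    have e4 := norm_apply₃_le _ (hRK w.1) n1 (hvb w hw) (hξb w hw)
    have e5 := norm_apply₂_le _ (hQK w.1) (hvb w hw) (hξb w hw)
    have e6 := norm_apply₂_le _ (hQK w.1) n1 e5
    have e7 := norm_apply₂_le _ (hQK w.1) (hvb w hw) ((norm_add_le _ _).trans (add_le_add n2 e1))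
    have e8 := (norm_add_le _ _).trans (add_le_add ((norm_sub_le _ _).trans (add_le_add e4 e6)) e7)
    rw [happ, Prod.norm_def]
    have hn := norm_nonneg h
    refine max_le (e3.trans ?_) (e8.trans ?_)
    · have : 0 ≤ (K * K * K + K * (K * K * K) + K * K * (1 + K * K)) * ‖h‖ := by positivity
      rw [hA]; nlinarith
    · have : 0 ≤ K * (1 + K * K) * ‖h‖ := by positivity
      rw [hA]; nlinarith
  have hcoeff0 : ∀ w ∈ Ω, ∀ h : E, ‖coeff v Q R w (h, 0)‖ ≤ B * c * ‖h‖ := by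
    intro w hw h
    have e1 : ‖Q w.1 h w.2‖ ≤ K * c * ‖h‖ * K := norm_apply₂_le _ (hQb _) le_rfl (hξb w hw)
    have e2 : ‖((0 : E), Q w.1 h w.2)‖ ≤ K * c * ‖h‖ * K := by simpa [Prod.norm_def] using e1
    have e3 : ‖fderiv ℝ v w ((h, 0) + (0, Q w.1 h w.2))‖ ≤
        K * c * ‖h‖ + K * (K * c * ‖h‖ * K) := by
      rw [map_add]
      exact (norm_add_le _ _).trans (add_le_add (hdv0 w hw h)
        ((fderiv ℝ v w).le_of_opNorm_le_of_le (hdv w hw) e2))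
    have e4 := norm_apply₃_le _ (hRb w.1) (le_refl ‖h‖) (hvb w hw) (hξb w hw)
    have e5 := norm_apply₂_le _ (hQK w.1) (hvb w hw) (hξb w hw)
    have e6 := norm_apply₂_le _ (hQb w.1) (le_refl ‖h‖) e5
    have e7 : ‖Q w.1 (v w) (0 + Q w.1 h w.2)‖ ≤ K * K * (K * c * ‖h‖ * K) := by
      rw [zero_add]; exact norm_apply₂_le _ (hQK w.1) (hvb w hw) e1
    have e8 := (norm_add_le _ _).trans (add_le_add ((norm_sub_le _ _).trans (add_le_add e4 e6)) e7)
    rw [happ, Prod.norm_def]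
    have hn := norm_nonneg h
    refine max_le (e3.trans ?_) (e8.trans ?_)
    · have : 0 ≤ (K * K * K + K * (K * K * K) + K * K * (K * K)) * c * ‖h‖ := by positivity
      rw [hB]; nlinarith
    · have : 0 ≤ (K + K * (K * K)) * c * ‖h‖ := by positivity
      rw [hB]; nlinarith
  refine ContinuousLinearMap.opNorm_le_bound _ (by positivity) fun h => ?_
  -- The deviation from `(h, 0)` solves the linear equation with source `coeff (h, 0) = O(c)` and
  -- initial value `-(0, Q(h, ξ)) = O(c)`. Its first component is the deviation of `∂_y x` from the
  -- identity, since the covariant correction affects only the second one.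
  have hder : ∀ s, HasDerivAt (fun s => covar Q W s p (h, 0) - (h, 0))
      (coeff v Q R (W s p) (covar Q W s p (h, 0))) s := fun s =>
    (((hasDerivAt_covar hQ hR hΩ hv hU hWs hW hWΩ hp s).clm_apply
      (hasDerivAt_const s ((h, 0) : E × E))).sub_const _).congr_deriv (by simp)
  have hgr := norm_le_of_deriv_le_abs (ε := B * c * ‖h‖) hA0 (by positivity) (fun s _ => hder s)
    (fun s _ => by
      have h1 : covar Q W s p (h, 0) = (covar Q W s p (h, 0) - (h, 0)) + (h, 0) := by abel
      conv_lhs => rw [h1, map_add]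
      exact (norm_add_le _ _).trans (add_le_add (hcoeff _ (hWΩ p hp s) _)
        (hcoeff0 _ (hWΩ p hp s) h))) t ht
  have hd0 : fderiv ℝ (W 0) p = ContinuousLinearMap.id ℝ _ := by
    have : W 0 =ᶠ[𝓝 p] id := by
      filter_upwards [hU.mem_nhds hp] with q hq using hW0 q hq
    rw [this.fderiv_eq, fderiv_id]
  have h0 : ‖covar Q W 0 p (h, 0) - (h, 0)‖ ≤ K * K * c * ‖h‖ := by
    rw [covar_apply, hd0, hW0 p hp]
    have hp2 : p ∈ Ω := by have := hWΩ p hp 0; rwa [hW0 p hp] at this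
    have e1 : ‖Q p.1 h p.2‖ ≤ K * c * ‖h‖ * K := norm_apply₂_le _ (hQb _) le_rfl (hξb p hp2)
    simp only [ContinuousLinearMap.id_apply, Prod.mk_sub_mk, sub_self, zero_sub, sub_zero,
      Prod.norm_def, norm_zero, norm_neg]
    refine max_le (by positivity) (e1.trans (le_of_eq (by ring)))
  have hfst : (posJac (fderiv ℝ (W t) p) - 1) h = (covar Q W t p (h, 0) - (h, 0)).1 := by
    rw [covar_apply]; simp [posJac]
  rw [hfst]
  refine (norm_fst_le _).trans (hgr.trans ?_)
  calc _ ≤ (K * K * c * ‖h‖ + B * c * ‖h‖) * Real.exp (A + 1) := by gcongr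
    _ = _ := by ring

end PhaseFlow

/-! ### The Hamiltonian vector field -/

namespace RoughWave

open PhaseFlow

variable {d : ℕ} {g : E d → Matrix (Fin d) (Fin d) ℝ}

/-- The set `1 / r < |ξ| < r` in phase space. -/
def annulus (d : ℕ) (r : ℝ) : Set (E d × E d) := {w | 1 / r < ‖w.2‖ ∧ ‖w.2‖ < r}

theorem isOpen_annulus (d : ℕ) (r : ℝ) : IsOpen (annulus d r) :=
  (isOpen_lt continuous_const continuous_snd.norm).inter
    (isOpen_lt continuous_snd.norm continuous_const)

theorem snd_ne_zero_of_mem_annulus {r : ℝ} (hr : 0 ≤ r) {w : E d × E d} (hw : w ∈ annulus d r) :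
    w.2 ≠ 0 := norm_pos_iff.1 ((by positivity : (0 : ℝ) ≤ 1 / r).trans_lt hw.1)

theorem IsSmoothMetric.contDiff_quad (hg : IsSmoothMetric g) : ContDiff ℝ ∞ (quad g) :=
  ((hg.contDiff_invOp.comp contDiff_fst).clm_apply contDiff_snd).inner ℝ contDiff_snd

theorem IsSmoothMetric.hasFDerivAt_invOp_apply (hg : IsSmoothMetric g) (w : E d × E d) :
    HasFDerivAt (fun w : E d × E d => invOp g w.1 w.2)
      (((fderiv ℝ (invOp g) w.1).flip w.2).comp (ContinuousLinearMap.fst ℝ (E d) (E d)) +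
        (invOp g w.1).comp (ContinuousLinearMap.snd ℝ (E d) (E d))) w := by
  have h1 : HasFDerivAt (fun w : E d × E d => invOp g w.1)
      ((fderiv ℝ (invOp g) w.1).comp (ContinuousLinearMap.fst ℝ (E d) (E d))) w :=
    ((hg.contDiff_invOp.differentiable (by simp) w.1).hasFDerivAt).comp w hasFDerivAt_fst
  refine (h1.clm_apply hasFDerivAt_snd).congr_fderiv ?_
  ext h <;> simp

theorem IsSmoothMetric.fderiv_quad (hg : IsSmoothMetric g) (w h : E d × E d) :
    fderiv ℝ (quad g) w h = inner ℝ (fderiv ℝ (invOp g) w.1 h.1 w.2) w.2 +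
      2 * inner ℝ (invOp g w.1 w.2) h.2 := by
  have h1 := (hg.hasFDerivAt_invOp_apply w).inner ℝ (hasFDerivAt_snd (𝕜 := ℝ) (p := w))
  have h2 : HasFDerivAt (quad g) _ w := h1
  rw [h2.fderiv]
  have := hg.inner_invOp_comm w.1 h.2 w.2
  simp only [ContinuousLinearMap.comp_apply, fderivInnerCLM_apply, ContinuousLinearMap.prod_apply,
    add_apply, ContinuousLinearMap.flip_apply, ContinuousLinearMap.coe_fst',
    ContinuousLinearMap.coe_snd', inner_add_left, this]
  rw [real_inner_comm (invOp g w.1 w.2) h.2]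
  ring

theorem hasDerivAt_inv_sqrt {s : ℝ} (hs : 0 < s) :
    HasDerivAt (fun r => (√r)⁻¹) (-(1 / 2) * (√s)⁻¹ ^ 3) s := by
  have h1 := (Real.hasDerivAt_sqrt hs.ne').fun_inv (Real.sqrt_pos.2 hs).ne'
  refine h1.congr_deriv ?_
  have := (Real.sqrt_pos.2 hs).ne'
  field_simp

theorem IsSmoothMetric.hasFDerivAt_vel (hg : IsSmoothMetric g) {w : E d × E d}
    (hw : 0 < quad g w) (h : E d × E d) : fderiv ℝ (vel g) w h =
      (√(quad g w))⁻¹ • (fderiv ℝ (invOp g) w.1 h.1 w.2 + invOp g w.1 h.2) +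
      (-(1 / 2) * (√(quad g w))⁻¹ ^ 3 * fderiv ℝ (quad g) w h) • invOp g w.1 w.2 := by
  have h1 := (hasDerivAt_inv_sqrt hw).comp_hasFDerivAt w
    (hg.contDiff_quad.differentiable (by simp) w).hasFDerivAt
  have h2 : HasFDerivAt (vel g) _ w := h1.smul (hg.hasFDerivAt_invOp_apply w)
  rw [h2.fderiv]
  simp

theorem contDiffOn_inv_sqrt : ContDiffOn ℝ ∞ (fun s : ℝ => (√s)⁻¹) (Ioi 0) := fun _ hs =>
  ((Real.contDiffAt_sqrt (ne_of_gt hs)).inv (Real.sqrt_pos.2 hs).ne').contDiffWithinAt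

/-- Infinitesimal conservation of energy: by `inner_conn` the position and momentum contributions
cancel. -/
theorem IsSmoothMetric.fderiv_quad_field (hg : IsSmoothMetric g) (w : E d × E d) :
    fderiv ℝ (quad g) w (field (vel g) (conn g) w) = 0 := by
  have h := hg.inner_conn w.1 w.2 (invOp g w.1 w.2)
  rw [hg.fderiv_quad, real_inner_comm]
  simp only [field, vel, map_smul, smul_apply, inner_smul_right]
  rw [real_inner_comm _ (invOp g w.1 w.2), h, real_inner_comm]
  ring

/-- The scalar factor `χ` is there for the cut-off field, which is parallel to the Hamiltonian
field. Its solutions keep the energy before it is known that they stay where the cutoff equals `1`.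
-/
theorem IsSmoothMetric.quad_eq_of_hasDerivAt (hg : IsSmoothMetric g) {w : ℝ → E d × E d}
    {χ : ℝ → ℝ} (hw : ∀ t, HasDerivAt w (χ t • field (vel g) (conn g) (w t)) t) (t : ℝ) :
    quad g (w t) = quad g (w 0) := by
  have h : ∀ t, HasDerivAt (fun t => quad g (w t)) 0 t := fun t =>
    ((hg.contDiff_quad.differentiable (by simp) (w t)).hasFDerivAt.comp_hasDerivAt t
      (hw t)).congr_deriv (by rw [map_smul, hg.fderiv_quad_field, smul_zero])
  exact is_const_of_deriv_eq_zero (fun t => (h t).differentiableAt) (fun t => (h t).deriv) t 0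

theorem IsSmoothMetric.hasFDerivAt_sqrt_quad (hg : IsSmoothMetric g) {w : E d × E d}
    (hw : 0 < quad g w) : HasFDerivAt (fun w => √(quad g w))
      ((1 / (2 * √(quad g w))) • fderiv ℝ (quad g) w) w :=
  (hg.contDiff_quad.differentiable (by simp) w).hasFDerivAt.sqrt hw.ne'

theorem IsSmoothMetric.gradient_mom (hg : IsSmoothMetric g) {x ξ : E d}
    (hw : 0 < quad g (x, ξ)) : ∇ (fun ζ => hamiltonian g x ζ) ξ = vel g (x, ξ) := by
  refine HasGradientAt.gradient ?_
  rw [hasGradientAt_iff_hasFDerivAt]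
  simp only [hamiltonian_eq]
  refine ((hg.hasFDerivAt_sqrt_quad hw).comp ξ (hasFDerivAt_prodMk_right x ξ)).congr_fderiv ?_
  ext1 h
  have := (Real.sqrt_pos.2 hw).ne'
  simp only [ContinuousLinearMap.comp_apply, smul_apply, hg.fderiv_quad,
    InnerProductSpace.toDual_apply_apply, vel, inner_smul_left, conj_trivial, smul_eq_mul,
    ContinuousLinearMap.inr_apply, map_zero, zero_apply, inner_zero_left]
  field_simp
  ring

theorem IsSmoothMetric.gradient_pos (hg : IsSmoothMetric g) {x ξ : E d}
    (hw : 0 < quad g (x, ξ)) :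
    -∇ (fun z => hamiltonian g z ξ) x = conn g x (vel g (x, ξ)) ξ := by
  rw [neg_eq_iff_eq_neg]
  refine HasGradientAt.gradient ?_
  rw [hasGradientAt_iff_hasFDerivAt]
  simp only [hamiltonian_eq]
  refine ((hg.hasFDerivAt_sqrt_quad hw).comp (f := fun z => (z, ξ)) x
    (hasFDerivAt_prodMk_left x ξ)).congr_fderiv ?_
  ext1 h
  have := (Real.sqrt_pos.2 hw).ne'
  simp only [ContinuousLinearMap.comp_apply, smul_apply, hg.fderiv_quad,
    InnerProductSpace.toDual_apply_apply, vel, inner_smul_left, conj_trivial, smul_eq_mul,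
    ContinuousLinearMap.inl_apply, map_smul, inner_neg_left, inner_zero_right, hg.inner_conn]
  field_simp
  ring

/-! ### Bounds for the velocity and confinement of trajectories. -/

section Small

variable {c : ℝ}

/-- Constants depending only on the dimension. -/
theorem exists_vel_bounds (d : ℕ) : ∃ K : ℝ, 0 ≤ K ∧
    ∀ (g : E d → Matrix (Fin d) (Fin d) ℝ) (c : ℝ), IsSmoothMetric g → 0 < c → c ≤ small d →
      SmallMetric g c → ∀ w ∈ annulus d 16, ‖vel g w‖ ≤ K ∧
        ∀ h : E d × E d, ‖fderiv ℝ (vel g) w h‖ ≤ K * (c * ‖h.1‖ + ‖h.2‖) := by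
  obtain ⟨K, hK, hKb⟩ := exists_operator_bounds d
  refine ⟨48 * (K * 16 + 2) + 1 / 2 * 48 ^ 3 * (K * 16 * 16 + 2 * 32) * 32 + 48 * 32,
    by positivity, fun g c hg hc hcs h w hw => ?_⟩
  obtain ⟨hw1, hw2⟩ := hw
  obtain ⟨hG, hq, -⟩ := hg.quad_bounds hc hcs h w.1 w.2
  -- On the annulus `quad ≥ (1 / 16) ^ 2 / 8 = 1 / 2048`, and `48 ^ 2 = 2304` is a convenient larger
  -- square.
  have hq' : (1 / 48 : ℝ) ^ 2 ≤ quad g w := by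
    have : (1 / 16 : ℝ) ^ 2 ≤ ‖w.2‖ ^ 2 := by gcongr
    refine le_trans ?_ hq
    linarith
  have hqp : 0 < quad g w := lt_of_lt_of_le (by norm_num) hq'
  have hs : (√(quad g w))⁻¹ ≤ 48 := by
    have h1 : (1 / 48 : ℝ) ≤ √(quad g w) := Real.le_sqrt_of_sq_le hq'
    have h2 := inv_anti₀ (by norm_num) h1
    linarith
  set s := (√(quad g w))⁻¹ with hs_def
  have hs0 : 0 ≤ s := by positivity
  have hG' : ‖invOp g w.1 w.2‖ ≤ 32 := hG.trans (by linarith)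
  have hv : ‖vel g w‖ ≤ 48 * 32 := by
    rw [vel, norm_smul, Real.norm_of_nonneg hs0]
    gcongr
  refine ⟨hv.trans ?_, fun k => ?_⟩
  · have : 0 ≤ 48 * (K * 16 + 2) + 1 / 2 * 48 ^ 3 * (K * 16 * 16 + 2 * 32) * 32 := by positivity
    linarith
  have e1 : ‖fderiv ℝ (invOp g) w.1 k.1 w.2‖ ≤ K * c * ‖k.1‖ * 16 := by
    refine ((fderiv ℝ (invOp g) w.1).le_opNorm₂ _ _).trans ?_
    have := (hKb g c hg hc hcs h w.1).2.2
    gcongr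
  have e2 : ‖invOp g w.1 k.2‖ ≤ 2 * ‖k.2‖ := (hg.quad_bounds hc hcs h w.1 k.2).1
  have e3 : ‖fderiv ℝ (quad g) w k‖ ≤ K * c * ‖k.1‖ * 16 * 16 + 2 * (32 * ‖k.2‖) := by
    rw [hg.fderiv_quad]
    refine (norm_add_le _ _).trans (add_le_add ((norm_inner_le_norm _ _).trans ?_) ?_)
    · gcongr
    · rw [norm_mul, Real.norm_ofNat]
      gcongr
      exact (norm_inner_le_norm _ _).trans (by gcongr)
  rw [hg.hasFDerivAt_vel hqp]
  have e4 : ‖s • (fderiv ℝ (invOp g) w.1 k.1 w.2 + invOp g w.1 k.2)‖ ≤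
      48 * (K * c * ‖k.1‖ * 16 + 2 * ‖k.2‖) := by
    rw [norm_smul, Real.norm_of_nonneg hs0]
    gcongr
    exact (norm_add_le _ _).trans (add_le_add e1 e2)
  have e5 : ‖(-(1 / 2) * s ^ 3 * fderiv ℝ (quad g) w k) • invOp g w.1 w.2‖ ≤
      1 / 2 * 48 ^ 3 * (K * c * ‖k.1‖ * 16 * 16 + 2 * (32 * ‖k.2‖)) * 32 := by
    rw [norm_smul, norm_mul, norm_mul, norm_neg, norm_pow, Real.norm_of_nonneg hs0,
      Real.norm_of_nonneg (by norm_num : (0 : ℝ) ≤ 1 / 2)]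
    gcongr
  refine (norm_add_le _ _).trans ((add_le_add e4 e5).trans ?_)
  have n1 : 0 ≤ c * ‖k.1‖ := by positivity
  have n2 := norm_nonneg k.2
  have n3 : 0 ≤ K * ‖k.2‖ := by positivity
  nlinarith

/-- The energy lies between `‖ξ‖ ^ 2 / 8` and `2 * ‖ξ‖ ^ 2`, a ratio of `16`, so at equal energy
`‖ξ‖` changes by at most a factor `4`. -/
theorem IsSmoothMetric.mem_annulus_of_quad_eq (hg : IsSmoothMetric g) (hc : 0 < c)
    (hcs : c ≤ small d) (h : SmallMetric g c) {w p : E d × E d} (hp : p ∈ annulus d 2)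
    (hq : quad g w = quad g p) : w ∈ annulus d 8 := by
  obtain ⟨-, h1, h2⟩ := hg.quad_bounds hc hcs h p.1 p.2
  obtain ⟨-, h3, h4⟩ := hg.quad_bounds hc hcs h w.1 w.2
  simp only [Prod.mk.eta] at h1 h2 h3 h4
  obtain ⟨hp1, hp2⟩ := hp
  have n1 := norm_nonneg w.2
  constructor
  · by_contra! hh
    nlinarith
  · by_contra! hh
    nlinarith

theorem annulus_mono {r s : ℝ} (hr : 0 < r) (hrs : r ≤ s) : annulus d r ⊆ annulus d s :=
  fun _ hw => ⟨(one_div_le_one_div_of_le hr hrs).trans_lt hw.1, hw.2.trans_le hrs⟩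

end Small

end RoughWave

/-! ### Words of partial derivatives -/

namespace RoughWave

variable {d : ℕ}

/-- The word of a multi-index. -/
def indexWord (β : Fin d → ℕ) : List (Fin d) :=
  (List.finRange d).flatMap fun i => List.replicate (β i) i

theorem length_indexWord (β : Fin d → ℕ) : (indexWord β).length = order β := by
  simp [indexWord, List.length_flatMap, order, Fin.sum_univ_def]

theorem count_indexWord (β : Fin d → ℕ) (i : Fin d) : (indexWord β).count i = β i := by
  rw [indexWord, List.count_flatMap, ← Fin.sum_univ_def]
  simp [List.count_replicate]

theorem foldr_flatMap_replicate {A S : Type*} (T : A → S → S) (β : A → ℕ) (L : List A) (s : S) :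
    (L.flatMap fun i => List.replicate (β i) i).foldr T s =
      L.foldr (fun i h => (T i)^[β i] h) s := by
  have h1 : ∀ (n : ℕ) (i : A) (s : S), (List.replicate n i).foldr T s = (T i)^[n] s := by
    intro n i s
    induction n with
    | zero => rfl
    | succ n ih => rw [List.replicate_succ, List.foldr_cons, ih, Function.iterate_succ_apply']
  induction L with
  | nil => rfl
  | cons i L ih => rw [List.flatMap_cons, List.foldr_append, ih, h1, List.foldr_cons]

theorem multiDeriv_eq_foldr {F : Type*} [NormedAddCommGroup F] [NormedSpace ℝ F]
    (β : Fin d → ℕ) (f : E d → F) : multiDeriv β f = (indexWord β).foldr partialDeriv f :=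
  (foldr_flatMap_replicate _ _ _ _).symm

theorem partialDeriv_comm {f : E d → ℝ} (hf : ContDiff ℝ ∞ f) (i j : Fin d) :
    partialDeriv i (partialDeriv j f) = partialDeriv j (partialDeriv i f) := by
  have h : ∀ (i j : Fin d) x, partialDeriv i (partialDeriv j f) x =
      fderiv ℝ (fderiv ℝ f) x (EuclideanSpace.single i 1) (EuclideanSpace.single j 1) := by
    intro i j x
    have h1 := ((hf.fderiv_right (m := ∞) (by norm_cast)).differentiable (by simp) x).hasFDerivAt
    have h2 := h1.clm_apply (hasFDerivAt_const (EuclideanSpace.single j (1 : ℝ)) x)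
    change fderiv ℝ (fun y => fderiv ℝ f y (EuclideanSpace.single j (1 : ℝ))) x _ = _
    rw [h2.fderiv]
    simp
  funext x
  rw [h, h]
  exact (hf.contDiffAt.isSymmSndFDerivAt (by simp; norm_cast)) _ _

theorem contDiff_foldr_partialDeriv {f : E d → ℝ} (hf : ContDiff ℝ ∞ f) (l : List (Fin d)) :
    ContDiff ℝ ∞ (l.foldr partialDeriv f) := by
  induction l with
  | nil => exact hf
  | cons i l ih => exact contDiff_partialDeriv ih i

theorem foldr_partialDeriv_perm {f : E d → ℝ} (hf : ContDiff ℝ ∞ f) {l l' : List (Fin d)}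
    (h : l.Perm l') : l.foldr partialDeriv f = l'.foldr partialDeriv f := by
  induction h with
  | nil => rfl
  | cons i _ ih => rw [List.foldr_cons, ih, List.foldr_cons]
  | swap i j l => exact partialDeriv_comm (contDiff_foldr_partialDeriv hf l) _ _
  | trans _ _ ih1 ih2 => rw [ih1, ih2]

/-- Partial derivatives of a smooth function commute, so a word matters only through its letter
counts. -/
theorem foldr_partialDeriv_eq_multiDeriv {f : E d → ℝ} (hf : ContDiff ℝ ∞ f)
    (l : List (Fin d)) : l.foldr partialDeriv f = multiDeriv (fun i => l.count i) f := by
  rw [multiDeriv_eq_foldr]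
  exact foldr_partialDeriv_perm hf (List.perm_iff_count.2 fun i => (count_indexWord (fun i => l.count i) i).symm)

theorem order_count (l : List (Fin d)) : order (fun i => l.count i) = l.length := by
  rw [← length_indexWord]
  exact (List.perm_iff_count.2 fun i => count_indexWord (fun i => l.count i) i).length_eq

/-- The derivative is the sum over `i` of `∂_i f` times the `i`-th coordinate form, of norm at most
`1`. Each order thus contributes a factor `d`. -/
theorem norm_iteratedFDeriv_le_of_words (k : ℕ) {f : E d → ℝ} (hf : ContDiff ℝ ∞ f) {S : ℝ}
    {x : E d} (hS : ∀ l : List (Fin d), l.length = k → |l.foldr partialDeriv f x| ≤ S) :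
    ‖iteratedFDeriv ℝ k f x‖ ≤ d ^ k * S := by
  induction k generalizing f with
  | zero => simpa using hS [] rfl
  | succ k ih =>
    have h1 : fderiv ℝ f = fun y => ∑ i : Fin d,
        (ContinuousLinearMap.toSpanSingleton ℝ (EuclideanSpace.proj i : E d →L[ℝ] ℝ) ∘
          partialDeriv i f) y := by
      funext y
      ext h
      rw [fderiv_apply_eq_sum]
      simp [sum_apply, mul_comm]
    have h2 : ∀ i : Fin d, ContDiff ℝ ∞
        (ContinuousLinearMap.toSpanSingleton ℝ (EuclideanSpace.proj i : E d →L[ℝ] ℝ) ∘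
          partialDeriv i f) := fun i =>
      (ContinuousLinearMap.contDiff _).comp (contDiff_partialDeriv hf i)
    rw [← norm_iteratedFDeriv_fderiv, h1, iteratedFDeriv_fun_sum_apply fun i _ =>
      ((h2 i).of_le (by norm_cast; simp)).contDiffAt]
    have h3 : ∀ i ∈ (Finset.univ : Finset (Fin d)), ‖iteratedFDeriv ℝ k
        (ContinuousLinearMap.toSpanSingleton ℝ (EuclideanSpace.proj i : E d →L[ℝ] ℝ) ∘
          partialDeriv i f) x‖ ≤ d ^ k * S := by
      intro i _
      have h4 := ih (contDiff_partialDeriv hf i) fun l hl => by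
        -- The derivative split off is the innermost one, so its letter goes to the end of the word.
        have := hS (l ++ [i]) (by simp [hl])
        simpa using this
      refine (ContinuousLinearMap.norm_iteratedFDeriv_comp_left _ (N := ∞)
        (contDiff_partialDeriv hf i).contDiffAt (by norm_cast; simp)).trans ?_
      refine (mul_le_of_le_one_left (norm_nonneg _) ?_).trans h4
      rw [ContinuousLinearMap.norm_toSpanSingleton]
      refine ContinuousLinearMap.opNorm_le_bound _ zero_le_one fun z => ?_
      simpa using PiLp.norm_apply_le z i
    refine (norm_sum_le_of_le _ h3).trans (le_of_eq ?_)
    simp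
    ring

/-- Bounds on the derivatives `∂^β f` give symbol bounds. -/
theorem symb_of_multiDeriv {ι : Type*} {M : ι → ℝ} {f : ι → E d → ℝ} {B : (Fin d → ℕ) → ℝ}
    {a : ℕ} (hM : ∀ i, 1 ≤ M i) (hf : ∀ i, ContDiff ℝ ∞ (f i)) {C₀ : ℝ}
    (h0 : ∀ i x, |f i x| ≤ C₀)
    (hB : ∀ β, 1 ≤ order β → ∀ i x, |multiDeriv β (f i) x| ≤ B β * M i ^ (order β - a)) (N : ℕ) :
    Symb N a M (fun _ => univ) f := by
  refine ⟨hM, fun _ => isOpen_univ, fun i => (hf i).contDiffOn, fun k _ => ?_⟩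
  rcases Nat.eq_zero_or_pos k with rfl | hk
  · exact ⟨C₀, fun i x _ => by simpa using h0 i x⟩
  -- Summing `|B|` over the finitely many words of length `k` gives a constant that does not depend
  -- on the index.
  refine ⟨d ^ k * ∑ w : Fin k → Fin d, |B fun i => (List.ofFn w).count i|, fun i x _ => ?_⟩
  rw [mul_assoc]
  refine norm_iteratedFDeriv_le_of_words k (hf i) fun l hl => ?_
  rw [foldr_partialDeriv_eq_multiDeriv (hf i)]
  refine (hB _ (by rw [order_count, hl]; exact hk) i x).trans ?_
  rw [order_count, hl]
  have h1 : l = List.ofFn fun j : Fin k => l.get (j.cast hl.symm) := by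
    subst hl; simp
  have h2 : B (fun i => l.count i) ≤ ∑ w : Fin k → Fin d, |B fun i => (List.ofFn w).count i| := by
    refine (le_abs_self _).trans ?_
    conv_lhs => rw [h1]
    exact Finset.single_le_sum (f := fun w : Fin k → Fin d =>
      |B fun i => (List.ofFn w).count i|) (fun _ _ => abs_nonneg _) (Finset.mem_univ _)
  have := hM i
  gcongr

end RoughWave

/-! ### Uniform bounds for the coefficients of the flow -/

namespace RoughWave

variable {d : ℕ} {B : (Fin d → ℕ) → ℝ}

/-- The family of all metrics satisfying the hypotheses for a given choice of constants. -/
structure BoundedMetric (d : ℕ) (B : (Fin d → ℕ) → ℝ) where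
  g : E d → Matrix (Fin d) (Fin d) ℝ
  M : ℝ
  c : ℝ
  one_le : 1 ≤ M
  pos : 0 < c
  le_small : c ≤ small d
  isSmooth : IsSmoothMetric g
  isSmall : SmallMetric g c
  bounds : DerivBounds g B M

namespace BoundedMetric

theorem symb_inv (N : ℕ) (i j : Fin d) :
    Symb N 1 (M : BoundedMetric d B → ℝ) (fun _ => univ) (fun m => metricInv m.g i j) :=
  symb_of_multiDeriv one_le (fun m => m.isSmooth.contDiff_inv i j)
    (fun m x => m.isSmooth.abs_inv_le m.pos m.le_small m.isSmall i j x)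
    (fun β hβ m x => m.bounds.metric β hβ i j x) N

theorem contDiff_riemann {g : E d → Matrix (Fin d) (Fin d) ℝ} (hg : IsSmoothMetric g)
    (i j k l : Fin d) : ContDiff ℝ ∞ (riemann g i j k l) :=
  ContDiff.sum fun n _ => (hg.smooth i n).mul
    (((contDiff_partialDeriv (hg.contDiff_christoffel _ _ _) _).sub
      (contDiff_partialDeriv (hg.contDiff_christoffel _ _ _) _)).add
      (ContDiff.sum fun _ _ => ((hg.contDiff_christoffel _ _ _).mul
        (hg.contDiff_christoffel _ _ _)).sub ((hg.contDiff_christoffel _ _ _).mul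
        (hg.contDiff_christoffel _ _ _))))

theorem symb_riemann (N : ℕ) (i j k l : Fin d) :
    Symb N 0 (M : BoundedMetric d B → ℝ) (fun _ => univ) (fun m => riemann m.g i j k l) :=
  symb_of_multiDeriv (C₀ := 1) one_le (fun m => contDiff_riemann m.isSmooth i j k l)
    (fun m x => ((m.isSmall.bounds m.pos).1 i j k l x).trans (m.le_small.trans (small_aux d).2.1))
    (fun β _ m x => by simpa using m.bounds.curvature β i j k l x) N

/-- The derivative hypotheses concern the inverse metric. The identity `Dg = -g (Dg⁻¹) g` expresses
one more derivative of `g` through `g` itself, so the bounds pass to `g` by induction on the order.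
-/
theorem symb_metric (N : ℕ) (i j : Fin d) :
    Symb N 1 (M : BoundedMetric d B → ℝ) (fun _ => univ) (fun m x => m.g x i j) := by
  induction N generalizing i j with
  | zero =>
    exact ⟨one_le, fun _ => isOpen_univ, fun m => (m.isSmooth.smooth i j).contDiffOn,
      fun k hk => ⟨2, fun m x _ => by
        obtain rfl : k = 0 := by omega
        simpa using IsSmoothMetric.abs_metric_le m.pos m.le_small m.isSmall i j x⟩⟩
  | succ N ih =>
    refine Symb.of_fderiv (C := 2) (fun m => (m.isSmooth.smooth i j).contDiffOn)
      (fun m x _ => IsSmoothMetric.abs_metric_le m.pos m.le_small m.isSmall i j x) ?_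
    have h : ∀ i j, Symb N 0 (M : BoundedMetric d B → ℝ) (fun _ => univ) (fun m x => m.g x i j) :=
      fun i j => (ih i j).mono_weight zero_le_one
    have e1 : ∀ a b, Symb N 0 (M : BoundedMetric d B → ℝ) (fun _ => univ)
        (fun m x => m.g x i a * m.g x b j) := fun a b => (h i a).mul zero_le_one (h b j)
    have e2 : ∀ a b, Symb N 0 (M : BoundedMetric d B → ℝ) (fun _ => univ)
        (fun m x => (m.g x i a * m.g x b j) • fderiv ℝ (metricInv m.g a b) x) := fun a b =>
      (e1 a b).smul zero_le_one (symb_inv (N + 1) a b).fderiv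
    have e3 : ∀ a, Symb N 0 (M : BoundedMetric d B → ℝ) (fun _ => univ)
        (fun m x => ∑ b, (m.g x i a * m.g x b j) • fderiv ℝ (metricInv m.g a b) x) := fun a =>
      Symb.sum one_le (fun _ => isOpen_univ) _ fun b _ => e2 a b
    have e4 : Symb N 0 (M : BoundedMetric d B → ℝ) (fun _ => univ)
        (fun m x => ∑ a, ∑ b, (m.g x i a * m.g x b j) • fderiv ℝ (metricInv m.g a b) x) :=
      Symb.sum one_le (fun _ => isOpen_univ) _ fun a _ => e3 a
    exact (e4.neg zero_le_one).congr fun m x _ => m.isSmooth.fderiv_metric i j x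

theorem symb_partialDeriv_metric (N : ℕ) (k i j : Fin d) :
    Symb N 0 (M : BoundedMetric d B → ℝ) (fun _ => univ)
      (fun m => partialDeriv k (fun x => m.g x i j)) :=
  (symb_metric (N + 1) i j).fderiv.clm_apply zero_le_one
    (Symb.const one_le (fun _ => isOpen_univ) _)

theorem symb_christoffel (N : ℕ) (n i j : Fin d) :
    Symb N 0 (M : BoundedMetric d B → ℝ) (fun _ => univ) (fun m => christoffel m.g n i j) :=
  (Symb.const one_le (fun _ => isOpen_univ) _).mul zero_le_one
    (Symb.sum one_le (fun _ => isOpen_univ) _ fun k _ =>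
      ((symb_inv N n k).mono_weight zero_le_one).mul zero_le_one
        (((symb_partialDeriv_metric N _ _ _).add (symb_partialDeriv_metric N _ _ _)).sub
          zero_le_one (symb_partialDeriv_metric N _ _ _)))

/-- The decisive gain: single derivatives of Christoffel symbols would cost an extra `M`, but this
combination is curvature plus products of Christoffel symbols, all of weight `0`. -/
theorem symb_curv_coeff (N : ℕ) (n k l a : Fin d) :
    Symb N 0 (M : BoundedMetric d B → ℝ) (fun _ => univ)
      (fun m x => partialDeriv l (christoffel m.g n a k) x -
        partialDeriv a (christoffel m.g n l k) x) := by
  have e1 : ∀ i, Symb N 0 (M : BoundedMetric d B → ℝ) (fun _ => univ)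
      (fun m x => metricInv m.g n i x * riemann m.g i k l a x) := fun i =>
    ((symb_inv N n i).mono_weight zero_le_one).mul zero_le_one (symb_riemann N i k l a)
  have e2 : ∀ a b c a' b' c', Symb N 0 (M : BoundedMetric d B → ℝ) (fun _ => univ)
      (fun m x => christoffel m.g a b c x * christoffel m.g a' b' c' x) :=
    fun a b c a' b' c' => (symb_christoffel N a b c).mul zero_le_one (symb_christoffel N a' b' c')
  have e3 : Symb N 0 (M : BoundedMetric d B → ℝ) (fun _ => univ)
      (fun m x => ∑ i, metricInv m.g n i x * riemann m.g i k l a x) :=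
    Symb.sum one_le (fun _ => isOpen_univ) _ fun i _ => e1 i
  have e4 : ∀ j, Symb N 0 (M : BoundedMetric d B → ℝ) (fun _ => univ)
      (fun m x => christoffel m.g n l j x * christoffel m.g j a k x
          - christoffel m.g n a j x * christoffel m.g j l k x) := fun j =>
    (e2 n l j j a k).sub zero_le_one (e2 n a j j l k)
  have e5 : Symb N 0 (M : BoundedMetric d B → ℝ) (fun _ => univ)
      (fun m x => ∑ j, (christoffel m.g n l j x * christoffel m.g j a k x
          - christoffel m.g n a j x * christoffel m.g j l k x)) :=
    Symb.sum one_le (fun _ => isOpen_univ) _ fun j _ => e4 j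
  exact (e3.sub zero_le_one e5).congr
    fun m x _ => m.isSmooth.partialDeriv_christoffel_sub n k l a x

theorem _root_.RoughWave.symb_sum_smul {ι J F X : Type*} [Fintype J] [NormedAddCommGroup F]
    [NormedSpace ℝ F] [NormedAddCommGroup X] [NormedSpace ℝ X] {N a : ℕ} {M : ι → ℝ}
    {Ω : ι → Set F} (ha : a ≤ 1) (hM : ∀ i, 1 ≤ M i) (hΩ : ∀ i, IsOpen (Ω i))
    {f : J → ι → F → ℝ} (hf : ∀ j, Symb N a M Ω (f j)) (T : J → X) :
    Symb N a M Ω (fun i w => ∑ j, f j i w • T j) :=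
  Symb.sum hM hΩ _ fun j _ => (hf j).smul ha (Symb.const hM hΩ (T j))

theorem symb_conn (N : ℕ) :
    Symb N 0 (M : BoundedMetric d B → ℝ) (fun _ => univ) (fun m => conn m.g) :=
  (symb_sum_smul zero_le_one one_le (fun _ => isOpen_univ)
    (fun q : Fin d × Fin d × Fin d => symb_christoffel N q.2.1 q.1 q.2.2)
    (fun q => tens3 q.1 q.2.1 q.2.2)).congr fun _ x _ => conn_eq_sum x

theorem symb_curvOp (N : ℕ) :
    Symb N 0 (M : BoundedMetric d B → ℝ) (fun _ => univ) (fun m => curvOp m.g) :=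
  (symb_sum_smul zero_le_one one_le (fun _ => isOpen_univ)
    (fun q : Fin d × Fin d × Fin d × Fin d => symb_curv_coeff N q.2.2.1 q.2.2.2 q.1 q.2.1)
    (fun q => tens4 q.1 q.2.1 q.2.2.1 q.2.2.2)).congr fun _ x _ => curvOp_eq_sum x

theorem symb_invOp (N : ℕ) :
    Symb N 1 (M : BoundedMetric d B → ℝ) (fun _ => univ) (fun m => invOp m.g) :=
  Symb.sum one_le (fun _ => isOpen_univ) _ fun i _ =>
    symb_sum_smul le_rfl one_le (fun _ => isOpen_univ) (fun j => symb_inv N i j) _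

variable (r : ℝ)

theorem symb_fderiv_fst (N : ℕ) : Symb N 0 (M : BoundedMetric d B → ℝ) (fun _ => annulus d r)
    (fun _ => fderiv ℝ (Prod.fst : E d × E d → E d)) := by
  have : (fun _ : BoundedMetric d B => fderiv ℝ (Prod.fst : E d × E d → E d)) =
      fun _ _ => ContinuousLinearMap.fst ℝ (E d) (E d) := by
    funext _ w; exact fderiv_fst
  rw [this]
  exact Symb.const one_le (fun _ => isOpen_annulus d r) _

theorem symb_conn_fst (N : ℕ) : Symb N 0 (M : BoundedMetric d B → ℝ) (fun _ => annulus d r)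
    (fun m w => conn m.g w.1) :=
  (symb_conn N).comp_symb (fun _ => contDiff_fst.contDiffOn) (fun _ _ _ => mem_univ _)
    (symb_fderiv_fst r N) (Nat.le_succ N)

theorem symb_curvOp_fst (N : ℕ) : Symb N 0 (M : BoundedMetric d B → ℝ) (fun _ => annulus d r)
    (fun m w => curvOp m.g w.1) :=
  (symb_curvOp N).comp_symb (fun _ => contDiff_fst.contDiffOn) (fun _ _ _ => mem_univ _)
    (symb_fderiv_fst r N) (Nat.le_succ N)

theorem symb_snd (N : ℕ) : Symb N 1 (M : BoundedMetric d B → ℝ) (fun _ => annulus d r)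
    (fun _ w => w.2) :=
  Symb.of_clm one_le (fun _ => isOpen_annulus d r) (ContinuousLinearMap.snd ℝ (E d) (E d))
    (C := r) fun _ _ hw => hw.2.le

theorem symb_invOp_apply (N : ℕ) : Symb (N + 1) 1 (M : BoundedMetric d B → ℝ)
    (fun _ => annulus d r) (fun m w => invOp m.g w.1 w.2) :=
  ((symb_invOp (N + 1)).comp_one (fun _ => contDiff_fst.contDiffOn) (fun _ _ _ => mem_univ _)
    (symb_fderiv_fst r N)).clm_apply le_rfl (symb_snd r (N + 1))

theorem symb_quad (N : ℕ) : Symb (N + 1) 1 (M : BoundedMetric d B → ℝ)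
    (fun _ => annulus d r) (fun m => quad m.g) :=
  Symb.bilin (innerSL ℝ) le_rfl (symb_invOp_apply r N) (symb_snd r (N + 1))

variable {r}

theorem symb_vel (hr : 0 < r) (N : ℕ) : Symb N 1 (M : BoundedMetric d B → ℝ)
    (fun _ => annulus d r) (fun m => vel m.g) := by
  have hI : Icc ((1 / r) ^ 2 / 8) (2 * r ^ 2) ⊆ Ioi (0 : ℝ) := fun s hs =>
    lt_of_lt_of_le (by positivity) hs.1
  have h1 : Symb (N + 1) 1 (M : BoundedMetric d B → ℝ) (fun _ => annulus d r)
      (fun m w => (√(quad m.g w))⁻¹) := by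
    -- On the annulus the energy stays in a compact interval of positive numbers, where `s ↦ (√s)⁻¹`
    -- has bounded derivatives of every order.
    refine Symb.fixed_comp_one (φ := fun s : ℝ => (√s)⁻¹)
      (Ω₀ := Ioo ((1 / r) ^ 2 / 8) (2 * r ^ 2)) isOpen_Ioo
      (contDiffOn_inv_sqrt.mono (Ioo_subset_Icc_self.trans hI)) (fun k => ?_) (symb_quad r N) ?_
    · obtain ⟨C, hC⟩ := exists_bound_iteratedFDeriv_of_isCompact isOpen_Ioi contDiffOn_inv_sqrt
        isCompact_Icc hI k
      exact ⟨C, fun z hz => hC z (Ioo_subset_Icc_self hz)⟩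
    · intro m w hw
      obtain ⟨-, h2, h3⟩ := m.isSmooth.quad_bounds m.pos m.le_small m.isSmall w.1 w.2
      have h4 : (1 / r) ^ 2 < ‖w.2‖ ^ 2 := by have := hw.1; gcongr
      have h5 : ‖w.2‖ ^ 2 < r ^ 2 := by have := hw.2; gcongr
      simp only [Prod.mk.eta] at h2 h3
      constructor <;> linarith
  exact (h1.smul le_rfl (symb_invOp_apply r N)).mono (Nat.le_succ N)

end BoundedMetric

end RoughWave

/-! ### Existence, uniqueness and smoothness of the Hamiltonian flow -/

namespace RoughWave

open PhaseFlow

variable {d : ℕ} {B : (Fin d → ℕ) → ℝ}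

/-- The cutoff vanishes as soon as `‖ξ‖ ≥ 32` or `‖ξ‖ ≤ 1 / 32`, so points outside the annulus of
radius `64` have a whole neighbourhood where it is zero. This makes the cut-off field smooth also at
`ξ = 0`. -/
theorem exists_cutoff (d : ℕ) : ∃ χ : E d → ℝ, ContDiff ℝ ∞ χ ∧
    (∀ w ∈ annulus d 16, χ w.2 = 1) ∧ ∀ w ∉ annulus d 64, ∀ᶠ z in 𝓝 w, χ z.2 = 0 := by
  let b₁ : ContDiffBump (0 : E d) := ⟨16, 32, by norm_num, by norm_num⟩
  let b₀ : ContDiffBump (0 : E d) := ⟨1 / 32, 1 / 16, by norm_num, by norm_num⟩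
  refine ⟨fun ξ => b₁ ξ * (1 - b₀ ξ), b₁.contDiff.mul (contDiff_const.sub b₀.contDiff),
    fun w hw => ?_, fun w hw => ?_⟩
  · have h1 : b₁ w.2 = 1 := b₁.one_of_mem_closedBall (by
      rw [mem_closedBall_zero_iff]; exact hw.2.le)
    have h0 : b₀ w.2 = 0 := b₀.zero_of_le_dist (by
      rw [dist_zero_right]; exact hw.1.le)
    simp [h1, h0]
  · rw [annulus, mem_ofPred_eq, not_and_or, not_lt, not_lt] at hw
    rcases hw with hw | hw
    · have : ∀ᶠ z : E d × E d in 𝓝 w, ‖z.2‖ < 1 / 32 :=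
        continuous_snd.norm.continuousAt.eventually_lt_const
          (lt_of_le_of_lt hw (by norm_num))
      filter_upwards [this] with z hz
      have h0 : b₀ z.2 = 1 := b₀.one_of_mem_closedBall (by
        rw [mem_closedBall_zero_iff]; exact hz.le)
      simp [h0]
    · have : ∀ᶠ z : E d × E d in 𝓝 w, 32 < ‖z.2‖ :=
        continuous_snd.norm.continuousAt.eventually_const_lt
          (lt_of_lt_of_le (by norm_num) hw)
      filter_upwards [this] with z hz
      have h1 : b₁ z.2 = 0 := b₁.zero_of_le_dist (by rw [dist_zero_right]; exact hz.le)
      simp [h1]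

namespace BoundedMetric

/-- The Hamiltonian vector field. -/
noncomputable abbrev hamField (m : BoundedMetric d B) : E d × E d → E d × E d :=
  field (vel m.g) (conn m.g)

theorem symb_hamField {r : ℝ} (hr : 0 < r) (N : ℕ) : Symb N 0 (M : BoundedMetric d B → ℝ)
    (fun _ => annulus d r) hamField :=
  have hv := (symb_vel (B := B) hr N).mono_weight zero_le_one
  hv.prodMk zero_le_one (((symb_conn_fst r N).clm_apply zero_le_one hv).clm_apply zero_le_one
    ((symb_snd r N).mono_weight zero_le_one))

/-- The bounds are uniform in `x`, so cutting off in `ξ` alone yields a globally bounded Lipschitz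
field. Its Lipschitz constant may grow with `M`; it serves only existence and uniqueness. -/
theorem exists_cutoff_field (m : BoundedMetric d B) : ∃ (V : E d × E d → E d × E d)
    (χ : E d × E d → ℝ) (K L : ℝ≥0), ContDiff ℝ ∞ V ∧ LipschitzWith K V ∧ (∀ w, ‖V w‖ ≤ L) ∧
      (∀ w, V w = χ w • m.hamField w) ∧ ∀ w ∈ annulus d 16, V w = m.hamField w := by
  obtain ⟨χ, hχ, hχ1, hχ0⟩ := exists_cutoff d
  have hsymb : Symb 1 0 (fun _ : Unit => m.M) (fun _ => annulus d 64)
      (fun _ w => χ w.2 • m.hamField w) := by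
    have h1 : Symb 1 0 (fun _ : Unit => m.M) (fun _ => annulus d 64)
        (fun _ (w : E d × E d) => χ w.2) :=
      Symb.fixed_comp (Ω₀ := ball 0 64) isOpen_ball hχ.contDiffOn (fun k _ => by
        obtain ⟨C, hC⟩ := exists_bound_iteratedFDeriv_of_isCompact isOpen_univ hχ.contDiffOn
          (isCompact_closedBall (0 : E d) 64) (subset_univ _) k
        exact ⟨C, fun z hz => hC z (ball_subset_closedBall hz)⟩)
        (((symb_snd (B := B) 64 1).reindex fun _ : Unit => m).mono_weight zero_le_one)
        (fun _ w hw => by rw [mem_ball_zero_iff]; exact hw.2)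
    exact h1.smul zero_le_one ((symb_hamField (by norm_num) 1).reindex fun _ : Unit => m)
  set V : E d × E d → E d × E d := fun w => χ w.2 • m.hamField w with hV
  have hVs : ContDiff ℝ ∞ V := contDiff_iff_contDiffAt.2 fun w => by
    by_cases hw : w ∈ annulus d 64
    · exact hsymb.contDiffAt (i := ()) hw
    · have : V =ᶠ[𝓝 w] fun _ => 0 := by
        filter_upwards [hχ0 w hw] with z hz
        simp [hV, hz]
      exact contDiffAt_const.congr_of_eventuallyEq this
  obtain ⟨L, hL0, hL⟩ := hsymb.norm_le
  obtain ⟨C, hC0, hC⟩ := hsymb.bound_nonneg le_rfl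
  refine ⟨V, fun w => χ w.2, (C * m.M).toNNReal, L.toNNReal, hVs,
    lipschitzWith_of_nnnorm_fderiv_le (hVs.differentiable (by simp)) fun w => ?_, fun w => ?_,
    fun w => rfl, fun w hw => by simp [hV, hχ1 w hw]⟩
  · have hM := m.one_le
    rw [← NNReal.coe_le_coe, coe_nnnorm, Real.coe_toNNReal _ (by positivity)]
    by_cases hw : w ∈ annulus d 64
    · have := hC () w hw
      rwa [← norm_iteratedFDeriv_fderiv, norm_iteratedFDeriv_zero, Nat.sub_zero, pow_one] at this
    · have : V =ᶠ[𝓝 w] fun _ => 0 := by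
        filter_upwards [hχ0 w hw] with z hz
        simp [hV, hz]
      rw [this.fderiv_eq]
      simp only [fderiv_fun_const, Pi.zero_apply, norm_zero]
      positivity
  · rw [Real.coe_toNNReal _ hL0]
    by_cases hw : w ∈ annulus d 64
    · exact hL () w hw
    · have : V w = 0 := by simp [hV, (hχ0 w hw).self_of_nhds]
      rw [this, norm_zero]; exact hL0

theorem mem_annulus (m : BoundedMetric d B) {w : ℝ → E d × E d} {χ : ℝ → ℝ}
    (hw : ∀ t, HasDerivAt w (χ t • m.hamField (w t)) t) (h0 : w 0 ∈ annulus d 2) (t : ℝ) :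
    w t ∈ annulus d 16 :=
  annulus_mono (by norm_num) (by norm_num) (m.isSmooth.mem_annulus_of_quad_eq m.pos m.le_small
    m.isSmall h0 (m.isSmooth.quad_eq_of_hasDerivAt hw t))

theorem exists_curve (m : BoundedMetric d B) {p : E d × E d} (hp : p ∈ annulus d 2) :
    ∃ w : ℝ → E d × E d, w 0 = p ∧ (∀ t, HasDerivAt w (m.hamField (w t)) t) ∧
      ∀ t, w t ∈ annulus d 16 := by
  obtain ⟨V, χ, K, L, -, hK, hL, hχ, h16⟩ := m.exists_cutoff_field
  obtain ⟨w, hw0, hw⟩ := exists_global_solution hK hL p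
  have hm : ∀ t, w t ∈ annulus d 16 := m.mem_annulus (χ := fun t => χ (w t))
    (fun t => by rw [← hχ]; exact hw t) (by rwa [hw0])
  exact ⟨w, hw0, fun t => by rw [← h16 _ (hm t)]; exact hw t, hm⟩

theorem curve_unique (m : BoundedMetric d B) {w z : ℝ → E d × E d}
    (hw : ∀ t, HasDerivAt w (m.hamField (w t)) t) (hz : ∀ t, HasDerivAt z (m.hamField (z t)) t)
    (h0 : w 0 ∈ annulus d 2) (h : w 0 = z 0) : w = z := by
  obtain ⟨V, χ, K, L, -, hK, hL, hχ, h16⟩ := m.exists_cutoff_field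
  have hmem : ∀ {w : ℝ → E d × E d}, (∀ t, HasDerivAt w (m.hamField (w t)) t) →
      w 0 ∈ annulus d 2 → ∀ t, HasDerivAt w (V (w t)) t := fun hw h0 t => by
    rw [h16 _ (m.mem_annulus (χ := fun _ => 1) (fun t => by simpa using hw t) h0 t)]
    exact hw t
  exact ODE_solution_unique_univ (v := fun _ => V) (s := fun _ => univ) (K := K) (t₀ := 0)
    (fun _ => hK.lipschitzOnWith) (fun t => ⟨hmem hw h0 t, trivial⟩)
    (fun t => ⟨hmem hz (h ▸ h0) t, trivial⟩) h

/-- The velocity is homogeneous of degree `0` in `ξ` and the force of degree `1`, so scaling the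
momentum maps solutions to solutions. -/
theorem hamField_smul (m : BoundedMetric d B) {l : ℝ} (hl : 0 < l) (w : E d × E d) :
    m.hamField (w.1, l • w.2) = ((m.hamField w).1, l • (m.hamField w).2) := by
  have h1 : quad m.g (w.1, l • w.2) = l ^ 2 * quad m.g w := by
    simp only [quad, map_smul, inner_smul_left, inner_smul_right, conj_trivial]; ring
  have h2 : vel m.g (w.1, l • w.2) = vel m.g w := by
    rw [vel, vel, h1, Real.sqrt_mul (by positivity), Real.sqrt_sq hl.le]
    simp only [map_smul, smul_smul, mul_inv]
    congr 1
    field_simp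
  simp only [hamField, field, h2, map_smul]

theorem hasDerivAt_smul (m : BoundedMetric d B) {l : ℝ} (hl : 0 < l) {w : ℝ → E d × E d} {t : ℝ}
    (hw : HasDerivAt w (m.hamField (w t)) t) :
    HasDerivAt (fun t => ((w t).1, l • (w t).2)) (m.hamField ((w t).1, l • (w t).2)) t := by
  rw [hamField_smul m hl]
  have h1 : HasDerivAt (fun t => (w t).1) (m.hamField (w t)).1 t := hw.fst
  have h2 : HasDerivAt (fun t => (w t).2) (m.hamField (w t)).2 t := hw.snd
  exact h1.prodMk (h2.const_smul l)

theorem quad_pos (m : BoundedMetric d B) {w : E d × E d} (hw : w.2 ≠ 0) : 0 < quad m.g w :=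
  m.isSmooth.quad_pos m.pos m.le_small m.isSmall hw

theorem unit_mem_annulus (y : E d) {η : E d} (hη : η ≠ 0) : (y, ‖η‖⁻¹ • η) ∈ annulus d 2 := by
  have h : ‖‖η‖⁻¹ • η‖ = 1 := norm_smul_inv_norm (𝕜 := ℝ) hη
  constructor <;> simp only [h] <;> norm_num

/-- Solutions are built for unit covectors, which lie in the annulus, and then rescaled by `‖η‖`. -/
theorem exists_isHamiltonianFlow (m : BoundedMetric d B) :
    ∃ X Ξ, IsHamiltonianFlow m.g X Ξ := by
  have h : ∀ y η : E d, ∃ w : ℝ → E d × E d, η ≠ 0 → w 0 = (y, η) ∧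
      (∀ t, HasDerivAt w (m.hamField (w t)) t) ∧ ∀ t, (w t).2 ≠ 0 := by
    intro y η
    by_cases hη : η = 0
    · exact ⟨0, fun h => absurd hη h⟩
    obtain ⟨w, hw0, hw, hm⟩ := m.exists_curve (unit_mem_annulus y hη)
    have hl := norm_pos_iff.2 hη
    refine ⟨fun t => ((w t).1, ‖η‖ • (w t).2), fun _ => ⟨?_, fun t => m.hasDerivAt_smul hl (hw t),
      fun t => smul_ne_zero hl.ne' (snd_ne_zero_of_mem_annulus (by norm_num) (hm t))⟩⟩
    simp [hw0, smul_smul, hl.ne']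
  choose w hw using h
  refine ⟨fun t y η => (w y η t).1, fun t y η => (w y η t).2, fun y η hη => by rw [(hw y η hη).1],
    fun y η hη => by rw [(hw y η hη).1], fun t y η hη => (hw y η hη).2.2 t,
    fun t y η hη => ?_, fun t y η hη => ?_⟩
  · rw [m.isSmooth.gradient_mom (m.quad_pos ((hw y η hη).2.2 t))]
    exact ((hw y η hη).2.1 t).fst
  · rw [m.isSmooth.gradient_pos (m.quad_pos ((hw y η hη).2.2 t))]
    exact ((hw y η hη).2.1 t).snd

variable {X Ξ : ℝ → E d → E d → E d}

theorem hasDerivAt_flow (m : BoundedMetric d B) (hF : IsHamiltonianFlow m.g X Ξ) (y : E d)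
    {η : E d} (hη : η ≠ 0) (t : ℝ) :
    HasDerivAt (fun t => (X t y η, Ξ t y η)) (m.hamField (X t y η, Ξ t y η)) t := by
  have hq := m.quad_pos (w := (X t y η, Ξ t y η)) (hF.mom_ne_zero t y η hη)
  have h1 := hF.deriv_pos t y η hη
  have h2 := hF.deriv_mom t y η hη
  rw [m.isSmooth.gradient_mom hq] at h1
  rw [m.isSmooth.gradient_pos hq] at h2
  exact h1.prodMk h2

/-- Uniqueness identifies the given solution at the unit covector with the rescaled solution at `η`.
-/
theorem flow_homogeneous (m : BoundedMetric d B) (hF : IsHamiltonianFlow m.g X Ξ) (t : ℝ) (y : E d)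
    {η : E d} (hη : η ≠ 0) : X t y η = X t y (‖η‖⁻¹ • η) ∧ Ξ t y η = ‖η‖ • Ξ t y (‖η‖⁻¹ • η) := by
  have hl := norm_pos_iff.2 hη
  have hu : ‖η‖⁻¹ • η ≠ 0 := smul_ne_zero (inv_ne_zero hl.ne') hη
  have h := m.curve_unique (m.hasDerivAt_flow hF y hu) (fun t => m.hasDerivAt_smul
    (inv_pos.2 hl) (m.hasDerivAt_flow hF y hη t))
    (by rw [hF.init_pos y _ hu, hF.init_mom y _ hu]; exact unit_mem_annulus y hη)
    (by simp only [hF.init_pos y _ hu, hF.init_mom y _ hu, hF.init_pos y _ hη,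
      hF.init_mom y _ hη])
  have h2 := congrFun h t
  simp only [Prod.mk.injEq] at h2
  refine ⟨h2.1.symm, ?_⟩
  rw [h2.2, smul_smul, mul_inv_cancel₀ hl.ne', one_smul]

theorem flow_mem_annulus (m : BoundedMetric d B) (hF : IsHamiltonianFlow m.g X Ξ)
    {p : E d × E d} (hp : p ∈ annulus d 2) (t : ℝ) : (X t p.1 p.2, Ξ t p.1 p.2) ∈ annulus d 16 := by
  have hη := snd_ne_zero_of_mem_annulus zero_le_two hp
  exact m.mem_annulus (w := fun t => (X t p.1 p.2, Ξ t p.1 p.2)) (χ := fun _ => 1)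
    (fun t => by simpa using m.hasDerivAt_flow hF p.1 hη t)
    (by rwa [hF.init_pos _ _ hη, hF.init_mom _ _ hη]) t

/-- `IsHamiltonianFlow` includes no regularity in the initial data. Trajectories from the annulus
also solve the equation of the cut-off field, which is smooth everywhere, and this gives it. -/
theorem contDiffOn_flow (m : BoundedMetric d B) (hF : IsHamiltonianFlow m.g X Ξ) :
    ContDiffOn ℝ ∞ (fun z : ℝ × (E d × E d) => (X z.1 z.2.1 z.2.2, Ξ z.1 z.2.1 z.2.2))
      (univ ×ˢ annulus d 2) := by
  obtain ⟨V, χ, K, L, hV, -, -, -, h16⟩ := m.exists_cutoff_field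
  refine _root_.contDiffOn_flow (isOpen_annulus d 2) hV
    (W := fun t p => (X t p.1 p.2, Ξ t p.1 p.2)) (fun p hp t => ?_)
    (contDiffOn_id.congr fun p hp => ?_)
  · rw [h16 _ (m.flow_mem_annulus hF hp t)]
    exact m.hasDerivAt_flow hF p.1 (snd_ne_zero_of_mem_annulus zero_le_two hp) t
  · have hη := snd_ne_zero_of_mem_annulus zero_le_two hp
    rw [hF.init_pos _ _ hη, hF.init_mom _ _ hη]; rfl

end BoundedMetric

end RoughWave

/-! ### Mixed derivatives -/

namespace RoughWave

/-! ### Words of directional derivatives. -/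

section Directional

variable {X F : Type*} [NormedAddCommGroup X] [NormedSpace ℝ X] [NormedAddCommGroup F]
  [NormedSpace ℝ F] {U : Set X} {f : X → F}

/-- The derivative in a fixed direction. -/
noncomputable def dirDeriv (v : X) (f : X → F) : X → F := fun x => fderiv ℝ f x v

theorem contDiffOn_foldr_dirDeriv (hU : IsOpen U) (hf : ContDiffOn ℝ ∞ f U) (l : List X) :
    ContDiffOn ℝ ∞ (l.foldr dirDeriv f) U := by
  induction l with
  | nil => exact hf
  | cons v l ih =>
    exact ((contDiffOn_infty_iff_fderiv_of_isOpen hU).1 ih).2.clm_apply contDiffOn_const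

theorem exists_foldr_dirDeriv_eq (hU : IsOpen U) (hf : ContDiffOn ℝ ∞ f U) {l : List X}
    (hl : ∀ v ∈ l, ‖v‖ ≤ 1) : ∃ m : Fin l.length → X, (∀ i, ‖m i‖ ≤ 1) ∧
      ∀ x ∈ U, l.foldr dirDeriv f x = iteratedFDeriv ℝ l.length f x m := by
  induction l with
  | nil => exact ⟨fun i => i.elim0, fun i => i.elim0, fun x _ => by simp⟩
  | cons v l ih =>
    obtain ⟨m, hm, h⟩ := ih fun w hw => hl w (List.mem_cons_of_mem _ hw)
    refine ⟨Fin.cons v m, fun i => ?_, fun x hx => ?_⟩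
    · refine Fin.cases ?_ (fun i => ?_) i
      · simpa using hl v (by simp)
      · simpa using hm i
    · have h1 : l.foldr dirDeriv f =ᶠ[𝓝 x] fun y => iteratedFDeriv ℝ l.length f y m := by
        filter_upwards [hU.mem_nhds hx] with y hy using h y hy
      have h2 : DifferentiableAt ℝ (iteratedFDeriv ℝ l.length f) x :=
        (hf.contDiffAt (hU.mem_nhds hx)).differentiableAt_iteratedFDeriv
          (by exact_mod_cast ENat.natCast_lt_top _)
      rw [List.foldr_cons, dirDeriv, h1.fderiv_eq, fderiv_continuousMultilinear_apply_const_apply h2]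
      exact (iteratedFDeriv_succ_apply_left (m := (Fin.cons v m : Fin (l.length + 1) → X))).symm

theorem norm_foldr_dirDeriv_le (hU : IsOpen U) (hf : ContDiffOn ℝ ∞ f U) {l : List X}
    (hl : ∀ v ∈ l, ‖v‖ ≤ 1) {x : X} (hx : x ∈ U) :
    ‖l.foldr dirDeriv f x‖ ≤ ‖iteratedFDeriv ℝ l.length f x‖ := by
  obtain ⟨m, hm, h⟩ := exists_foldr_dirDeriv_eq hU hf hl
  rw [h x hx]
  refine (ContinuousMultilinearMap.le_opNorm _ _).trans (mul_le_of_le_one_right (norm_nonneg _) ?_)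
  exact Finset.prod_le_one (fun _ _ => norm_nonneg _) fun i _ => hm i

variable {d : ℕ}

/-- Partial derivatives along an affine slice `a` are directional derivatives of `f` in the fixed
directions `L e_i`. The slices used are `x' ↦ (x', η)` and `η' ↦ (x, η')`. -/
theorem foldr_partialDeriv_comp (hU : IsOpen U) (hf : ContDiffOn ℝ ∞ f U) {a : E d → X}
    {L : E d →L[ℝ] X} (ha : ∀ y, HasFDerivAt a L y) {h : E d → F} (hh : ∀ y, a y ∈ U → h y = f (a y))
    (l : List (Fin d)) (y : E d) (hy : a y ∈ U) : l.foldr partialDeriv h y =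
      (l.map fun i => L (EuclideanSpace.single i 1)).foldr dirDeriv f (a y) := by
  induction l generalizing y with
  | nil => exact hh y hy
  | cons i l ih =>
    have h1 : l.foldr partialDeriv h =ᶠ[𝓝 y]
        (l.map fun i => L (EuclideanSpace.single i 1)).foldr dirDeriv f ∘ a := by
      filter_upwards [(ha y).continuousAt.preimage_mem_nhds (hU.mem_nhds hy)] with z hz using ih z hz
    have h2 := ((contDiffOn_foldr_dirDeriv hU hf (l.map fun i =>
      L (EuclideanSpace.single i 1))).contDiffAt (hU.mem_nhds hy)).differentiableAt (by simp)
    rw [List.foldr_cons, List.map_cons, List.foldr_cons, partialDeriv, h1.fderiv_eq,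
      (h2.hasFDerivAt.comp y (ha y)).fderiv, dirDeriv, ContinuousLinearMap.comp_apply]

end Directional

variable {d : ℕ} {u : E d → E d → E d}

/-- A mixed derivative is the iterated derivative on the product space evaluated at vectors `(e_i,
0)` and `(0, e_i)`, which have norm `1`. -/
theorem norm_mixedDeriv_le {U : Set (E d × E d)} (hU : IsOpen U)
    (hu : ContDiffOn ℝ ∞ (fun q : E d × E d => u q.1 q.2) U) (β α : Fin d → ℕ) {x η : E d}
    (hx : (x, η) ∈ U) : ‖mixedDeriv β α u x η‖ ≤
      ‖iteratedFDeriv ℝ (order α + order β) (fun q : E d × E d => u q.1 q.2) (x, η)‖ := by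
  set f := fun q : E d × E d => u q.1 q.2
  set la := (indexWord α).map fun i =>
    ContinuousLinearMap.inr ℝ (E d) (E d) (EuclideanSpace.single i 1)
  set lb := (indexWord β).map fun i =>
    ContinuousLinearMap.inl ℝ (E d) (E d) (EuclideanSpace.single i 1)
  have h1 : ∀ x η, (x, η) ∈ U → multiDeriv α (fun η' => u x η') η = la.foldr dirDeriv f (x, η) :=
    fun x η hx => by
      rw [multiDeriv_eq_foldr]
      exact foldr_partialDeriv_comp hU hu (a := fun η' => (x, η'))
        (fun y => hasFDerivAt_prodMk_right x y) (fun y _ => rfl) _ η hx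
  have h2 : mixedDeriv β α u x η = (lb ++ la).foldr dirDeriv f (x, η) := by
    rw [mixedDeriv, multiDeriv_eq_foldr, List.foldr_append]
    exact foldr_partialDeriv_comp hU (contDiffOn_foldr_dirDeriv hU hu la) (a := fun x' => (x', η))
      (fun y => hasFDerivAt_prodMk_left y η) (fun y hy => h1 y η hy) _ x hx
  have h3 : (lb ++ la).length = order α + order β := by
    simp [la, lb, length_indexWord, add_comm]
  rw [h2, ← h3]
  refine norm_foldr_dirDeriv_le hU hu (fun v hv => ?_) hx
  simp only [la, lb, List.mem_append, List.mem_map] at hv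
  rcases hv with ⟨i, -, rfl⟩ | ⟨i, -, rfl⟩ <;> simp [Prod.norm_def]

/-! ### Scaling, locality and homogeneity of partial derivatives. -/

section Linear

variable {F : Type*} [NormedAddCommGroup F] [NormedSpace ℝ F]

theorem partialDeriv_const_smul (a : ℝ) (i : Fin d) (f : E d → F) :
    partialDeriv i (fun x => a • f x) = fun x => a • partialDeriv i f x := by
  funext x
  rw [partialDeriv, show (fun x => a • f x) = a • f from rfl, fderiv_const_smul_field]
  rfl

theorem foldr_partialDeriv_const_smul (a : ℝ) (l : List (Fin d)) (f : E d → F) :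
    l.foldr partialDeriv (fun x => a • f x) = fun x => a • l.foldr partialDeriv f x := by
  induction l with
  | nil => rfl
  | cons i l ih => rw [List.foldr_cons, ih, partialDeriv_const_smul, List.foldr_cons]

theorem foldr_partialDeriv_congr {U : Set (E d)} (hU : IsOpen U) {f h : E d → F}
    (hfh : EqOn f h U) (l : List (Fin d)) :
    EqOn (l.foldr partialDeriv f) (l.foldr partialDeriv h) U := by
  induction l with
  | nil => exact hfh
  | cons i l ih =>
    intro x hx
    simp only [List.foldr_cons, partialDeriv]
    rw [(ih.eventuallyEq_of_mem (hU.mem_nhds hx)).fderiv_eq]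

theorem partialDeriv_const_add_smul (b : F) (a : ℝ) (i : Fin d) (f : E d → F) :
    partialDeriv i (fun x => b + a • f x) = fun x => a • partialDeriv i f x := by
  rw [← partialDeriv_const_smul]
  funext x
  rw [partialDeriv, partialDeriv, fderiv_const_add]

/-- Each derivative lowers the degree by one, by differentiating the homogeneity relation. Integer
exponents are needed since the degree may become negative. -/
theorem foldr_partialDeriv_homogeneous {f : E d → F} {l : ℝ} {k : ℤ} (hl : 0 < l)
    (hf : ∀ η, η ≠ 0 → f (l • η) = l ^ k • f η) (w : List (Fin d)) {η : E d} (hη : η ≠ 0) :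
    w.foldr partialDeriv f (l • η) = l ^ (k - w.length) • w.foldr partialDeriv f η := by
  induction w generalizing η with
  | nil => simpa using hf η hη
  | cons i w ih =>
    set h := w.foldr partialDeriv f
    have h1 : (fun y => h (l • y)) =ᶠ[𝓝 η] fun y => l ^ (k - w.length) • h y := by
      filter_upwards [isOpen_ne.mem_nhds hη] with y hy using ih hy
    have h2 := h1.fderiv_eq (𝕜 := ℝ)
    rw [fderiv_comp_smul, show (fun y => l ^ (k - (w.length : ℤ)) • h y) =
      l ^ (k - (w.length : ℤ)) • h from rfl, fderiv_const_smul_field] at h2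
    have h3 := congrArg (fun T : E d →L[ℝ] F => l⁻¹ • T (EuclideanSpace.single i (1 : ℝ))) h2
    simp only [smul_apply, Pi.smul_apply, smul_smul, inv_mul_cancel₀ hl.ne', one_smul] at h3
    rw [List.foldr_cons, partialDeriv, partialDeriv, h3, List.length_cons, Nat.cast_succ,
      ← sub_sub, zpow_sub_one₀ hl.ne', mul_comm]

end Linear

theorem mixedDeriv_homogeneous {k : ℤ}
    (hu : ∀ x η, η ≠ 0 → ∀ l : ℝ, 0 < l → u x (l • η) = l ^ k • u x η) (β α : Fin d → ℕ) (x : E d)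
    {η : E d} (hη : η ≠ 0) :
    mixedDeriv β α u x η = ‖η‖ ^ (k - order α) • mixedDeriv β α u x (‖η‖⁻¹ • η) := by
  have hn := norm_pos_iff.2 hη
  have hv : ‖η‖⁻¹ • η ≠ 0 := smul_ne_zero (inv_ne_zero hn.ne') hη
  have hs : ‖η‖ • ‖η‖⁻¹ • η = η := by rw [smul_smul, mul_inv_cancel₀ hn.ne', one_smul]
  rw [mixedDeriv, mixedDeriv, multiDeriv_eq_foldr β, multiDeriv_eq_foldr β]
  have h1 : (fun x' => multiDeriv α (fun η' => u x' η') η) =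
      fun x' => ‖η‖ ^ (k - order α) • multiDeriv α (fun η' => u x' η') (‖η‖⁻¹ • η) := by
    funext x'
    rw [multiDeriv_eq_foldr, ← length_indexWord α,
      ← foldr_partialDeriv_homogeneous hn (fun η' hη' => hu x' η' hη' _ hn) _ hv, hs]
  rw [h1, foldr_partialDeriv_const_smul]

theorem mixedDeriv_congr {u' : E d → E d → E d} (h : ∀ x η, η ≠ 0 → u x η = u' x η)
    (β α : Fin d → ℕ) (x : E d) {η : E d} (hη : η ≠ 0) :
    mixedDeriv β α u x η = mixedDeriv β α u' x η := by
  have h1 : (fun x' => multiDeriv α (fun η' => u x' η') η) =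
      fun x' => multiDeriv α (fun η' => u' x' η') η := by
    funext x'
    rw [multiDeriv_eq_foldr, multiDeriv_eq_foldr]
    exact foldr_partialDeriv_congr isOpen_ne (fun η' hη' => h x' η' hη') _ hη
  rw [mixedDeriv, mixedDeriv, h1]

/-- Mixed derivatives of a perturbation of the identity. -/
theorem mixedDeriv_id_add_smul {w : E d → E d → E d} {t : ℝ} {η : E d}
    (hw : Differentiable ℝ fun x => w x η) (β α : Fin d → ℕ) (h : 1 ≤ order α ∨ 2 ≤ order β)
    (x : E d) : mixedDeriv β α (fun x η => x + t • w x η) x η = t • mixedDeriv β α w x η := by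
  rw [mixedDeriv, mixedDeriv]
  rcases Nat.eq_zero_or_pos (order α) with h0 | h0
  · have hα : indexWord α = [] := List.length_eq_zero_iff.1 (by rw [length_indexWord, h0])
    simp only [multiDeriv_eq_foldr α, hα, List.foldr_nil]
    rw [multiDeriv_eq_foldr, multiDeriv_eq_foldr]
    have hl : 2 ≤ (indexWord β).length := by rw [length_indexWord]; omega
    have h1 : indexWord β ≠ [] := by intro h; simp [h] at hl
    -- With no `η`-derivative, two `x`-derivatives remove the identity: the innermost turns `x` into
    -- the constant `e_i`, the next one kills it.
    obtain ⟨l, i, hli⟩ : ∃ l i, indexWord β = l ++ [i] :=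
      ⟨_, _, (List.dropLast_append_getLast h1).symm⟩
    have h2 : l ≠ [] := by rintro rfl; simp [hli] at hl
    obtain ⟨l', j, hlj⟩ : ∃ l' j, l = l' ++ [j] := ⟨_, _, (List.dropLast_append_getLast h2).symm⟩
    have h3 : partialDeriv i (fun x => x + t • w x η) =
        fun x => EuclideanSpace.single i (1 : ℝ) + t • partialDeriv i (fun x => w x η) x := by
      funext x
      have := ((hasFDerivAt_id x).add ((hw x).hasFDerivAt.const_smul t)).fderiv
      rw [partialDeriv]
      erw [this]
      simp [partialDeriv]
    rw [hli, hlj]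
    simp only [List.foldr_append, List.foldr_cons, List.foldr_nil, h3]
    rw [partialDeriv_const_add_smul, foldr_partialDeriv_const_smul]
  · have h1 : indexWord α ≠ [] := by
      intro h; rw [← length_indexWord, h] at h0; simp at h0
    -- One `η`-derivative already removes `x`, which is constant in `η`.
    obtain ⟨l, i, hli⟩ : ∃ l i, indexWord α = l ++ [i] :=
      ⟨_, _, (List.dropLast_append_getLast h1).symm⟩
    simp only [multiDeriv_eq_foldr, hli, List.foldr_append, List.foldr_cons, List.foldr_nil,
      partialDeriv_const_add_smul, foldr_partialDeriv_const_smul]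

end RoughWave

/-! ### The family of Hamiltonian flows -/

namespace RoughWave

open PhaseFlow

variable {d : ℕ} {B : (Fin d → ℕ) → ℝ} {c₀ : ℝ}

/-- The family of all Hamiltonian flows for given constants. -/
structure BoundedFlow (d : ℕ) (B : (Fin d → ℕ) → ℝ) (c₀ : ℝ) extends BoundedMetric d B where
  X : ℝ → E d → E d → E d
  Ξ : ℝ → E d → E d → E d
  le : c ≤ c₀
  isFlow : IsHamiltonianFlow g X Ξ

namespace BoundedFlow

/-- The flow map in phase space. -/
def flow (s : BoundedFlow d B c₀) (t : ℝ) (p : E d × E d) : E d × E d :=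
  (s.X t p.1 p.2, s.Ξ t p.1 p.2)

/-- The inverse `x ↦ y(t, x, η)` of the position map. -/
noncomputable def inv (s : BoundedFlow d B c₀) (t : ℝ) (x η : E d) : E d :=
  Function.invFun (fun y => s.X t y (‖η‖⁻¹ • η)) x

/-- The inverse of `(y, η) ↦ (x, η)`. -/
noncomputable def invMap (s : BoundedFlow d B c₀) (t : ℝ) (z : E d × E d) : E d × E d :=
  (s.inv t z.1 z.2, z.2)

/-- Instantiates the abstract theory. The index is the whole family of admissible metrics with their
flows; data in the annulus of radius `2` stay in that of radius `16`. -/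
theorem isSymbFlow : IsSymbFlow (fun s : BoundedFlow d B c₀ => s.M) (fun _ => annulus d 16)
    (fun _ => annulus d 2) (fun s => vel s.g) (fun s => conn s.g) (fun s => curvOp s.g) flow where
  one_le s := s.one_le
  isOpen_dom _ := isOpen_annulus d 16
  isOpen_par _ := isOpen_annulus d 2
  sub _ := annulus_mono (by norm_num) (by norm_num)
  bounded := ⟨16, fun _ _ hw => hw.2.le⟩
  smooth_conn s := s.isSmooth.contDiff_conn
  curv s := s.isSmooth.curvOp_apply
  symb_vel N := (BoundedMetric.symb_vel (B := B) (by norm_num) N).reindex toBoundedMetric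
  symb_conn N := (BoundedMetric.symb_conn_fst (B := B) 16 N).reindex toBoundedMetric
  symb_curv N := (BoundedMetric.symb_curvOp_fst (B := B) 16 N).reindex toBoundedMetric
  init s p hp := by
    have hη := snd_ne_zero_of_mem_annulus zero_le_two hp
    rw [flow, s.isFlow.init_pos _ _ hη, s.isFlow.init_mom _ _ hη]
  smooth s := s.toBoundedMetric.contDiffOn_flow s.isFlow
  deriv s p hp := s.toBoundedMetric.hasDerivAt_flow s.isFlow p.1
    (snd_ne_zero_of_mem_annulus zero_le_two hp)
  mem s _ hp := s.toBoundedMetric.flow_mem_annulus s.isFlow hp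

/-- For small `c` the position maps are close to the identity. -/
theorem exists_threshold (d : ℕ) : ∃ c₀ K : ℝ, 0 < c₀ ∧ c₀ ≤ small d ∧ 0 ≤ K ∧ K * c₀ ≤ 1 / 2 ∧
    ∀ (B : (Fin d → ℕ) → ℝ) (s : BoundedFlow d B c₀), ∀ p ∈ annulus d 2, ∀ t, |t| ≤ 1 →
      ‖posJac (fderiv ℝ (s.flow t) p) - 1‖ ≤ K * s.c := by
  obtain ⟨K₁, hK₁, h₁⟩ := exists_operator_bounds d
  obtain ⟨K₂, hK₂, h₂⟩ := exists_vel_bounds d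
  -- One constant for all hypotheses: `K₁` for the connection and curvature, `2 * K₂` for the full
  -- derivative of the velocity on the product space, `16` for `‖ξ‖`.
  obtain ⟨K, hK, h⟩ := exists_norm_posJac_sub_one_le (K₁ + 2 * K₂ + 16) (by positivity)
  obtain ⟨hs0, hs1, -⟩ := small_aux d
  refine ⟨min (small d) (1 / (2 * (K + 1))), K, lt_min hs0 (by positivity), min_le_left _ _, hK,
    ?_, fun B s => ?_⟩
  · calc K * min (small d) (1 / (2 * (K + 1))) ≤ (K + 1) * (1 / (2 * (K + 1))) := by
          gcongr
          · linarith
          · exact min_le_right _ _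
      _ = 1 / 2 := by field_simp
  have hF := isSymbFlow (d := d) (B := B) (c₀ := min (small d) (1 / (2 * (K + 1))))
  have hc := s.pos
  have hc1 : s.c ≤ 1 := s.le_small.trans hs1
  have b₁ := h₁ s.g s.c s.isSmooth s.pos s.le_small s.isSmall
  have b₂ := h₂ s.g s.c s.isSmooth s.pos s.le_small s.isSmall
  refine h (hF.smooth_conn s) (hF.curv s) (hF.isOpen_dom s) ((hF.symb_vel 0).smooth s)
    (hF.isOpen_par s) (hF.smooth s) (hF.deriv s) (hF.mem s) (hF.init s) hc.le hc1
    (fun x => (b₁ x).1.trans ?_) (fun x => (b₁ x).2.1.trans ?_) (fun w hw => hw.2.le.trans ?_)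
    (fun w hw => (b₂ w hw).1.trans ?_) (fun w hw => ?_) (fun w hw k => ?_)
  · gcongr; linarith
  · gcongr; linarith
  · linarith
  · linarith
  · refine ContinuousLinearMap.opNorm_le_bound _ (by positivity) fun k => ((b₂ w hw).2 k).trans ?_
    have e1 := norm_fst_le k
    have e2 := norm_snd_le k
    have e0 := norm_nonneg k
    calc K₂ * (s.c * ‖k.1‖ + ‖k.2‖) ≤ K₂ * (1 * ‖k‖ + ‖k‖) := by gcongr
      _ = 2 * K₂ * ‖k‖ := by ring
      _ ≤ _ := by gcongr; linarith
  · refine ((b₂ w hw).2 (k, 0)).trans ?_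
    simp only [norm_zero, add_zero, ← mul_assoc]
    gcongr
    linarith

/-! ### The position map for fixed momentum direction, and homogeneity. -/

section NearIdentity

variable (s : BoundedFlow d B c₀)

theorem X_eq (t : ℝ) (y : E d) {η : E d} (hη : η ≠ 0) : s.X t y η = s.X t y (‖η‖⁻¹ • η) :=
  (s.toBoundedMetric.flow_homogeneous s.isFlow t y hη).1

theorem hasFDerivAt_X (t : ℝ) (y : E d) {η : E d} (hη : η ≠ 0) :
    HasFDerivAt (fun y => s.X t y η)
      (posJac (fderiv ℝ (s.flow t) (y, ‖η‖⁻¹ • η))) y := by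
  simp only [s.X_eq t _ hη]
  have hp := BoundedMetric.unit_mem_annulus y hη
  have h1 := (((isSymbFlow.smooth_slice s t).contDiffAt
    ((isOpen_annulus d 2).mem_nhds hp)).differentiableAt (by simp)).hasFDerivAt
  have h2 : HasFDerivAt (fun y => s.flow t (y, ‖η‖⁻¹ • η)) _ y :=
    HasFDerivAt.comp (f := fun y => (y, ‖η‖⁻¹ • η)) y h1
      (hasFDerivAt_prodMk_left y (‖η‖⁻¹ • η))
  exact h2.fst

theorem contDiff_X (t : ℝ) {η : E d} (hη : η ≠ 0) : ContDiff ℝ ∞ fun y => s.X t y η := by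
  simp only [s.X_eq t _ hη]
  refine contDiff_iff_contDiffAt.2 fun y => ?_
  have h1 := (isSymbFlow.smooth_slice s t).contDiffAt
    ((isOpen_annulus d 2).mem_nhds (BoundedMetric.unit_mem_annulus y hη))
  exact (h1.comp y (contDiff_prodMk_left (‖η‖⁻¹ • η)).contDiffAt).fst

theorem bijective_X
    (hs : ∀ p ∈ annulus d 2, ∀ t, |t| ≤ 1 → ‖posJac (fderiv ℝ (s.flow t) p) - 1‖ ≤ 1 / 2)
    {t : ℝ} (ht : |t| ≤ 1) {η : E d} (hη : η ≠ 0) : Function.Bijective fun y => s.X t y η :=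
  bijective_of_norm_fderiv_sub_id_le (fun y => (s.hasFDerivAt_X t y hη).differentiableAt)
    fun y => by
      rw [(s.hasFDerivAt_X t y hη).fderiv]
      exact hs _ (BoundedMetric.unit_mem_annulus y hη) t ht

theorem inv_eq {η : E d} (hη : η ≠ 0) (t : ℝ) (x : E d) :
    s.inv t x η = Function.invFun (fun y => s.X t y η) x := by
  rw [inv]; simp only [s.X_eq t _ hη]

theorem leftInverse_inv
    (hs : ∀ p ∈ annulus d 2, ∀ t, |t| ≤ 1 → ‖posJac (fderiv ℝ (s.flow t) p) - 1‖ ≤ 1 / 2)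
    {t : ℝ} (ht : |t| ≤ 1) {η : E d} (hη : η ≠ 0) :
    Function.LeftInverse (fun x => s.inv t x η) (fun y => s.X t y η) := by
  simp only [s.inv_eq hη]
  exact Function.leftInverse_invFun (s.bijective_X hs ht hη).1

theorem rightInverse_inv
    (hs : ∀ p ∈ annulus d 2, ∀ t, |t| ≤ 1 → ‖posJac (fderiv ℝ (s.flow t) p) - 1‖ ≤ 1 / 2)
    {t : ℝ} (ht : |t| ≤ 1) {η : E d} (hη : η ≠ 0) :
    Function.RightInverse (fun x => s.inv t x η) (fun y => s.X t y η) := by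
  simp only [s.inv_eq hη]
  exact Function.rightInverse_invFun (s.bijective_X hs ht hη).2

theorem inv_smul (t : ℝ) (x : E d) (η : E d) {l : ℝ} (hl : 0 < l) :
    s.inv t x (l • η) = s.inv t x η := by
  have : ‖l • η‖⁻¹ • l • η = ‖η‖⁻¹ • η := by
    rw [norm_smul, Real.norm_of_nonneg hl.le, smul_smul, mul_inv]
    congr 1
    field_simp
  rw [inv, inv, this]

theorem mom_smul (t : ℝ) (y : E d) {η : E d} (hη : η ≠ 0) {l : ℝ} (hl : 0 < l) :
    s.Ξ t y (l • η) = l • s.Ξ t y η := by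
  have h1 := (s.toBoundedMetric.flow_homogeneous s.isFlow t y (smul_ne_zero hl.ne' hη)).2
  have h2 := (s.toBoundedMetric.flow_homogeneous s.isFlow t y hη).2
  have : ‖l • η‖⁻¹ • l • η = ‖η‖⁻¹ • η := by
    rw [norm_smul, Real.norm_of_nonneg hl.le, smul_smul, mul_inv]
    congr 1
    field_simp
  rw [h1, h2, this, norm_smul, Real.norm_of_nonneg hl.le, mul_smul]

end NearIdentity

theorem isInverse (hs : ∀ (s : BoundedFlow d B c₀), ∀ p ∈ annulus d 2, ∀ t, |t| ≤ 1 →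
    ‖posJac (fderiv ℝ (s.flow t) p) - 1‖ ≤ 1 / 2) :
    IsSymbFlow.IsInverse (fun _ : BoundedFlow d B c₀ => annulus d 2) flow invMap where
  jac := hs
  inj s t ht p hp q hq h := by
    simp only [posMap, flow, Prod.mk.injEq] at h
    have h2 : p.2 = q.2 := h.2
    have hη := snd_ne_zero_of_mem_annulus zero_le_two hq
    exact Prod.ext ((s.bijective_X (hs s) ht hη).1 (by simpa [h2] using h.1)) h2
  maps s t _ _ hz := hz
  right_inv s t ht z hz := by
    have hη := snd_ne_zero_of_mem_annulus zero_le_two hz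
    exact Prod.ext (s.rightInverse_inv (hs s) ht hη z.1) rfl

/-- Extending smoothness from the annulus by homogeneity. -/
theorem _root_.RoughWave.contDiffOn_of_homogeneous {u : E d × E d → E d} {k : ℕ}
    (h : ContDiffOn ℝ ∞ u (annulus d 2))
    (hu : ∀ q : E d × E d, q.2 ≠ 0 → ∀ l : ℝ, 0 < l → u (q.1, l • q.2) = l ^ k • u q) :
    ContDiffOn ℝ ∞ u {q | q.2 ≠ 0} := by
  intro q hq
  have hl := norm_pos_iff.2 hq
  have h1 : ContDiffAt ℝ ∞ (fun z : E d × E d => (z.1, ‖q.2‖⁻¹ • z.2)) q :=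
    (contDiff_fst.prodMk (contDiff_snd.const_smul _)).contDiffAt
  have h2 : ContDiffAt ℝ ∞ (fun z : E d × E d => (‖q.2‖ ^ k) • u (z.1, ‖q.2‖⁻¹ • z.2)) q :=
    ((h.contDiffAt ((isOpen_annulus d 2).mem_nhds
      (BoundedMetric.unit_mem_annulus q.1 hq))).comp q h1).const_smul _
  refine (h2.congr_of_eventuallyEq ?_).contDiffWithinAt
  filter_upwards [(isOpen_ne.preimage continuous_snd).mem_nhds hq] with z hz
  rw [hu z hz _ (inv_pos.2 hl), smul_smul, ← mul_pow, mul_inv_cancel₀ hl.ne', one_pow, one_smul]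

variable {s : BoundedFlow d B c₀} {t : ℝ}

/-- With `J` the Jacobian of the position map and `D` that of its inverse, `D - 1 = (1 - J) D`. The
bound `‖J - 1‖ ≤ 1 / 2` gives `‖D‖ ≤ 2`, and then the bound by `K` gives the factor `2 * K`. -/
theorem norm_fderiv_inv_sub_id_le {K : ℝ}
    (hs : ∀ p ∈ annulus d 2, ∀ t, |t| ≤ 1 → ‖posJac (fderiv ℝ (s.flow t) p) - 1‖ ≤ 1 / 2)
    (hK : ∀ p ∈ annulus d 2, ∀ t, |t| ≤ 1 → ‖posJac (fderiv ℝ (s.flow t) p) - 1‖ ≤ K)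
    (ht : |t| ≤ 1) {η : E d} (hη : η ≠ 0) {x : E d}
    (hd : DifferentiableAt ℝ (fun x => s.inv t x η) x) :
    ‖fderiv ℝ (fun x => s.inv t x η) x - ContinuousLinearMap.id ℝ (E d)‖ ≤ 2 * K := by
  set D := fderiv ℝ (fun x => s.inv t x η) x
  set J := posJac (fderiv ℝ (s.flow t) (s.inv t x η, ‖η‖⁻¹ • η))
  have hp := BoundedMetric.unit_mem_annulus (s.inv t x η) hη
  have h1 : J * D = 1 := by
    have h2 : HasFDerivAt (fun x => s.X t (s.inv t x η) η) (J.comp D) x :=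
      HasFDerivAt.comp (f := fun x => s.inv t x η) x (s.hasFDerivAt_X t (s.inv t x η) hη)
        hd.hasFDerivAt
    have h3 : (fun x => s.X t (s.inv t x η) η) = id := funext (s.rightInverse_inv hs ht hη)
    rw [h3] at h2
    exact h2.unique (hasFDerivAt_id x)
  have h2 : D - 1 = (1 - J) * D := by rw [sub_mul, one_mul, h1]
  have h3 : ‖D - 1‖ ≤ ‖J - 1‖ * ‖D‖ := by rw [h2, norm_sub_rev J 1]; exact norm_mul_le _ _
  have h4 := hs _ hp t ht
  have h5 := hK _ hp t ht
  have h6 : ‖D‖ ≤ 2 := by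
    have e1 : ‖D‖ ≤ ‖D - 1‖ + ‖(1 : E d →L[ℝ] E d)‖ := norm_le_norm_sub_add D 1
    have e2 : ‖(1 : E d →L[ℝ] E d)‖ ≤ 1 := ContinuousLinearMap.norm_id_le
    have e3 : ‖J - 1‖ * ‖D‖ ≤ 1 / 2 * ‖D‖ := by gcongr
    linarith
  change ‖D - 1‖ ≤ _
  calc ‖D - 1‖ ≤ ‖J - 1‖ * ‖D‖ := h3
    _ ≤ K * 2 := by gcongr; exact (norm_nonneg _).trans h5
    _ = 2 * K := mul_comm _ _

end BoundedFlow

/-- Derivative bounds on the annulus, extended by homogeneity. -/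
theorem norm_mixedDeriv_le_of_symb {ι : Type*} {M : ι → ℝ} {u : ι → E d → E d → E d} {k : ℤ}
    (hu : ∀ i x η, η ≠ 0 → ∀ l : ℝ, 0 < l → u i x (l • η) = l ^ k • u i x η)
    (hsm : ∀ i, ContDiffOn ℝ ∞ (fun q : E d × E d => u i q.1 q.2) (annulus d 2))
    (h : ∀ N, Symb N 0 M (fun _ => annulus d 2)
      (fun i => fderiv ℝ (fun q : E d × E d => u i q.1 q.2))) (n : ℕ) :
    ∃ C : ℝ, 0 ≤ C ∧ ∀ i (β α : Fin d → ℕ) x η, η ≠ 0 → 1 ≤ order α + order β →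
      order α + order β = n → ‖mixedDeriv β α (u i) x η‖ ≤
        C * M i ^ (order α + order β - 1) * ‖η‖ ^ (k - order α) := by
  obtain ⟨C, hC0, hC⟩ := (h n).bound_nonneg (Nat.sub_le n 1)
  refine ⟨C, hC0, fun i β α x η hη h1 hn => ?_⟩
  have hp := BoundedMetric.unit_mem_annulus x hη
  rw [mixedDeriv_homogeneous (hu i) β α x hη, norm_smul,
    Real.norm_of_nonneg (zpow_nonneg (norm_nonneg _) _), mul_comm]
  gcongr
  refine (norm_mixedDeriv_le (isOpen_annulus d 2) (hsm i) β α hp).trans ?_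
  have h2 := hC i _ hp
  -- A derivative of total order `n ≥ 1` is one of order `n - 1` of the differential, a weight `0`
  -- symbol; this is the source of the power `M ^ (n - 1)`.
  rw [norm_iteratedFDeriv_fderiv, Nat.sub_add_cancel (by omega), Nat.sub_zero, ← hn] at h2
  exact h2

end RoughWave

/-! ### The main estimates -/

namespace RoughWave

open PhaseFlow

namespace BoundedFlow

variable {d : ℕ} {B : (Fin d → ℕ) → ℝ} {c₀ : ℝ}

theorem contDiffOn_inv (hΨ : IsSymbFlow.IsInverse (fun _ : BoundedFlow d B c₀ => annulus d 2)
    flow invMap) (s : BoundedFlow d B c₀) {t : ℝ} (ht : |t| ≤ 1) :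
    ContDiffOn ℝ ∞ (fun q : E d × E d => s.inv t q.1 q.2) (annulus d 2) :=
  (isSymbFlow.contDiffOn_inv hΨ s ht).fst

theorem contDiffOn_mom (hΨ : IsSymbFlow.IsInverse (fun _ : BoundedFlow d B c₀ => annulus d 2)
    flow invMap) (s : BoundedFlow d B c₀) {t : ℝ} (ht : |t| ≤ 1) :
    ContDiffOn ℝ ∞ (fun q : E d × E d => s.Ξ t (s.inv t q.1 q.2) q.2) (annulus d 2) :=
  ((isSymbFlow.smooth_slice s t).comp (isSymbFlow.contDiffOn_inv hΨ s ht)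
    (hΨ.maps s t ht)).snd

/-- Exhibits the inverse as the identity plus `t` times a function with uniform bounds. At `t = 0`
it holds because the position map is then the identity. -/
theorem inv_eq_add_smul (s : BoundedFlow d B c₀) (t : ℝ) (x : E d) {η : E d} (hη : η ≠ 0) :
    s.inv t x η = x + t • t⁻¹ • (s.inv t x η - x) := by
  rcases eq_or_ne t 0 with rfl | ht
  · have h : (fun y => s.X 0 y η) = id := funext fun y => s.isFlow.init_pos y η hη
    have hid : Function.LeftInverse (Function.invFun (id : E d → E d)) id :=
      Function.leftInverse_invFun Function.injective_id
    rw [s.inv_eq hη, h, zero_smul, add_zero]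
    exact hid x
  · rw [smul_smul, mul_inv_cancel₀ ht, one_smul, add_sub_cancel]

/-- Uniform bounds for the inverse, its displacement, and the momentum. -/
theorem exists_mixedDeriv_bounds
    (hΨ : IsSymbFlow.IsInverse (fun _ : BoundedFlow d B c₀ => annulus d 2) flow invMap) (n : ℕ) :
    ∃ C : ℝ, ∀ (s : BoundedFlow d B c₀) (t : ℝ), |t| ≤ 1 → ∀ (β α : Fin d → ℕ) (x η : E d), η ≠ 0 →
      1 ≤ order α + order β → order α + order β = n →
      ‖mixedDeriv β α (s.inv t) x η‖ ≤
        C * s.M ^ (order α + order β - 1) * ‖η‖ ^ (-(order α : ℤ)) ∧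
      (1 ≤ order α ∨ 2 ≤ order β → ‖mixedDeriv β α (s.inv t) x η‖ ≤
        C * |t| * s.M ^ (order α + order β - 1) * ‖η‖ ^ (-(order α : ℤ))) ∧
      ‖mixedDeriv β α (fun x η => s.Ξ t (s.inv t x η) η) x η‖ ≤
        C * s.M ^ (order α + order β - 1) * ‖η‖ ^ (1 - (order α : ℤ)) := by
  have hF := isSymbFlow (d := d) (B := B) (c₀ := c₀)
  have hsm : ∀ j : BoundedFlow d B c₀ × UnitTime, ContDiffOn ℝ ∞
      (fun q : E d × E d => j.1.inv j.2 q.1 q.2) (annulus d 2) := fun j =>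
    contDiffOn_inv hΨ j.1 j.2.2
  have hone : ∀ j : BoundedFlow d B c₀ × UnitTime, 1 ≤ j.1.M := fun j => j.1.one_le
  obtain ⟨C₁, hC₁, h₁⟩ := norm_mixedDeriv_le_of_symb (k := 0)
    (u := fun (j : BoundedFlow d B c₀ × UnitTime) => j.1.inv j.2)
    (fun j x η _ l hl => by rw [zpow_zero, one_smul, j.1.inv_smul _ _ _ hl]) hsm
    (fun N => ((Symb.const hone (fun _ => isOpen_annulus d 2)
      (ContinuousLinearMap.fst ℝ (E d) (E d))).clm_comp zero_le_one
      (hF.symb_fderiv_inv hΨ N)).congr fun j q hq =>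
        ((hF.contDiffAt_inv hΨ j.1 j.2.2 hq).2.differentiableAt.hasFDerivAt.fst).fderiv) n
  -- The displacement quotient, homogeneous of degree `0` like the inverse itself; multiplied by `t`
  -- it yields the bounds with the factor `|t|`.
  obtain ⟨C₂, hC₂, h₂⟩ := norm_mixedDeriv_le_of_symb (k := 0)
    (u := fun (j : BoundedFlow d B c₀ × UnitTime) x η => (j.2 : ℝ)⁻¹ • (j.1.inv j.2 x η - x))
    (fun j x η _ l hl => by rw [zpow_zero, one_smul, j.1.inv_smul _ _ _ hl])
    (fun j => ((hsm j).sub contDiffOn_fst).const_smul _)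
    (fun N => hF.symb_fderiv_inv_displacement hΨ N) n
  obtain ⟨C₃, hC₃, h₃⟩ := norm_mixedDeriv_le_of_symb (k := 1)
    (u := fun (j : BoundedFlow d B c₀ × UnitTime) x η => j.1.Ξ j.2 (j.1.inv j.2 x η) η)
    (fun j x η hη l hl => by rw [zpow_one, j.1.inv_smul _ _ _ hl, j.1.mom_smul _ _ hη hl])
    (fun j => contDiffOn_mom hΨ j.1 j.2.2)
    (fun N => hF.symb_fderiv_momentum hΨ N) n
  refine ⟨C₁ + C₂ + C₃, fun s t ht β α x η hη h1 hn => ⟨?_, fun h2 => ?_, ?_⟩⟩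
  · have hM := s.one_le
    refine (h₁ (s, ⟨t, ht⟩) β α x η hη h1 hn).trans ?_
    rw [zero_sub]
    gcongr
    linarith
  · have hM := s.one_le
    have hd : Differentiable ℝ fun x => t⁻¹ • (s.inv t x η - x) := fun x => by
      have h3 := contDiffOn_of_homogeneous (k := 0) (hsm (s, ⟨t, ht⟩)) fun q _ l hl => by
        rw [pow_zero, one_smul]; exact s.inv_smul _ _ _ hl
      have h4 := (h3.contDiffAt ((isOpen_ne.preimage continuous_snd).mem_nhds
        (x := (x, η)) hη)).differentiableAt (by simp)
      have h5 : DifferentiableAt ℝ (fun x => s.inv t x η) x :=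
        h4.comp (f := fun x => (x, η)) x (hasFDerivAt_prodMk_left x η).differentiableAt
      exact (h5.sub differentiableAt_id).const_smul t⁻¹
    have h5 : mixedDeriv β α (s.inv t) x η =
        mixedDeriv β α (fun x η => x + t • t⁻¹ • (s.inv t x η - x)) x η :=
      mixedDeriv_congr (fun x η hη => s.inv_eq_add_smul t x hη) β α x hη
    rw [h5, mixedDeriv_id_add_smul hd β α h2, norm_smul, Real.norm_eq_abs]
    have h6 := h₂ (s, ⟨t, ht⟩) β α x η hη h1 hn
    rw [zero_sub] at h6
    calc _ ≤ |t| * (C₂ * s.M ^ (order α + order β - 1) * ‖η‖ ^ (-(order α : ℤ))) := by gcongr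
      _ = C₂ * |t| * s.M ^ (order α + order β - 1) * ‖η‖ ^ (-(order α : ℤ)) := by ring
      _ ≤ _ := by gcongr; linarith
  · have hM := s.one_le
    refine (h₃ (s, ⟨t, ht⟩) β α x η hη h1 hn).trans ?_
    gcongr
    linarith

end BoundedFlow

end RoughWave

end

theorem theorem3p3 (d : ℕ) :
    -- `c₀` and `K` depend only on the dimension
    ∃ c₀ : ℝ, 0 < c₀ ∧ ∃ K : ℝ,
    -- `C α β` depends only on the constants `B`
    ∀ B : (Fin d → ℕ) → ℝ, ∃ C : (Fin d → ℕ) → (Fin d → ℕ) → ℝ,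
    ∀ (M : ℝ) (c : ℝ) (g : RoughWave.E d → Matrix (Fin d) (Fin d) ℝ),
      1 ≤ M → 0 < c → c ≤ c₀ →
      RoughWave.IsSmoothMetric g → RoughWave.SmallMetric g c → RoughWave.DerivBounds g B M →
      (∃ X Ξ, RoughWave.IsHamiltonianFlow g X Ξ) ∧
      ∀ X Ξ : ℝ → RoughWave.E d → RoughWave.E d → RoughWave.E d,
        RoughWave.IsHamiltonianFlow g X Ξ →
        ∃ Y : ℝ → RoughWave.E d → RoughWave.E d → RoughWave.E d,
          ∀ t : ℝ, |t| ≤ 1 →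
            -- joint smoothness in `(x, η)`, `η ≠ 0`, of `y(t,x,η)` and `ξ(t,x,η)`
            ContDiffOn ℝ ∞ (fun q : RoughWave.E d × RoughWave.E d => Y t q.1 q.2)
              {q | q.2 ≠ 0} ∧
            ContDiffOn ℝ ∞ (fun q : RoughWave.E d × RoughWave.E d => Ξ t (Y t q.1 q.2) q.2)
              {q | q.2 ≠ 0} ∧
            ∀ η : RoughWave.E d, η ≠ 0 →
              -- `y ↦ x(t,y,η)` is a diffeomorphism with inverse `x ↦ y(t,x,η)`
              ContDiff ℝ ∞ (fun y => X t y η) ∧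
              ContDiff ℝ ∞ (fun x => Y t x η) ∧
              Function.LeftInverse (fun x => Y t x η) (fun y => X t y η) ∧
              Function.RightInverse (fun x => Y t x η) (fun y => X t y η) ∧
              ∀ x : RoughWave.E d,
                ‖fderiv ℝ (fun x' => Y t x' η) x - ContinuousLinearMap.id ℝ (RoughWave.E d)‖
                  ≤ K * c ∧
                ∀ α β : Fin d → ℕ,
                  (1 ≤ RoughWave.order α + RoughWave.order β →
                    ‖RoughWave.mixedDeriv β α (Y t) x η‖
                      ≤ C α β * M ^ (RoughWave.order α + RoughWave.order β - 1)
                        * ‖η‖ ^ (-(RoughWave.order α : ℤ))) ∧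
                  (1 ≤ RoughWave.order α ∨ 2 ≤ RoughWave.order β →
                    ‖RoughWave.mixedDeriv β α (Y t) x η‖
                      ≤ C α β * |t| * M ^ (RoughWave.order α + RoughWave.order β - 1)
                        * ‖η‖ ^ (-(RoughWave.order α : ℤ))) ∧
                  (1 ≤ RoughWave.order α + RoughWave.order β →
                    ‖RoughWave.mixedDeriv β α (fun x' η' => Ξ t (Y t x' η') η') x η‖
                      ≤ C α β * M ^ (RoughWave.order α + RoughWave.order β - 1)
                        * ‖η‖ ^ (1 - (RoughWave.order α : ℤ))) := by
  obtain ⟨c₀, K, hc₀, hc₀s, hK, hKc, hjac⟩ := RoughWave.BoundedFlow.exists_threshold d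
  -- The factor `2` is lost in passing from the Jacobian of the position map to that of its inverse.
  refine ⟨c₀, hc₀, 2 * K, fun B => ?_⟩
  have hs : ∀ (s : RoughWave.BoundedFlow d B c₀), ∀ p ∈ RoughWave.annulus d 2, ∀ t, |t| ≤ 1 →
      ‖PhaseFlow.posJac (fderiv ℝ (s.flow t) p) - 1‖ ≤ 1 / 2 := fun s p hp t ht =>
    (hjac B s p hp t ht).trans ((mul_le_mul_of_nonneg_left s.le hK).trans hKc)
  have hΨ := RoughWave.BoundedFlow.isInverse hs
  choose C hC using RoughWave.BoundedFlow.exists_mixedDeriv_bounds hΨ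
  -- The constants come from bounds on full iterated derivatives, so they depend on `α` and `β` only
  -- through the total order.
  refine ⟨fun α β => C (RoughWave.order α + RoughWave.order β),
    fun M c g hM hc hcc hg hsmall hb => ?_⟩
  let m : RoughWave.BoundedMetric d B := ⟨g, M, c, hM, hc, hcc.trans hc₀s, hg, hsmall, hb⟩
  refine ⟨m.exists_isHamiltonianFlow, fun X Ξ hflow => ?_⟩
  let s : RoughWave.BoundedFlow d B c₀ := ⟨m, X, Ξ, hcc, hflow⟩
  refine ⟨s.inv, fun t ht => ?_⟩
  have hY : ContDiffOn ℝ ∞ (fun q : RoughWave.E d × RoughWave.E d => s.inv t q.1 q.2)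
      {q | q.2 ≠ 0} :=
    RoughWave.contDiffOn_of_homogeneous (k := 0) (RoughWave.BoundedFlow.contDiffOn_inv hΨ s ht)
      fun q _ l hl => by rw [pow_zero, one_smul]; exact s.inv_smul _ _ _ hl
  refine ⟨hY, RoughWave.contDiffOn_of_homogeneous (k := 1)
    (RoughWave.BoundedFlow.contDiffOn_mom hΨ s ht) fun q hq l hl => ?_, fun η hη => ?_⟩
  · change s.Ξ t (s.inv t q.1 (l • q.2)) (l • q.2) = l ^ 1 • s.Ξ t (s.inv t q.1 q.2) q.2
    rw [pow_one, s.inv_smul _ _ _ hl, s.mom_smul _ _ hq hl]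
  have hYη : ContDiff ℝ ∞ fun x => s.inv t x η := contDiffOn_univ.1
    (hY.comp (f := fun x => (x, η)) (contDiff_prodMk_left η).contDiffOn fun _ _ => hη)
  refine ⟨s.contDiff_X t hη, hYη, s.leftInverse_inv (hs s) ht hη, s.rightInverse_inv (hs s) ht hη,
    fun x => ⟨?_, fun α β => ⟨fun h => (hC _ s t ht β α x η hη h rfl).1, fun h =>
      (hC _ s t ht β α x η hη (by omega) rfl).2.1 h,
      fun h => (hC _ s t ht β α x η hη h rfl).2.2⟩⟩⟩
  rw [mul_assoc]
  exact RoughWave.BoundedFlow.norm_fderiv_inv_sub_id_le (hs s) (hjac B s) ht hη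
    (hYη.differentiable (by simp) x)
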